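/- Conventions. Let $k$ be a field; $\otimes=\otimes_k$, algebras are associative and unital over $k$ unless said otherwise, and tensors are written in Sweedler style with summation understood. A quasi-Hopf algebra $H$ is an algebra with algebra maps $\Delta:H\to H\otimes H$, $\Delta(h)=h_1\otimes h_2$, and $\varepsilon:H\to k$, an invertible $\Phi=X^1\otimes X^2\otimes X^3\in H^{\otimes 3}$ with inverse $\Phi^{-1}=x^1\otimes x^2\otimes x^3$, an algebra anti-automorphism $S$ of $H$ and $\alpha,\beta\in H$, such that $$(\mathrm{id}\otimes\Delta)\Delta(h)=\Phi(\Delta\otimes\mathrm{id})(\Delta(h))\Phi^{-1},\quad (\mathrm{id}\otimes\varepsilon)\Delta(h)=h=(\varepsilon\otimes\mathrm{id})\Delta(h),$$ $$(1\otimes\Phi)(\mathrm{id}\otimes\Delta\otimes\mathrm{id})(\Phi)(\Phi\otimes1)=(\mathrm{id}\otimes\mathrm{id}\otimes\Delta)(\Phi)(\Delta\otimes\mathrm{id}\otimes\mathrm{id})(\Phi),$$ applying $\varepsilon$ to any one factor of $\Phi$ gives $1\otimes1$, and $$S(h_1)\alpha h_2=\varepsilon(h)\alpha,\quad h_1\beta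 S(h_2)=\varepsilon(h)\beta,\quad X^1\beta S(X^2)\alpha X^3=1=S(x^1)\alpha x^2\beta S(x^3),$$ normalized by $\varepsilon(\alpha)=\varepsilon(\beta)=1$. Put $A^1\otimes A^2\otimes A^3\otimes A^4=(\Phi\otimes1)(\Delta\otimes\mathrm{id}\otimes\mathrm{id})(\Phi^{-1})$, $g=S(A^2)\alpha A^3\otimes S(A^1)\alpha A^4$ and $$f=f^1\otimes f^2=\bigl(S((x^1)_2)\otimes S((x^1)_1)\bigr)\,g\,\Delta\bigl(x^2\beta S(x^3)\bigr).$$ An $H$-bimodule algebra $\mathcal A$ is an $H$-bimodule with a $k$-bilinear (not necessarily associative) multiplication with unit $1_{\mathcal A}$ such that $(\varphi\psi)\xi=(X^1\cdot\varphi\cdot x^1)[(X^2\cdot\psi\cdot x^2)(X^3\cdot\xi\cdot x^3)]$, $h\cdot(\varphi\psi)=(h_1\cdot\varphi)(h_2\cdot\psi)$, $(\varphi\psi)\cdot h=(\varphi\cdot h_1)(\psi\cdot h_2)$ and $h\cdot1_{\mathcal A}=\varepsilon(h)1_{\mathcal A}=1_{\mathcal A}\cdot h$. An $H$-bicomodule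 algebra $\mathbb A$ is an algebra with algebra maps $\lambda:\mathbb A\to H\otimes\mathbb A$, $\lambda(u)=u_{[-1]}\otimes u_{[0]}$, and $\rho:\mathbb A\to\mathbb A\otimes H$, $\rho(u)=u_{<0>}\otimes u_{<1>}$, and invertible elements $\Phi_\lambda=\tilde X^1_\lambda\otimes\tilde X^2_\lambda\otimes\tilde X^3_\lambda\in H\otimes H\otimes\mathbb A$, $\Phi_\rho=\tilde X^1_\rho\otimes\tilde X^2_\rho\otimes\tilde X^3_\rho\in\mathbb A\otimes H\otimes H$, $\Phi_{\lambda,\rho}\in H\otimes\mathbb A\otimes H$, with inverses $\Phi_\lambda^{-1}=\tilde x^1_\lambda\otimes\tilde x^2_\lambda\otimes\tilde x^3_\lambda$, $\Phi_\rho^{-1}=\tilde x^1_\rho\otimes\tilde x^2_\rho\otimes\tilde x^3_\rho$, $\Phi_{\lambda,\rho}^{-1}=\theta^1\otimes\theta^2\otimes\theta^3$, such that for all $u\in\mathbb A$: $$\Phi_\rho(\rho\otimes\mathrm{id})\rho(u)=(\mathrm{id}\otimes\Delta)(\rho(u))\Phi_\rho,\qquad(\mathrm{id}\otimes\lambda)(\lambda(u))\Phi_\lambda=\Phi_\lambda(\Delta\otimes\mathrm{id})\lambda(u),$$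 $$\Phi_{\lambda,\rho}(\lambda\otimes\mathrm{id})\rho(u)=(\mathrm{id}\otimes\rho)(\lambda(u))\Phi_{\lambda,\rho},$$ $$(1\otimes\Phi)(\mathrm{id}\otimes\Delta\otimes\mathrm{id})(\Phi_\rho)(\Phi_\rho\otimes1)=(\mathrm{id}\otimes\mathrm{id}\otimes\Delta)(\Phi_\rho)(\rho\otimes\mathrm{id}\otimes\mathrm{id})(\Phi_\rho),$$ $$(1\otimes\Phi_\lambda)(\mathrm{id}\otimes\Delta\otimes\mathrm{id})(\Phi_\lambda)(\Phi\otimes1)=(\mathrm{id}\otimes\mathrm{id}\otimes\lambda)(\Phi_\lambda)(\Delta\otimes\mathrm{id}\otimes\mathrm{id})(\Phi_\lambda),$$ $$(1\otimes\Phi_{\lambda,\rho})(\mathrm{id}\otimes\lambda\otimes\mathrm{id})(\Phi_{\lambda,\rho})(\Phi_\lambda\otimes1)=(\mathrm{id}\otimes\mathrm{id}\otimes\rho)(\Phi_\lambda)(\Delta\otimes\mathrm{id}\otimes\mathrm{id})(\Phi_{\lambda,\rho}),$$ $$(1\otimes\Phi_\rho)(\mathrm{id}\otimes\rho\otimes\mathrm{id})(\Phi_{\lambda,\rho})(\Phi_{\lambda,\rho}\otimes1)=(\mathrm{id}\otimes\mathrm{id}\otimes\Delta)(\Phi_{\lambda,\rho})(\lambda\otimes\mathrm{id}\otimes\mathrm{id})(\Phi_\rho),$$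 $(\mathrm{id}\otimes\varepsilon)\rho=\mathrm{id}=(\varepsilon\otimes\mathrm{id})\lambda$, and applying $\varepsilon$ to any one $H$-factor of $\Phi_\lambda$ or $\Phi_\rho$ gives $1\otimes1$. Let $$\tilde p=\tilde p^1\otimes\tilde p^2=\tilde x^1_\rho\otimes\tilde x^2_\rho\beta S(\tilde x^3_\rho),\qquad\tilde q=\tilde q^1\otimes\tilde q^2=\tilde X^1_\rho\otimes S^{-1}(\alpha\tilde X^3_\rho)\tilde X^2_\rho\quad\text{in }\mathbb A\otimes H,$$ and let $\Omega=\Omega^1\otimes\cdots\otimes\Omega^5\in H^{\otimes2}\otimes\mathbb A\otimes H^{\otimes2}$ be the element $$(\tilde X^1_\rho)_{[-1]_1}\tilde x^1_\lambda\theta^1\otimes(\tilde X^1_\rho)_{[-1]_2}\tilde x^2_\lambda\theta^2_{[-1]}\otimes(\tilde X^1_\rho)_{[0]}\tilde x^3_\lambda\theta^2_{[0]}\otimes S^{-1}(f^1\tilde X^2_\rho\theta^3)\otimes S^{-1}(f^2\tilde X^3_\rho).$$ The generalized diagonal crossed product $\mathcal A\bowtie\mathbb A$ is $\mathcal A\otimes\mathbb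 A$ (with $\varphi\bowtie u$ for $\varphi\otimes u$), with unit $1_{\mathcal A}\bowtie1_{\mathbb A}$ and multiplication $$(\varphi\bowtie u)(\varphi'\bowtie u')=(\Omega^1\cdot\varphi\cdot\Omega^5)(\Omega^2u_{<0>_{[-1]}}\cdot\varphi'\cdot S^{-1}(u_{<1>})\Omega^4)\bowtie\Omega^3u_{<0>_{[0]}}u'.$$ Define linear maps $\Gamma:\mathcal A\to\mathcal A\bowtie\mathbb A$, $\Gamma(\varphi)=\tilde p^1_{[-1]}\cdot\varphi\cdot S^{-1}(\tilde p^2)\bowtie\tilde p^1_{[0]}$, and $j:\mathbb A\to\mathcal A\bowtie\mathbb A$, $j(u)=1_{\mathcal A}\bowtie u$. Proposition. Let $H$ be a quasi-Hopf algebra, $\mathcal A$ an $H$-bimodule algebra, $\mathbb A$ an $H$-bicomodule algebra, $B$ an associative unital algebra, $\gamma:\mathbb A\to B$ an algebra map and $v:\mathcal A\to B$ a linear map such that, for all $\varphi,\varphi'\in\mathcal A$ and $u\in\mathbb A$, $$\gamma(u_{<0>})v(\varphi\cdot u_{<1>})=v(u_{[-1]}\cdot\varphi)\gamma(u_{[0]}),$$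 $$v(\varphi\varphi')=\gamma(\tilde X^1_\rho)\,v(\theta^1\tilde X^1_\lambda\cdot\varphi\cdot\tilde X^2_\rho)\,\gamma(\theta^2)\,v(\tilde X^2_\lambda\cdot\varphi'\cdot\tilde X^3_\rho\theta^3)\,\gamma(\tilde X^3_\lambda),$$ $$v(1_{\mathcal A})=1_B.$$ Then there exists a unique algebra map (that is, a linear map preserving the unit and products) $w:\mathcal A\bowtie\mathbb A\to B$ such that $w\circ\Gamma=v$ and $w\circ j=\gamma$. Moreover, for all $\varphi\in\mathcal A$ and $u\in\mathbb A$, $$w(\varphi\bowtie u)=\gamma(\tilde q^1)\,v(\varphi\cdot\tilde q^2)\,\gamma(u).$$ -/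

import Mathlib

open scoped TensorProduct

noncomputable section

namespace QuasiHopf

/-! ### Evaluating Sweedler-type expressions -/

section Sweedler

variable {k : Type*} [Field k]

/-- The linear map `x ⊗ y ↦ f x * g y`. Iterating it evaluates Sweedler-type products. -/
def prodMap {X Y E : Type*} [AddCommMonoid X] [Module k X] [AddCommMonoid Y] [Module k Y]
    [NonUnitalNonAssocSemiring E] [Module k E] [SMulCommClass k E E] [IsScalarTower k E E]
    (f : X →ₗ[k] E) (g : Y →ₗ[k] E) : X ⊗[k] Y →ₗ[k] E :=
  LinearMap.mul' k E ∘ₗ TensorProduct.map f g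

@[simp] theorem prodMap_tmul {X Y E : Type*} [AddCommMonoid X] [Module k X] [AddCommMonoid Y]
    [Module k Y] [NonUnitalNonAssocSemiring E] [Module k E] [SMulCommClass k E E]
    [IsScalarTower k E E] (f : X →ₗ[k] E) (g : Y →ₗ[k] E) (x : X) (y : Y) :
    prodMap f g (x ⊗ₜ[k] y) = f x * g y := by
  simp [prodMap]

/-- Let an endomorphism act on the first tensor factor. -/
def onFst (M N : Type*) [AddCommMonoid M] [Module k M] [AddCommMonoid N] [Module k N] :
    Module.End k M →ₗ[k] Module.End k (M ⊗[k] N) :=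
  LinearMap.rTensorHom N

/-- Let an endomorphism act on the second tensor factor. -/
def onSnd (M N : Type*) [AddCommMonoid M] [Module k M] [AddCommMonoid N] [Module k N] :
    Module.End k N →ₗ[k] Module.End k (M ⊗[k] N) :=
  LinearMap.lTensorHom M

@[simp] theorem onFst_tmul {M N : Type*} [AddCommMonoid M] [Module k M] [AddCommMonoid N]
    [Module k N] (f : Module.End k M) (m : M) (n : N) :
    onFst M N f (m ⊗ₜ[k] n) = f m ⊗ₜ[k] n := by
  simp [onFst]

@[simp] theorem onSnd_tmul {M N : Type*} [AddCommMonoid M] [Module k M] [AddCommMonoid N]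
    [Module k N] (f : Module.End k N) (m : M) (n : N) :
    onSnd M N f (m ⊗ₜ[k] n) = m ⊗ₜ[k] f n := by
  simp [onSnd]

/-- If `X` acts on `M` and `Y` acts on `N`, then `X ⊗ Y` acts on `M ⊗ N`, factor by factor. -/
def tensorAct {X Y M N : Type*} [AddCommMonoid X] [Module k X] [AddCommMonoid Y] [Module k Y]
    [AddCommMonoid M] [Module k M] [AddCommMonoid N] [Module k N]
    (a : X →ₗ[k] Module.End k M) (b : Y →ₗ[k] Module.End k N) :
    X ⊗[k] Y →ₗ[k] Module.End k (M ⊗[k] N) :=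
  prodMap (onFst M N ∘ₗ a) (onSnd M N ∘ₗ b)

@[simp] theorem tensorAct_tmul {X Y M N : Type*} [AddCommMonoid X] [Module k X]
    [AddCommMonoid Y] [Module k Y] [AddCommMonoid M] [Module k M] [AddCommMonoid N] [Module k N]
    (a : X →ₗ[k] Module.End k M) (b : Y →ₗ[k] Module.End k N) (x : X) (y : Y) (m : M) (n : N) :
    tensorAct a b (x ⊗ₜ[k] y) (m ⊗ₜ[k] n) = a x m ⊗ₜ[k] b y n := by
  simp [tensorAct]

/-- For an algebra map `f : X → Y ⊗ Z`, the algebra map `f ⊗ id : X ⊗ W → Y ⊗ (Z ⊗ W)`. All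
iterated tensor products are bracketed to the right. -/
def splitFst {X Y Z : Type*} [Ring X] [Algebra k X] [Ring Y] [Algebra k Y] [Ring Z]
    [Algebra k Z] (W : Type*) [Ring W] [Algebra k W] (f : X →ₐ[k] Y ⊗[k] Z) :
    X ⊗[k] W →ₐ[k] Y ⊗[k] (Z ⊗[k] W) :=
  (Algebra.TensorProduct.assoc k k k Y Z W).toAlgHom.comp
    (Algebra.TensorProduct.map f (AlgHom.id k W))

/-- The algebra map `id ⊗ f : W ⊗ X → W ⊗ Y`. -/
def onRight {X Y : Type*} [Ring X] [Algebra k X] [Ring Y] [Algebra k Y]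
    (W : Type*) [Ring W] [Algebra k W] (f : X →ₐ[k] Y) : W ⊗[k] X →ₐ[k] W ⊗[k] Y :=
  Algebra.TensorProduct.map (AlgHom.id k W) f

/-- The algebra map `f ⊗ id : X ⊗ W → Y ⊗ W`. -/
def onLeft {X Y : Type*} [Ring X] [Algebra k X] [Ring Y] [Algebra k Y]
    (W : Type*) [Ring W] [Algebra k W] (f : X →ₐ[k] Y) : X ⊗[k] W →ₐ[k] Y ⊗[k] W :=
  Algebra.TensorProduct.map f (AlgHom.id k W)

/-- The algebra map `x ↦ x ⊗ 1`. -/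
def tmulOne (X W : Type*) [Ring X] [Algebra k X] [Ring W] [Algebra k W] :
    X →ₐ[k] X ⊗[k] W :=
  Algebra.TensorProduct.includeLeft

/-- The algebra map `x ↦ 1 ⊗ x`. -/
def oneTmul (W X : Type*) [Ring X] [Algebra k X] [Ring W] [Algebra k W] :
    X →ₐ[k] W ⊗[k] X :=
  Algebra.TensorProduct.includeRight

end Sweedler

/-! ### Quasi-bialgebras and quasi-Hopf algebras -/

/-- A quasi-bialgebra `(H, Δ, ε, Φ)` over the field `k`. -/
class QuasiBialgebra (k H : Type*) [Field k] [Ring H] [Algebra k H] where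
  /-- the coproduct `Δ` -/
  comul : H →ₐ[k] H ⊗[k] H
  /-- the counit `ε` -/
  counit : H →ₐ[k] k
  /-- the reassociator `Φ` -/
  Phi : (H ⊗[k] (H ⊗[k] H))ˣ
  /-- `(id ⊗ Δ)(Δ(h)) = Φ (Δ ⊗ id)(Δ(h)) Φ⁻¹` -/
  coassoc : ∀ h : H, onRight H comul (comul h) =
    (Phi : H ⊗[k] (H ⊗[k] H)) * splitFst H comul (comul h) * ((Phi⁻¹ : (H ⊗[k] (H ⊗[k] H))ˣ) :
      H ⊗[k] (H ⊗[k] H))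
  /-- `(id ⊗ ε)(Δ(h)) = h ⊗ 1` -/
  counit_right : ∀ h : H, onRight H counit (comul h) = h ⊗ₜ[k] 1
  /-- `(ε ⊗ id)(Δ(h)) = 1 ⊗ h` -/
  counit_left : ∀ h : H, onLeft H counit (comul h) = 1 ⊗ₜ[k] h
  /-- `(1 ⊗ Φ)(id ⊗ Δ ⊗ id)(Φ)(Φ ⊗ 1) = (id ⊗ id ⊗ Δ)(Φ)(Δ ⊗ id ⊗ id)(Φ)` -/
  pentagon : oneTmul H (H ⊗[k] (H ⊗[k] H)) Phi * onRight H (splitFst H comul) Phi *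
      onRight H (onRight H (tmulOne H H)) Phi =
    onRight H (onRight H comul) Phi * splitFst (H ⊗[k] H) comul Phi
  /-- `(ε ⊗ id ⊗ id)(Φ) = 1` -/
  counit_Phi_fst : onLeft (H ⊗[k] H) counit (Phi : H ⊗[k] (H ⊗[k] H)) = 1
  /-- `(id ⊗ ε ⊗ id)(Φ) = 1` -/
  counit_Phi_snd : onRight H (onLeft H counit) (Phi : H ⊗[k] (H ⊗[k] H)) = 1
  /-- `(id ⊗ id ⊗ ε)(Φ) = 1` -/
  counit_Phi_trd : onRight H (onRight H counit) (Phi : H ⊗[k] (H ⊗[k] H)) = 1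

/-- The reassociator `Φ`, as an element of `H ⊗ H ⊗ H`. -/
def phi (k H : Type*) [Field k] [Ring H] [Algebra k H] [QuasiBialgebra k H] :
    H ⊗[k] (H ⊗[k] H) :=
  (QuasiBialgebra.Phi (k := k) (H := H) : (H ⊗[k] (H ⊗[k] H))ˣ)

/-- The inverse `Φ⁻¹` of the reassociator. -/
def PhiInv (k H : Type*) [Field k] [Ring H] [Algebra k H] [QuasiBialgebra k H] :
    H ⊗[k] (H ⊗[k] H) :=
  ((QuasiBialgebra.Phi (k := k) (H := H))⁻¹ : (H ⊗[k] (H ⊗[k] H))ˣ)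

open QuasiBialgebra in
/-- A quasi-Hopf algebra: a quasi-bialgebra with an algebra anti-automorphism `S` and elements
`α, β`, with the usual normalization `ε(α) = ε(β) = 1`. (`S 1 = 1` and `ε ∘ S = ε` follow.) -/
class QuasiHopfAlgebra (k H : Type*) [Field k] [Ring H] [Algebra k H] extends
    QuasiBialgebra k H where
  /-- the antipode `S` (bijective) -/
  antipode : H ≃ₗ[k] H
  /-- `S` reverses products -/
  antipode_mul : ∀ g h : H, antipode (g * h) = antipode h * antipode g
  /-- the element `α` -/
  alpha : H
  /-- the element `β` -/
  beta : H
  /-- `S(h₁) α h₂ = ε(h) α` -/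
  antipode_alpha : ∀ h : H,
    prodMap (LinearMap.mulRight k alpha ∘ₗ antipode.toLinearMap) LinearMap.id (comul h) =
      counit h • alpha
  /-- `h₁ β S(h₂) = ε(h) β` -/
  antipode_beta : ∀ h : H,
    prodMap (LinearMap.mulRight k beta) antipode.toLinearMap (comul h) =
      counit h • beta
  /-- `X¹ β S(X²) α X³ = 1`, where `Φ = X¹ ⊗ X² ⊗ X³` -/
  antipode_Phi : prodMap (LinearMap.mulRight k beta)
    (prodMap (LinearMap.mulRight k alpha ∘ₗ antipode.toLinearMap) LinearMap.id)
    (phi k H) = 1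
  /-- `S(x¹) α x² β S(x³) = 1`, where `Φ⁻¹ = x¹ ⊗ x² ⊗ x³` -/
  antipode_PhiInv : prodMap (LinearMap.mulRight k alpha ∘ₗ antipode.toLinearMap)
    (prodMap (LinearMap.mulRight k beta) antipode.toLinearMap) (PhiInv k H) = 1
  /-- `ε(α) = 1` -/
  counit_alpha : counit alpha = 1
  /-- `ε(β) = 1` -/
  counit_beta : counit beta = 1

section Twist

variable (k H : Type*) [Field k] [Ring H] [Algebra k H] [QuasiHopfAlgebra k H]

/-- The coproduct `Δ` of `H`. -/
abbrev Delta : H →ₐ[k] H ⊗[k] H := QuasiBialgebra.comul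

/-- The antipode `S`, as a linear map. -/
abbrev S : H →ₗ[k] H := (QuasiHopfAlgebra.antipode (k := k) (H := H)).toLinearMap

/-- The inverse `S⁻¹` of the antipode, as a linear map. -/
abbrev SInv : H →ₗ[k] H := (QuasiHopfAlgebra.antipode (k := k) (H := H)).symm.toLinearMap

/-- The linear map `h ↦ h α`. -/
abbrev mulAlpha : H →ₗ[k] H := LinearMap.mulRight k (QuasiHopfAlgebra.alpha k (H := H))

/-- The linear map `h ↦ α h`. -/
abbrev alphaMul : H →ₗ[k] H := LinearMap.mulLeft k (QuasiHopfAlgebra.alpha k (H := H))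

/-- The linear map `h ↦ h β`. -/
abbrev mulBeta : H →ₗ[k] H := LinearMap.mulRight k (QuasiHopfAlgebra.beta k (H := H))

/-- The element `A¹ ⊗ A² ⊗ A³ ⊗ A⁴ = (Φ ⊗ 1)(Δ ⊗ id ⊗ id)(Φ⁻¹)`. -/
def elemA : H ⊗[k] (H ⊗[k] (H ⊗[k] H)) :=
  onRight H (onRight H (tmulOne H H)) (phi k H) *
    splitFst (H ⊗[k] H) (Delta k H) (PhiInv k H)

/-- The linear map `a₁ ⊗ a₂ ⊗ a₃ ⊗ a₄ ↦ S(a₂) α a₃ ⊗ S(a₁) α a₄`. -/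
def gammaMap : H ⊗[k] (H ⊗[k] (H ⊗[k] H)) →ₗ[k] H ⊗[k] H :=
  prodMap ((oneTmul H H).toLinearMap ∘ₗ mulAlpha k H ∘ₗ S k H)
    (prodMap ((tmulOne H H).toLinearMap ∘ₗ mulAlpha k H ∘ₗ S k H)
      (prodMap (tmulOne H H).toLinearMap (oneTmul H H).toLinearMap))

theorem gammaMap_tmul (a₁ a₂ a₃ a₄ : H) :
    gammaMap k H (a₁ ⊗ₜ (a₂ ⊗ₜ (a₃ ⊗ₜ a₄))) =
      (S k H a₂ * QuasiHopfAlgebra.alpha k * a₃) ⊗ₜ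
        (S k H a₁ * QuasiHopfAlgebra.alpha k * a₄) := by
  simp [gammaMap, oneTmul, tmulOne]

/-- The element `γ = S(A²) α A³ ⊗ S(A¹) α A⁴`. -/
def gammaElem : H ⊗[k] H := gammaMap k H (elemA k H)

/-- The linear map `h ↦ (S ⊗ S)(Δᶜᵒᵖ(h))`, where `Δᶜᵒᵖ(h) = h₂ ⊗ h₁`. -/
def antipodeCop : H →ₗ[k] H ⊗[k] H :=
  TensorProduct.map (S k H) (S k H) ∘ₗ (TensorProduct.comm k H H).toLinearMap ∘ₗ
    (Delta k H).toLinearMap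

/-- Drinfeld's gauge transformation
`f = (S ⊗ S)(Δᶜᵒᵖ(x¹)) γ Δ(x² β S(x³))`, where `Φ⁻¹ = x¹ ⊗ x² ⊗ x³`. -/
def drinfeldTwist : H ⊗[k] H :=
  prodMap (LinearMap.mulRight k (gammaElem k H) ∘ₗ antipodeCop k H)
    ((Delta k H).toLinearMap ∘ₗ prodMap (mulBeta k H) (S k H)) (PhiInv k H)

end Twist

/-! ### Comodule algebras and bicomodule algebras -/

open QuasiBialgebra in
/-- A right `H`-comodule algebra `(A, ρ, Φ_ρ)` over a quasi-bialgebra `H`. -/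
class RightComoduleAlgebra (k H A : Type*) [Field k] [Ring H] [Algebra k H]
    [QuasiBialgebra k H] [Ring A] [Algebra k A] where
  /-- the right coaction `ρ(a) = a_{<0>} ⊗ a_{<1>}` -/
  rho : A →ₐ[k] A ⊗[k] H
  /-- the invertible element `Φ_ρ` -/
  PhiRho : (A ⊗[k] (H ⊗[k] H))ˣ
  /-- `Φ_ρ (ρ ⊗ id)(ρ(a)) = (id ⊗ Δ)(ρ(a)) Φ_ρ` -/
  rho_coassoc : ∀ a : A, (PhiRho : A ⊗[k] (H ⊗[k] H)) * splitFst H rho (rho a) =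
    onRight A comul (rho a) * (PhiRho : A ⊗[k] (H ⊗[k] H))
  /-- `(1 ⊗ Φ)(id ⊗ Δ ⊗ id)(Φ_ρ)(Φ_ρ ⊗ 1) = (id ⊗ id ⊗ Δ)(Φ_ρ)(ρ ⊗ id ⊗ id)(Φ_ρ)` -/
  rho_pentagon : oneTmul A (H ⊗[k] (H ⊗[k] H)) (phi k H) * onRight A (splitFst H comul) PhiRho *
      onRight A (onRight H (tmulOne H H)) PhiRho =
    onRight A (onRight H comul) PhiRho * splitFst (H ⊗[k] H) rho PhiRho
  /-- `(id ⊗ ε) ∘ ρ = id` -/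
  rho_counit : ∀ a : A, onRight A counit (rho a) = a ⊗ₜ[k] 1
  /-- `(id ⊗ ε ⊗ id)(Φ_ρ) = 1` -/
  counit_PhiRho_snd : onRight A (onLeft H counit) (PhiRho : A ⊗[k] (H ⊗[k] H)) = 1
  /-- `(id ⊗ id ⊗ ε)(Φ_ρ) = 1` -/
  counit_PhiRho_trd : onRight A (onRight H counit) (PhiRho : A ⊗[k] (H ⊗[k] H)) = 1

open QuasiBialgebra in
/-- A left `H`-comodule algebra `(A, λ, Φ_λ)` over a quasi-bialgebra `H`. -/
class LeftComoduleAlgebra (k H A : Type*) [Field k] [Ring H] [Algebra k H]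
    [QuasiBialgebra k H] [Ring A] [Algebra k A] where
  /-- the left coaction `λ(a) = a_{[-1]} ⊗ a_{[0]}` -/
  lam : A →ₐ[k] H ⊗[k] A
  /-- the invertible element `Φ_λ` -/
  PhiLam : (H ⊗[k] (H ⊗[k] A))ˣ
  /-- `(id ⊗ λ)(λ(a)) Φ_λ = Φ_λ (Δ ⊗ id)(λ(a))` -/
  lam_coassoc : ∀ a : A, onRight H lam (lam a) * (PhiLam : H ⊗[k] (H ⊗[k] A)) =
    (PhiLam : H ⊗[k] (H ⊗[k] A)) * splitFst A comul (lam a)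
  /-- `(1 ⊗ Φ_λ)(id ⊗ Δ ⊗ id)(Φ_λ)(Φ ⊗ 1) = (id ⊗ id ⊗ λ)(Φ_λ)(Δ ⊗ id ⊗ id)(Φ_λ)` -/
  lam_pentagon : oneTmul H (H ⊗[k] (H ⊗[k] A)) PhiLam * onRight H (splitFst A comul) PhiLam *
      onRight H (onRight H (tmulOne H A)) (phi k H) =
    onRight H (onRight H lam) PhiLam * splitFst (H ⊗[k] A) comul PhiLam
  /-- `(ε ⊗ id) ∘ λ = id` -/
  lam_counit : ∀ a : A, onLeft A counit (lam a) = 1 ⊗ₜ[k] a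
  /-- `(id ⊗ ε ⊗ id)(Φ_λ) = 1` -/
  counit_PhiLam_snd : onRight H (onLeft A counit) (PhiLam : H ⊗[k] (H ⊗[k] A)) = 1
  /-- `(ε ⊗ id ⊗ id)(Φ_λ) = 1` -/
  counit_PhiLam_fst : onLeft (H ⊗[k] A) counit (PhiLam : H ⊗[k] (H ⊗[k] A)) = 1

open QuasiBialgebra RightComoduleAlgebra LeftComoduleAlgebra in
/-- An `H`-bicomodule algebra `(A, λ, ρ, Φ_λ, Φ_ρ, Φ_{λ,ρ})` over a quasi-bialgebra `H`. -/
class BicomoduleAlgebra (k H A : Type*) [Field k] [Ring H] [Algebra k H]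
    [QuasiBialgebra k H] [Ring A] [Algebra k A] extends
    RightComoduleAlgebra k H A, LeftComoduleAlgebra k H A where
  /-- the invertible element `Φ_{λ,ρ}` -/
  PhiLamRho : (H ⊗[k] (A ⊗[k] H))ˣ
  /-- `Φ_{λ,ρ} (λ ⊗ id)(ρ(u)) = (id ⊗ ρ)(λ(u)) Φ_{λ,ρ}` -/
  lam_rho : ∀ u : A, (PhiLamRho : H ⊗[k] (A ⊗[k] H)) * splitFst H lam (rho u) =
    onRight H rho (lam u) * (PhiLamRho : H ⊗[k] (A ⊗[k] H))
  /-- `(1 ⊗ Φ_{λ,ρ})(id ⊗ λ ⊗ id)(Φ_{λ,ρ})(Φ_λ ⊗ 1) =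
  (id ⊗ id ⊗ ρ)(Φ_λ)(Δ ⊗ id ⊗ id)(Φ_{λ,ρ})` -/
  lam_lam_rho : oneTmul H (H ⊗[k] (A ⊗[k] H)) PhiLamRho *
      onRight H (splitFst H lam) PhiLamRho * onRight H (onRight H (tmulOne A H)) PhiLam =
    onRight H (onRight H rho) PhiLam * splitFst (A ⊗[k] H) comul PhiLamRho
  /-- `(1 ⊗ Φ_ρ)(id ⊗ ρ ⊗ id)(Φ_{λ,ρ})(Φ_{λ,ρ} ⊗ 1) =
  (id ⊗ id ⊗ Δ)(Φ_{λ,ρ})(λ ⊗ id ⊗ id)(Φ_ρ)` -/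
  lam_rho_rho : oneTmul H (A ⊗[k] (H ⊗[k] H)) PhiRho *
      onRight H (splitFst H rho) PhiLamRho * onRight H (onRight A (tmulOne H H)) PhiLamRho =
    onRight H (onRight A comul) PhiLamRho * splitFst (H ⊗[k] H) lam PhiRho

/-! ### Bimodule algebras -/

section Actions

variable (k H 𝒜 : Type*) [Field k] [Ring H] [Algebra k H] [AddCommGroup 𝒜] [Module k 𝒜]

/-- The left action `h ↦ (φ ↦ h · φ)`. -/
def actL [Module H 𝒜] [IsScalarTower k H 𝒜] : H →ₗ[k] Module.End k 𝒜 :=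
  (Algebra.lsmul k k 𝒜 : H →ₐ[k] Module.End k 𝒜).toLinearMap

/-- The right action `h ↦ (φ ↦ φ · h)`; a right `H`-module is a module over the opposite
algebra. -/
def actR [Module Hᵐᵒᵖ 𝒜] [IsScalarTower k Hᵐᵒᵖ 𝒜] : H →ₗ[k] Module.End k 𝒜 :=
  (Algebra.lsmul k k 𝒜 : Hᵐᵒᵖ →ₐ[k] Module.End k 𝒜).toLinearMap ∘ₗ
    (MulOpposite.opLinearEquiv k).toLinearMap

@[simp] theorem actL_apply [Module H 𝒜] [IsScalarTower k H 𝒜] (h : H) (φ : 𝒜) :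
    actL k H 𝒜 h φ = h • φ := by
  simp [actL]

@[simp] theorem actR_apply [Module Hᵐᵒᵖ 𝒜] [IsScalarTower k Hᵐᵒᵖ 𝒜] (h : H) (φ : 𝒜) :
    actR k H 𝒜 h φ = MulOpposite.op h • φ := by
  simp [actR]

end Actions

/-- An `H`-bimodule algebra over a quasi-bialgebra `H`: an `H`-bimodule `𝒜` (left and right
actions that commute) with a bilinear, not necessarily associative multiplication with unit, which
is an algebra in the monoidal category of `H`-bimodules. -/
class BimoduleAlgebra (k H 𝒜 : Type*) [Field k] [Ring H] [Algebra k H] [QuasiBialgebra k H]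
    [NonAssocRing 𝒜] [Module k 𝒜] [SMulCommClass k 𝒜 𝒜] [IsScalarTower k 𝒜 𝒜]
    [Module H 𝒜] [IsScalarTower k H 𝒜] [Module Hᵐᵒᵖ 𝒜] [IsScalarTower k Hᵐᵒᵖ 𝒜]
    [SMulCommClass H Hᵐᵒᵖ 𝒜] : Prop where
  /-- `(φ ψ) ξ = (X¹ · φ · x¹) [(X² · ψ · x²) (X³ · ξ · x³)]`, where `Φ = X¹ ⊗ X² ⊗ X³` and
  `Φ⁻¹ = x¹ ⊗ x² ⊗ x³` -/
  mul_assoc' : ∀ φ ψ ξ : 𝒜, (φ * ψ) * ξ =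
    prodMap LinearMap.id (prodMap LinearMap.id LinearMap.id)
      (tensorAct (actR k H 𝒜) (tensorAct (actR k H 𝒜) (actR k H 𝒜)) (PhiInv k H)
        (tensorAct (actL k H 𝒜) (tensorAct (actL k H 𝒜) (actL k H 𝒜))
          (phi k H) (φ ⊗ₜ[k] (ψ ⊗ₜ[k] ξ))))
  /-- `h · (φ ψ) = (h₁ · φ)(h₂ · ψ)` -/
  smul_mul' : ∀ (h : H) (φ ψ : 𝒜), h • (φ * ψ) =
    prodMap LinearMap.id LinearMap.id
      (tensorAct (actL k H 𝒜) (actL k H 𝒜) (QuasiBialgebra.comul h) (φ ⊗ₜ[k] ψ))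
  /-- `(φ ψ) · h = (φ · h₁)(ψ · h₂)` -/
  mul_smul' : ∀ (h : H) (φ ψ : 𝒜), MulOpposite.op h • (φ * ψ) =
    prodMap LinearMap.id LinearMap.id
      (tensorAct (actR k H 𝒜) (actR k H 𝒜) (QuasiBialgebra.comul h) (φ ⊗ₜ[k] ψ))
  /-- `h · 1 = ε(h) 1` -/
  smul_one' : ∀ h : H, h • (1 : 𝒜) = (QuasiBialgebra.counit h : k) • (1 : 𝒜)
  /-- `1 · h = ε(h) 1` -/
  one_smul' : ∀ h : H, MulOpposite.op h • (1 : 𝒜) = (QuasiBialgebra.counit h : k) • (1 : 𝒜)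

/-! ### The generalized diagonal crossed product -/

section Elements

open RightComoduleAlgebra LeftComoduleAlgebra BicomoduleAlgebra

variable (k H 𝔸 : Type*) [Field k] [Ring H] [Algebra k H] [QuasiHopfAlgebra k H]
  [Ring 𝔸] [Algebra k 𝔸]

/-- `Φ_ρ`, as an element of `𝔸 ⊗ H ⊗ H`. -/
def phiRho [RightComoduleAlgebra k H 𝔸] : 𝔸 ⊗[k] (H ⊗[k] H) :=
  (PhiRho : (𝔸 ⊗[k] (H ⊗[k] H))ˣ)

/-- The inverse of `Φ_ρ`. -/
def phiRhoInv [RightComoduleAlgebra k H 𝔸] : 𝔸 ⊗[k] (H ⊗[k] H) :=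
  ((PhiRho : (𝔸 ⊗[k] (H ⊗[k] H))ˣ)⁻¹ : (𝔸 ⊗[k] (H ⊗[k] H))ˣ)

/-- `Φ_λ`, as an element of `H ⊗ H ⊗ 𝔸`. -/
def phiLam [LeftComoduleAlgebra k H 𝔸] : H ⊗[k] (H ⊗[k] 𝔸) :=
  (PhiLam : (H ⊗[k] (H ⊗[k] 𝔸))ˣ)

/-- The inverse of `Φ_λ`. -/
def phiLamInv [LeftComoduleAlgebra k H 𝔸] : H ⊗[k] (H ⊗[k] 𝔸) :=
  ((PhiLam : (H ⊗[k] (H ⊗[k] 𝔸))ˣ)⁻¹ : (H ⊗[k] (H ⊗[k] 𝔸))ˣ)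

/-- The inverse `θ¹ ⊗ θ² ⊗ θ³` of `Φ_{λ,ρ}`. -/
def theta [BicomoduleAlgebra k H 𝔸] : H ⊗[k] (𝔸 ⊗[k] H) :=
  ((PhiLamRho : (H ⊗[k] (𝔸 ⊗[k] H))ˣ)⁻¹ : (H ⊗[k] (𝔸 ⊗[k] H))ˣ)

/-- `p̃ = x̃¹ ⊗ x̃² β S(x̃³)`, where `Φ_ρ⁻¹ = x̃¹ ⊗ x̃² ⊗ x̃³`. -/
def pRho [RightComoduleAlgebra k H 𝔸] : 𝔸 ⊗[k] H :=
  TensorProduct.map LinearMap.id (prodMap (mulBeta k H) (S k H)) (phiRhoInv k H 𝔸)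

/-- `q̃ = X̃¹ ⊗ S⁻¹(α X̃³) X̃²`, where `Φ_ρ = X̃¹ ⊗ X̃² ⊗ X̃³`. -/
def qRho [RightComoduleAlgebra k H 𝔸] : 𝔸 ⊗[k] H :=
  TensorProduct.map LinearMap.id
    (prodMap (SInv k H ∘ₗ alphaMul k H) LinearMap.id ∘ₗ (TensorProduct.comm k H H).toLinearMap)
    (phiRho k H 𝔸)

/-- With `Φ_ρ = X¹ ⊗ X² ⊗ X³`, `Φ_λ⁻¹ = x¹ ⊗ x² ⊗ x³`, `Φ_{λ,ρ}⁻¹ = θ¹ ⊗ θ² ⊗ θ³` and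
`f = f¹ ⊗ f²`, the element
`X¹_{[-1]_1} x¹ θ¹ ⊗ X¹_{[-1]_2} x² θ²_{[-1]} ⊗ X¹_{[0]} x³ θ²_{[0]} ⊗ f¹ X² θ³ ⊗ f² X³`. -/
def omegaAux [BicomoduleAlgebra k H 𝔸] : H ⊗[k] (H ⊗[k] (𝔸 ⊗[k] (H ⊗[k] H))) :=
  oneTmul H _ (oneTmul H _ (oneTmul 𝔸 _ (drinfeldTwist k H))) *
    splitFst (𝔸 ⊗[k] (H ⊗[k] H)) (Delta k H)
      (splitFst (H ⊗[k] H) (lam (k := k) (H := H) (A := 𝔸)) (phiRho k H 𝔸)) *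
    onRight H (onRight H (tmulOne 𝔸 (H ⊗[k] H))) (phiLamInv k H 𝔸) *
    onRight H (onRight H (onRight 𝔸 (tmulOne H H)))
      (onRight H (splitFst H (lam (k := k) (H := H) (A := 𝔸))) (theta k H 𝔸))

/-- The element
`Ω = X¹_{[-1]_1} x¹ θ¹ ⊗ X¹_{[-1]_2} x² θ²_{[-1]} ⊗ X¹_{[0]} x³ θ²_{[0]} ⊗ S⁻¹(f¹ X² θ³) ⊗
S⁻¹(f² X³)`. -/
def Omega [BicomoduleAlgebra k H 𝔸] : H ⊗[k] (H ⊗[k] (𝔸 ⊗[k] (H ⊗[k] H))) :=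
  TensorProduct.map LinearMap.id (TensorProduct.map LinearMap.id (TensorProduct.map LinearMap.id
    (TensorProduct.map (SInv k H) (SInv k H)))) (omegaAux k H 𝔸)

/-- `u_{<0>_{[-1]}} ⊗ u_{<0>_{[0]}} ⊗ S⁻¹(u_{<1>})`, as a linear function of
`u_{<0>} ⊗ u_{<1>}`. -/
def lamSInv [LeftComoduleAlgebra k H 𝔸] : 𝔸 ⊗[k] H →ₗ[k] H ⊗[k] (𝔸 ⊗[k] H) :=
  TensorProduct.map LinearMap.id (TensorProduct.map LinearMap.id (SInv k H)) ∘ₗ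
    (splitFst H (lam (k := k) (H := H) (A := 𝔸))).toLinearMap

theorem lamSInv_tmul [LeftComoduleAlgebra k H 𝔸] (a : 𝔸) (h x : H) (b : 𝔸)
    (hab : lam (k := k) (H := H) a = x ⊗ₜ[k] b) :
    lamSInv k H 𝔸 (a ⊗ₜ h) = x ⊗ₜ (b ⊗ₜ SInv k H h) := by
  simp [lamSInv, splitFst, hab]

end Elements

section Crossed

variable (k H 𝒜 𝔸 : Type*) [Field k] [Ring H] [Algebra k H]
  [NonAssocRing 𝒜] [Module k 𝒜] [SMulCommClass k 𝒜 𝒜] [IsScalarTower k 𝒜 𝒜]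
  [Module H 𝒜] [IsScalarTower k H 𝒜] [Module Hᵐᵒᵖ 𝒜] [IsScalarTower k Hᵐᵒᵖ 𝒜]
  [Ring 𝔸] [Algebra k 𝔸]

/-- Left multiplication `a ↦ (b ↦ a b)` on `𝔸`. -/
abbrev mulL : 𝔸 →ₗ[k] Module.End k 𝔸 := LinearMap.mul k 𝔸

/-- `h ⊗ a ⊗ h'` acts on `𝒜 ⊗ 𝔸` by `φ ⊗ u ↦ (h · φ · h') ⊗ a u`. -/
def act3 : H ⊗[k] (𝔸 ⊗[k] H) →ₗ[k] Module.End k (𝒜 ⊗[k] 𝔸) :=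
  prodMap (onFst 𝒜 𝔸 ∘ₗ actL k H 𝒜)
    (prodMap (onSnd 𝒜 𝔸 ∘ₗ mulL k 𝔸) (onFst 𝒜 𝔸 ∘ₗ actR k H 𝒜))

theorem act3_tmul (h h' : H) (a u : 𝔸) (φ : 𝒜) :
    act3 k H 𝒜 𝔸 (h ⊗ₜ (a ⊗ₜ h')) (φ ⊗ₜ u) =
      (h • MulOpposite.op h' • φ) ⊗ₜ (a * u) := by
  simp [act3]

/-- `h₁ ⊗ h₂ ⊗ a ⊗ h₄ ⊗ h₅` acts on `𝒜 ⊗ 𝒜 ⊗ 𝔸` by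
`φ ⊗ φ' ⊗ u ↦ (h₁ · φ · h₅) ⊗ (h₂ · φ' · h₄) ⊗ a u`. -/
def act5 : H ⊗[k] (H ⊗[k] (𝔸 ⊗[k] (H ⊗[k] H))) →ₗ[k] Module.End k (𝒜 ⊗[k] (𝒜 ⊗[k] 𝔸)) :=
  prodMap (onFst 𝒜 (𝒜 ⊗[k] 𝔸) ∘ₗ actL k H 𝒜)
    (prodMap (onSnd 𝒜 (𝒜 ⊗[k] 𝔸) ∘ₗ onFst 𝒜 𝔸 ∘ₗ actL k H 𝒜)
      (prodMap (onSnd 𝒜 (𝒜 ⊗[k] 𝔸) ∘ₗ onSnd 𝒜 𝔸 ∘ₗ mulL k 𝔸)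
        (prodMap (onSnd 𝒜 (𝒜 ⊗[k] 𝔸) ∘ₗ onFst 𝒜 𝔸 ∘ₗ actR k H 𝒜)
          (onFst 𝒜 (𝒜 ⊗[k] 𝔸) ∘ₗ actR k H 𝒜))))

theorem act5_tmul (h₁ h₂ h₄ h₅ : H) (a u : 𝔸) (φ φ' : 𝒜) :
    act5 k H 𝒜 𝔸 (h₁ ⊗ₜ (h₂ ⊗ₜ (a ⊗ₜ (h₄ ⊗ₜ h₅)))) (φ ⊗ₜ (φ' ⊗ₜ u)) =
      (h₁ • MulOpposite.op h₅ • φ) ⊗ₜ ((h₂ • MulOpposite.op h₄ • φ') ⊗ₜ (a * u)) := by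
  simp [act5]

/-- The linear map `φ ⊗ φ' ⊗ u ↦ φ φ' ⊗ u`. -/
def mulFst : 𝒜 ⊗[k] (𝒜 ⊗[k] 𝔸) →ₗ[k] 𝒜 ⊗[k] 𝔸 :=
  (LinearMap.mul' k 𝒜).rTensor 𝔸 ∘ₗ (TensorProduct.assoc k 𝒜 𝒜 𝔸).symm.toLinearMap

theorem mulFst_tmul (φ φ' : 𝒜) (u : 𝔸) :
    mulFst k 𝒜 𝔸 (φ ⊗ₜ (φ' ⊗ₜ u)) = (φ * φ') ⊗ₜ u := by
  simp [mulFst]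

/-- The underlying vector space `𝒜 ⊗ 𝔸` of the generalized diagonal crossed product `𝒜 ⋈ 𝔸`. -/
@[nolint unusedArguments]
def DiagonalCrossedProduct (k _H 𝒜 𝔸 : Type*) [Field k] [AddCommGroup 𝒜] [Module k 𝒜]
    [AddCommGroup 𝔸] [Module k 𝔸] : Type _ :=
  𝒜 ⊗[k] 𝔸

namespace DiagonalCrossedProduct

instance : AddCommGroup (DiagonalCrossedProduct k H 𝒜 𝔸) :=
  inferInstanceAs (AddCommGroup (𝒜 ⊗[k] 𝔸))

instance : Module k (DiagonalCrossedProduct k H 𝒜 𝔸) :=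
  inferInstanceAs (Module k (𝒜 ⊗[k] 𝔸))

/-- The identification of vector spaces `𝒜 ⊗ 𝔸 = 𝒜 ⋈ 𝔸`. -/
def of : 𝒜 ⊗[k] 𝔸 ≃ₗ[k] DiagonalCrossedProduct k H 𝒜 𝔸 :=
  LinearEquiv.refl k (𝒜 ⊗[k] 𝔸)

variable {k 𝒜 𝔸}

/-- The element `φ ⋈ u` of `𝒜 ⋈ 𝔸`. -/
def mk (φ : 𝒜) (u : 𝔸) : DiagonalCrossedProduct k H 𝒜 𝔸 := of k H 𝒜 𝔸 (φ ⊗ₜ[k] u)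

variable (k 𝒜 𝔸)
variable [QuasiHopfAlgebra k H] [BicomoduleAlgebra k H 𝔸]

/-- For fixed `φ ⊗ u`, the linear map
`φ' ⊗ u' ↦ (Ω¹ · φ · Ω⁵)(Ω² u_{<0>_{[-1]}} · φ' · S⁻¹(u_{<1>}) Ω⁴) ⊗ Ω³ u_{<0>_{[0]}} u'`. -/
def mulAux : 𝒜 ⊗[k] 𝔸 →ₗ[k] 𝒜 ⊗[k] 𝔸 →ₗ[k] 𝒜 ⊗[k] 𝔸 :=
  TensorProduct.lift (LinearMap.mk₂ k
    (fun (φ : 𝒜) (u : 𝔸) =>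
      mulFst k 𝒜 𝔸 ∘ₗ act5 k H 𝒜 𝔸 (Omega k H 𝔸) ∘ₗ TensorProduct.mk k 𝒜 (𝒜 ⊗[k] 𝔸) φ ∘ₗ
        act3 k H 𝒜 𝔸 (lamSInv k H 𝔸 (RightComoduleAlgebra.rho u)))
    (fun φ φ' u => by simp only [map_add, LinearMap.add_comp, LinearMap.comp_add])
    (fun c φ u => by simp only [map_smul, LinearMap.smul_comp, LinearMap.comp_smul])
    (fun φ u u' => by simp only [map_add, LinearMap.comp_add])
    (fun c φ u => by simp only [map_smul, LinearMap.comp_smul]))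

/-- The multiplication of `𝒜 ⋈ 𝔸`. -/
instance : Mul (DiagonalCrossedProduct k H 𝒜 𝔸) :=
  ⟨fun x y => of k H 𝒜 𝔸 (mulAux k H 𝒜 𝔸 ((of k H 𝒜 𝔸).symm x) ((of k H 𝒜 𝔸).symm y))⟩

/-- The unit `1 ⋈ 1` of `𝒜 ⋈ 𝔸`. -/
instance : One (DiagonalCrossedProduct k H 𝒜 𝔸) := ⟨mk H 1 1⟩

theorem mk_mul_mk (φ φ' : 𝒜) (u u' : 𝔸) :
    (mk H φ u * mk H φ' u' : DiagonalCrossedProduct k H 𝒜 𝔸) =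
      of k H 𝒜 𝔸 (mulFst k 𝒜 𝔸 (act5 k H 𝒜 𝔸 (Omega k H 𝔸)
        (φ ⊗ₜ act3 k H 𝒜 𝔸 (lamSInv k H 𝔸 (RightComoduleAlgebra.rho u)) (φ' ⊗ₜ u')))) :=
  rfl

/-- The linear map `Γ(φ) = p̃¹_{[-1]} · φ · S⁻¹(p̃²) ⋈ p̃¹_{[0]}`. -/
def Gam : 𝒜 →ₗ[k] DiagonalCrossedProduct k H 𝒜 𝔸 :=
  (of k H 𝒜 𝔸).toLinearMap ∘ₗ act3 k H 𝒜 𝔸 (lamSInv k H 𝔸 (pRho k H 𝔸)) ∘ₗ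
    (TensorProduct.mk k 𝒜 𝔸).flip 1

/-- The linear map `j(u) = 1 ⋈ u`. -/
def j : 𝔸 →ₗ[k] DiagonalCrossedProduct k H 𝒜 𝔸 :=
  (of k H 𝒜 𝔸).toLinearMap ∘ₗ TensorProduct.mk k 𝒜 𝔸 1

theorem j_apply (u : 𝔸) : j k H 𝒜 𝔸 u = mk H 1 u := rfl

/-- A linear map from `𝒜 ⋈ 𝔸` to an algebra is an algebra map if it preserves the unit and the
multiplication. -/
structure IsAlgMap {k H 𝒜 𝔸 B : Type*} [Field k] [Ring H] [Algebra k H]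
    [NonAssocRing 𝒜] [Module k 𝒜] [SMulCommClass k 𝒜 𝒜] [IsScalarTower k 𝒜 𝒜]
    [Module H 𝒜] [IsScalarTower k H 𝒜] [Module Hᵐᵒᵖ 𝒜] [IsScalarTower k Hᵐᵒᵖ 𝒜]
    [Ring 𝔸] [Algebra k 𝔸] [QuasiHopfAlgebra k H] [BicomoduleAlgebra k H 𝔸]
    [Ring B] [Algebra k B] (w : DiagonalCrossedProduct k H 𝒜 𝔸 →ₗ[k] B) : Prop where
  map_one : w 1 = 1
  map_mul : ∀ x y : DiagonalCrossedProduct k H 𝒜 𝔸, w (x * y) = w x * w y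

end DiagonalCrossedProduct

/-! ### Expressions in the target algebra -/

variable {k H 𝒜 𝔸} {B : Type*} [Ring B] [Algebra k B]

/-- The linear map `h ↦ v(h · φ)`. -/
def vL (v : 𝒜 →ₗ[k] B) (φ : 𝒜) : H →ₗ[k] B := v ∘ₗ (actL k H 𝒜).flip φ

/-- The linear map `h ↦ v(φ · h)`. -/
def vR (v : 𝒜 →ₗ[k] B) (φ : 𝒜) : H →ₗ[k] B := v ∘ₗ (actR k H 𝒜).flip φ

theorem vL_apply (v : 𝒜 →ₗ[k] B) (φ : 𝒜) (h : H) : vL v φ h = v (h • φ) := by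
  simp [vL]

theorem vR_apply (v : 𝒜 →ₗ[k] B) (φ : 𝒜) (h : H) :
    vR v φ h = v (MulOpposite.op h • φ) := by
  simp [vR]

variable (k 𝒜 𝔸) in
/-- The space of words `a ⊗ φ ⊗ b ⊗ φ' ⊗ c`. -/
abbrev Word : Type _ := 𝔸 ⊗[k] (𝒜 ⊗[k] (𝔸 ⊗[k] (𝒜 ⊗[k] 𝔸)))

/-- `a ⊗ φ ⊗ b ⊗ φ' ⊗ c ↦ γ(a) v(φ) γ(b) v(φ') γ(c)`. -/
def wordEval (γ : 𝔸 →ₐ[k] B) (v : 𝒜 →ₗ[k] B) : Word k 𝒜 𝔸 →ₗ[k] B :=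
  prodMap γ.toLinearMap (prodMap v (prodMap γ.toLinearMap (prodMap v γ.toLinearMap)))

variable (k 𝒜 𝔸) in
/-- Act on the first letter `a` of a word. -/
def onWord1 : Module.End k 𝔸 →ₗ[k] Module.End k (Word k 𝒜 𝔸) :=
  onFst 𝔸 (𝒜 ⊗[k] (𝔸 ⊗[k] (𝒜 ⊗[k] 𝔸)))

variable (k 𝒜 𝔸) in
/-- Act on the second letter `φ` of a word. -/
def onWord2 : Module.End k 𝒜 →ₗ[k] Module.End k (Word k 𝒜 𝔸) :=
  onSnd 𝔸 (𝒜 ⊗[k] (𝔸 ⊗[k] (𝒜 ⊗[k] 𝔸))) ∘ₗ onFst 𝒜 (𝔸 ⊗[k] (𝒜 ⊗[k] 𝔸))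

variable (k 𝒜 𝔸) in
/-- Act on the third letter `b` of a word. -/
def onWord3 : Module.End k 𝔸 →ₗ[k] Module.End k (Word k 𝒜 𝔸) :=
  onSnd 𝔸 (𝒜 ⊗[k] (𝔸 ⊗[k] (𝒜 ⊗[k] 𝔸))) ∘ₗ onSnd 𝒜 (𝔸 ⊗[k] (𝒜 ⊗[k] 𝔸)) ∘ₗ
    onFst 𝔸 (𝒜 ⊗[k] 𝔸)

variable (k 𝒜 𝔸) in
/-- Act on the fourth letter `φ'` of a word. -/
def onWord4 : Module.End k 𝒜 →ₗ[k] Module.End k (Word k 𝒜 𝔸) :=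
  onSnd 𝔸 (𝒜 ⊗[k] (𝔸 ⊗[k] (𝒜 ⊗[k] 𝔸))) ∘ₗ onSnd 𝒜 (𝔸 ⊗[k] (𝒜 ⊗[k] 𝔸)) ∘ₗ
    onSnd 𝔸 (𝒜 ⊗[k] 𝔸) ∘ₗ onFst 𝒜 𝔸

variable (k 𝒜 𝔸) in
/-- Act on the fifth letter `c` of a word. -/
def onWord5 : Module.End k 𝔸 →ₗ[k] Module.End k (Word k 𝒜 𝔸) :=
  onSnd 𝔸 (𝒜 ⊗[k] (𝔸 ⊗[k] (𝒜 ⊗[k] 𝔸))) ∘ₗ onSnd 𝒜 (𝔸 ⊗[k] (𝒜 ⊗[k] 𝔸)) ∘ₗ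
    onSnd 𝔸 (𝒜 ⊗[k] 𝔸) ∘ₗ onSnd 𝒜 𝔸

variable (k H 𝒜 𝔸) in
/-- `x ⊗ h ⊗ h'` sends `a ⊗ φ ⊗ b ⊗ φ' ⊗ c` to `x a ⊗ φ · h ⊗ b ⊗ φ' · h' ⊗ c`. -/
def wordRho : 𝔸 ⊗[k] (H ⊗[k] H) →ₗ[k] Module.End k (Word k 𝒜 𝔸) :=
  prodMap (onWord1 k 𝒜 𝔸 ∘ₗ mulL k 𝔸)
    (prodMap (onWord2 k 𝒜 𝔸 ∘ₗ actR k H 𝒜) (onWord4 k 𝒜 𝔸 ∘ₗ actR k H 𝒜))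

variable (k H 𝒜 𝔸) in
/-- `h ⊗ h' ⊗ x` sends `a ⊗ φ ⊗ b ⊗ φ' ⊗ c` to `a ⊗ h · φ ⊗ b ⊗ h' · φ' ⊗ x c`. -/
def wordLam : H ⊗[k] (H ⊗[k] 𝔸) →ₗ[k] Module.End k (Word k 𝒜 𝔸) :=
  prodMap (onWord2 k 𝒜 𝔸 ∘ₗ actL k H 𝒜)
    (prodMap (onWord4 k 𝒜 𝔸 ∘ₗ actL k H 𝒜) (onWord5 k 𝒜 𝔸 ∘ₗ mulL k 𝔸))

variable (k H 𝒜 𝔸) in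
/-- `h ⊗ x ⊗ h'` sends `a ⊗ φ ⊗ b ⊗ φ' ⊗ c` to `a ⊗ h · φ ⊗ x b ⊗ φ' · h' ⊗ c`. -/
def wordTheta : H ⊗[k] (𝔸 ⊗[k] H) →ₗ[k] Module.End k (Word k 𝒜 𝔸) :=
  prodMap (onWord2 k 𝒜 𝔸 ∘ₗ actL k H 𝒜)
    (prodMap (onWord3 k 𝒜 𝔸 ∘ₗ mulL k 𝔸) (onWord4 k 𝒜 𝔸 ∘ₗ actR k H 𝒜))

/-- For `R = X¹ ⊗ X² ⊗ X³`, `T = θ¹ ⊗ θ² ⊗ θ³` and `L = Y¹ ⊗ Y² ⊗ Y³`, the element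
`γ(X¹) v(θ¹ Y¹ · φ · X²) γ(θ²) v(Y² · φ' · X³ θ³) γ(Y³)`. -/
def vMulExpr (γ : 𝔸 →ₐ[k] B) (v : 𝒜 →ₗ[k] B) (R : 𝔸 ⊗[k] (H ⊗[k] H))
    (T : H ⊗[k] (𝔸 ⊗[k] H)) (L : H ⊗[k] (H ⊗[k] 𝔸)) (φ φ' : 𝒜) : B :=
  wordEval γ v (wordTheta k H 𝒜 𝔸 T (wordRho k H 𝒜 𝔸 R (wordLam k H 𝒜 𝔸 L
    (1 ⊗ₜ[k] (φ ⊗ₜ[k] (1 ⊗ₜ[k] (φ' ⊗ₜ[k] 1)))))))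

theorem vMulExpr_tmul [SMulCommClass H Hᵐᵒᵖ 𝒜] (γ : 𝔸 →ₐ[k] B) (v : 𝒜 →ₗ[k] B)
    (x₁ t₂ y₃ : 𝔸) (x₂ x₃ t₁ t₃ y₁ y₂ : H) (φ φ' : 𝒜) :
    vMulExpr γ v (x₁ ⊗ₜ (x₂ ⊗ₜ x₃)) (t₁ ⊗ₜ (t₂ ⊗ₜ t₃)) (y₁ ⊗ₜ (y₂ ⊗ₜ y₃)) φ φ' =
      γ x₁ * v ((t₁ * y₁) • MulOpposite.op x₂ • φ) * γ t₂ *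
        v (y₂ • MulOpposite.op (x₃ * t₃) • φ') * γ y₃ := by
  simp [vMulExpr, wordEval, wordTheta, wordRho, wordLam, onWord1, onWord2, onWord3,
    onWord4, onWord5, mul_smul, mul_assoc,
    smul_comm y₁ (MulOpposite.op x₂), smul_comm y₂ (MulOpposite.op t₃),
    smul_comm y₂ (MulOpposite.op x₃)]

end Crossed

end QuasiHopf

end

open QuasiHopf

/-!
The candidate is `w(φ ⋈ u) = ṽ(φ) γ(u)` with `ṽ(φ) = γ(q̃¹) v(φ · q̃²)`. It is forced: the identity
`ρ(q̃¹) p̃ (1 ⊗ S(q̃²)) = 1 ⊗ 1` says that `φ ⋈ 1` is the sum of the products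
`(1 ⋈ q̃¹) Γ(φ · q̃²)`, and `φ ⋈ u = (φ ⋈ 1)(1 ⋈ u)`.

Conversely, the commutation rule for `γ` and `v` and the intertwining property of `q̃` move `γ(u)`
past `ṽ`:
`ṽ(u_{<0>[-1]} · φ · S⁻¹(u_{<1>})) γ(u_{<0>[0]}) = γ(u) ṽ(φ)`.
So `w` is multiplicative as soon as
`ṽ((Ω¹ · φ · Ω⁵)(Ω² · φ' · Ω⁴)) γ(Ω³) = ṽ(φ) ṽ(φ')`.
The rule for `v(φ φ')` expands the left side into a word in `γ` and `v`, in which the Drinfeld twist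
`f` meets `Δ(q̃²)`. The formula for `(id ⊗ Δ)(q̃)` in terms of `f`, which rests on the pentagon
identity for `Φ_ρ` and the twist identity `f Δ(S(h)) = (S ⊗ S)(Δᵒᵖ(h)) f`, splits the word into
two factors `ṽ`. Finally `w ∘ Γ = v` is the other identity between `q̃` and `p̃`, dual to the first.
-/

noncomputable section

namespace QuasiHopf

-- The ring structures on iterated tensor products nest deeper than the default depth allows.
set_option maxSynthPendingDepth 6

/-! ### Maps out of iterated tensor products -/

section TensorCalculus

variable {k : Type*} [Field k]

section Induction

variable {X Y Z M : Type*} [AddCommMonoid X] [Module k X] [AddCommMonoid Y] [Module k Y]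
  [AddCommMonoid Z] [Module k Z] [Add M]

-- Additivity suffices, because `0` is the pure tensor `0 ⊗ 0`.
theorem eq_of_tmul (t : X ⊗[k] Y) {F G : X ⊗[k] Y → M} (tmul : ∀ x y, F (x ⊗ₜ y) = G (x ⊗ₜ y))
    (hF : ∀ s t, F (s + t) = F s + F t := by
      intro _ _
      simp only [map_add, add_mul, mul_add, TensorProduct.add_tmul, TensorProduct.tmul_add,
        smul_add, LinearMap.add_apply])
    (hG : ∀ s t, G (s + t) = G s + G t := by
      intro _ _
      simp only [map_add, add_mul, mul_add, TensorProduct.add_tmul, TensorProduct.tmul_add,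
        smul_add, LinearMap.add_apply]) : F t = G t := by
  induction t using TensorProduct.induction_on with
  | zero => simpa only [TensorProduct.zero_tmul] using tmul 0 0
  | tmul x y => exact tmul x y
  | add s t hs ht => rw [hF, hG, hs, ht]

theorem eq_of_tmul₃ (t : X ⊗[k] (Y ⊗[k] Z)) {F G : X ⊗[k] (Y ⊗[k] Z) → M}
    (tmul : ∀ x y z, F (x ⊗ₜ (y ⊗ₜ z)) = G (x ⊗ₜ (y ⊗ₜ z)))
    (hF : ∀ s t, F (s + t) = F s + F t := by
      intro _ _
      simp only [map_add, add_mul, mul_add, TensorProduct.add_tmul, TensorProduct.tmul_add,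
        smul_add, LinearMap.add_apply])
    (hG : ∀ s t, G (s + t) = G s + G t := by
      intro _ _
      simp only [map_add, add_mul, mul_add, TensorProduct.add_tmul, TensorProduct.tmul_add,
        smul_add, LinearMap.add_apply]) : F t = G t :=
  eq_of_tmul t (fun x t => eq_of_tmul t (F := fun t => F (x ⊗ₜ t)) (G := fun t => G (x ⊗ₜ t))
    (tmul x) (fun _ _ => by rw [TensorProduct.tmul_add, hF])
    (fun _ _ => by rw [TensorProduct.tmul_add, hG])) hF hG

end Induction

variable {P Q V W X Y Z M N : Type*} [Ring P] [Algebra k P] [Ring Q] [Algebra k Q] [Ring V]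
  [Algebra k V] [Ring W] [Algebra k W] [Ring X] [Algebra k X] [Ring Y] [Algebra k Y] [Ring Z]
  [Algebra k Z] [AddCommMonoid M] [Module k M] [AddCommMonoid N] [Module k N]

@[simp] theorem onRight_tmul (f : X →ₐ[k] Y) (w : W) (x : X) :
    onRight W f (w ⊗ₜ[k] x) = w ⊗ₜ f x := rfl

@[simp] theorem onLeft_tmul (f : X →ₐ[k] Y) (w : W) (x : X) :
    onLeft W f (x ⊗ₜ[k] w) = f x ⊗ₜ w := rfl

theorem splitFst_tmul (f : X →ₐ[k] Y ⊗[k] Z) (x : X) (w : W) :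
    splitFst W f (x ⊗ₜ[k] w) = TensorProduct.assoc k Y Z W (f x ⊗ₜ w) := rfl

@[simp] theorem tmulOne_apply (x : X) : tmulOne X W x = x ⊗ₜ[k] 1 := rfl

@[simp] theorem oneTmul_apply (x : X) : oneTmul W X x = 1 ⊗ₜ[k] x := rfl

theorem onRight_comp (f : Y →ₐ[k] Z) (g : X →ₐ[k] Y) :
    onRight W (f.comp g) = (onRight W f).comp (onRight W g) := by
  ext <;> simp

theorem onRight_onRight (f : Y →ₐ[k] Z) (g : X →ₐ[k] Y) (t : W ⊗[k] X) :
    onRight W f (onRight W g t) = onRight W (f.comp g) t := by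
  rw [onRight_comp, AlgHom.comp_apply]

theorem splitFst_comp (f : Y →ₐ[k] Z ⊗[k] V) (g : X →ₐ[k] Y) :
    splitFst W (f.comp g) = (splitFst W f).comp (onLeft W g) := by
  ext <;> simp [splitFst_tmul]

variable (k) in
/-- The canonical isomorphism `(x ⊗ y ⊗ z) ⊗ w ↦ x ⊗ y ⊗ z ⊗ w`, as an algebra map. -/
def reassoc (X Y Z W : Type*) [Ring X] [Algebra k X] [Ring Y] [Algebra k Y] [Ring Z]
    [Algebra k Z] [Ring W] [Algebra k W] :
    (X ⊗[k] (Y ⊗[k] Z)) ⊗[k] W →ₐ[k] X ⊗[k] (Y ⊗[k] (Z ⊗[k] W)) :=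
  (onRight X (splitFst W (AlgHom.id k (Y ⊗[k] Z)))).comp
    (splitFst W (AlgHom.id k (X ⊗[k] (Y ⊗[k] Z))))

@[simp] theorem reassoc_tmul (x : X) (y : Y) (z : Z) (w : W) :
    reassoc k X Y Z W ((x ⊗ₜ (y ⊗ₜ z)) ⊗ₜ w) = x ⊗ₜ (y ⊗ₜ (z ⊗ₜ w)) := rfl

theorem reassoc_tmul_one (t : X ⊗[k] (Y ⊗[k] Z)) :
    reassoc k X Y Z W (t ⊗ₜ 1) = onRight X (onRight Y (tmulOne Z W)) t := by
  apply eq_of_tmul₃ t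
  simp

theorem splitFst_splitFst_tmul (f : Y →ₐ[k] V ⊗[k] P) (g : X →ₐ[k] Y ⊗[k] Z) (x : X) (w : W) :
    splitFst (Z ⊗[k] W) f (splitFst W g (x ⊗ₜ w)) =
      reassoc k V P Z W (splitFst Z f (g x) ⊗ₜ w) := by
  rw [splitFst_tmul]
  generalize g x = r
  apply eq_of_tmul r
  intro y z
  rw [TensorProduct.assoc_tmul, splitFst_tmul, splitFst_tmul]
  generalize f y = r
  apply eq_of_tmul r
  simp

theorem onRight_splitFst_splitFst_tmul (f : Z →ₐ[k] V ⊗[k] P) (g : X →ₐ[k] Y ⊗[k] Z) (x : X)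
    (w : W) :
    onRight Y (splitFst W f) (splitFst W g (x ⊗ₜ w)) =
      reassoc k Y V P W (onRight Y f (g x) ⊗ₜ w) := by
  rw [splitFst_tmul]
  generalize g x = r
  apply eq_of_tmul r
  intro y z
  rw [TensorProduct.assoc_tmul, onRight_tmul, onRight_tmul, splitFst_tmul]
  generalize f z = r
  apply eq_of_tmul r
  simp

theorem onRight_tmulOne_mul_splitFst_splitFst {f : Y →ₐ[k] V ⊗[k] P} {g : X →ₐ[k] Y ⊗[k] Z}
    {f' : Q →ₐ[k] P ⊗[k] Z} {g' : X →ₐ[k] V ⊗[k] Q} {u : V ⊗[k] (P ⊗[k] Z)}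
    (h : ∀ x, u * splitFst Z f (g x) = onRight V f' (g' x) * u) (t : X ⊗[k] W) :
    onRight V (onRight P (tmulOne Z W)) u * splitFst (Z ⊗[k] W) f (splitFst W g t) =
      onRight V (splitFst W f') (splitFst W g' t) * onRight V (onRight P (tmulOne Z W)) u := by
  apply eq_of_tmul t
  intro x w
  simp only [splitFst_splitFst_tmul, onRight_splitFst_splitFst_tmul, ← reassoc_tmul_one, ← map_mul,
    Algebra.TensorProduct.tmul_mul_tmul, h, one_mul, mul_one]

theorem map_inv_eq_one {A B F : Type*} [Monoid A] [Monoid B] [FunLike F A B]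
    [MonoidHomClass F A B] (f : F) (u : Aˣ) (h : f u = 1) : f ↑u⁻¹ = 1 := by
  simpa only [map_mul, h, mul_one, map_one] using congrArg f u.inv_mul

theorem assoc_mul (s t : (X ⊗[k] Y) ⊗[k] Z) :
    TensorProduct.assoc k X Y Z (s * t) =
      TensorProduct.assoc k X Y Z s * TensorProduct.assoc k X Y Z t :=
  map_mul (Algebra.TensorProduct.assoc k k k X Y Z) s t

/-- The linear map `x ⊗ y ↦ p (x ⊗ y ⊗ z)`, i.e. `p` with its last argument fixed. -/
def fixLast {X Y Z M : Type*} [AddCommMonoid X] [Module k X] [AddCommMonoid Y] [Module k Y]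
    [AddCommMonoid Z] [Module k Z] [AddCommMonoid M] [Module k M] (p : X ⊗[k] (Y ⊗[k] Z) →ₗ[k] M)
    (z : Z) : X ⊗[k] Y →ₗ[k] M :=
  p ∘ₗ (TensorProduct.assoc k X Y Z).toLinearMap ∘ₗ (TensorProduct.mk k (X ⊗[k] Y) Z).flip z

@[simp] theorem fixLast_tmul (p : X ⊗[k] (Y ⊗[k] Z) →ₗ[k] M) (x : X) (y : Y) (z : Z) :
    fixLast p z (x ⊗ₜ y) = p (x ⊗ₜ (y ⊗ₜ z)) := rfl

/-- The linear map `p` does not distinguish left multiplication by `f x` from left multiplication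
by `g x`. -/
def MulLeftEq (p : Y →ₗ[k] M) (f g : X → Y) : Prop := ∀ x y, p (f x * y) = p (g x * y)

/-- The linear map `p` does not distinguish right multiplication by `f x` from right
multiplication by `g x`. -/
def MulRightEq (p : Y →ₗ[k] M) (f g : X → Y) : Prop := ∀ x y, p (y * f x) = p (y * g x)

namespace MulLeftEq

theorem comp {X : Type*} {p : Y →ₗ[k] M} {f g : X → Y} (h : MulLeftEq p f g) (q : M →ₗ[k] N) :
    MulLeftEq (q ∘ₗ p) f g := fun x y => congrArg q (h x y)

theorem lTensor {p : Y →ₗ[k] M} {f g : X →ₐ[k] Y} (h : MulLeftEq p f g) (W : Type*) [Ring W]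
    [Algebra k W] : MulLeftEq (p.lTensor W) (onRight W f) (onRight W g) := fun t y => by
  apply eq_of_tmul t
  intro a x
  apply eq_of_tmul y
  intro b y
  simp only [onRight_tmul, Algebra.TensorProduct.tmul_mul_tmul, LinearMap.lTensor_tmul, h x y]

theorem splitFst {p : Y ⊗[k] (Z ⊗[k] W) →ₗ[k] M} {f g : X →ₐ[k] Y ⊗[k] Z}
    (h : ∀ w, MulLeftEq (fixLast p w) f g) :
    MulLeftEq p (splitFst W f) (splitFst W g) := fun t y => by
  apply eq_of_tmul t
  intro x w
  obtain ⟨y, rfl⟩ := (TensorProduct.assoc k Y Z W).surjective y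
  apply eq_of_tmul y
  intro y w'
  simp only [splitFst_tmul, ← assoc_mul, Algebra.TensorProduct.tmul_mul_tmul]
  exact h (w * w') x y

end MulLeftEq

namespace MulRightEq

theorem comp {X : Type*} {p : Y →ₗ[k] M} {f g : X → Y} (h : MulRightEq p f g) (q : M →ₗ[k] N) :
    MulRightEq (q ∘ₗ p) f g := fun x y => congrArg q (h x y)

theorem lTensor {p : Y →ₗ[k] M} {f g : X →ₐ[k] Y} (h : MulRightEq p f g) (W : Type*) [Ring W]
    [Algebra k W] : MulRightEq (p.lTensor W) (onRight W f) (onRight W g) := fun t y => by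
  apply eq_of_tmul t
  intro a x
  apply eq_of_tmul y
  intro b y
  simp only [onRight_tmul, Algebra.TensorProduct.tmul_mul_tmul, LinearMap.lTensor_tmul, h x y]

theorem splitFst {p : Y ⊗[k] (Z ⊗[k] W) →ₗ[k] M} {f g : X →ₐ[k] Y ⊗[k] Z}
    (h : ∀ w, MulRightEq (fixLast p w) f g) :
    MulRightEq p (splitFst W f) (splitFst W g) := fun t y => by
  apply eq_of_tmul t
  intro x w
  obtain ⟨y, rfl⟩ := (TensorProduct.assoc k Y Z W).surjective y
  apply eq_of_tmul y
  intro y w'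
  simp only [splitFst_tmul, ← assoc_mul, Algebra.TensorProduct.tmul_mul_tmul]
  exact h (w' * w) x y

end MulRightEq

end TensorCalculus

/-! ### Antipode and Drinfeld twist -/

section Counit

variable {k H : Type*} [Field k] [Ring H] [Algebra k H] [QuasiBialgebra k H]

open QuasiBialgebra

variable (k H) in
/-- The algebra map `h ↦ ε(h) 1` into an algebra `E`. -/
def counitTo (E : Type*) [Ring E] [Algebra k E] : H →ₐ[k] E := (Algebra.ofId k E).comp counit

theorem counitTo_apply (E : Type*) [Ring E] [Algebra k E] (h : H) :
    counitTo k H E h = (counit h : k) • (1 : E) := by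
  simp [counitTo, Algebra.ofId_apply, Algebra.algebraMap_eq_smul_one]

variable {W : Type*} [Ring W] [Algebra k W]

theorem onRight_counitTo (E : Type*) [Ring E] [Algebra k E] :
    onRight W (counitTo k H E) = (onRight W (Algebra.ofId k E)).comp (onRight W counit) :=
  onRight_comp ..

theorem splitFst_counitTo (Y Z : Type*) [Ring Y] [Algebra k Y] [Ring Z] [Algebra k Z] :
    splitFst W (counitTo k H (Y ⊗[k] Z)) =
      (splitFst W (Algebra.ofId k (Y ⊗[k] Z))).comp (onLeft W counit) :=
  splitFst_comp ..

theorem splitFst_counitTo_phi (Y Z : Type*) [Ring Y] [Algebra k Y] [Ring Z] [Algebra k Z] :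
    splitFst (H ⊗[k] H) (counitTo k H (Y ⊗[k] Z)) (phi k H) = 1 := by
  rw [splitFst_counitTo, AlgHom.comp_apply, phi, counit_Phi_fst, map_one]

theorem onRight_splitFst_counitTo_phi (Y Z : Type*) [Ring Y] [Algebra k Y] [Ring Z]
    [Algebra k Z] : onRight H (splitFst H (counitTo k H (Y ⊗[k] Z))) (phi k H) = 1 := by
  rw [splitFst_counitTo, onRight_comp, AlgHom.comp_apply, phi, counit_Phi_snd, map_one]

theorem onRight_onRight_counitTo_phi (E : Type*) [Ring E] [Algebra k E] :
    onRight H (onRight H (counitTo k H E)) (phi k H) = 1 := by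
  rw [onRight_counitTo, onRight_comp, AlgHom.comp_apply, phi, counit_Phi_trd, map_one]

theorem splitFst_counitTo_comul (Y Z : Type*) [Ring Y] [Algebra k Y] [Ring Z] [Algebra k Z]
    (h : H) : splitFst H (counitTo k H (Y ⊗[k] Z)) (comul h) = 1 ⊗ₜ (1 ⊗ₜ h) := by
  rw [splitFst_counitTo, AlgHom.comp_apply, counit_left]
  simp [splitFst_tmul]

theorem onRight_counitTo_comul (E : Type*) [Ring E] [Algebra k E] (h : H) :
    onRight H (counitTo k H E) (comul h) = h ⊗ₜ 1 := by
  rw [onRight_counitTo, AlgHom.comp_apply, counit_right]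
  simp

theorem PhiInv_mul_phi : PhiInv k H * phi k H = 1 := Units.inv_mul _

theorem PhiInv_mul_onRight_comul (h : H) :
    PhiInv k H * onRight H comul (comul h) = splitFst H comul (comul h) * PhiInv k H := by
  rw [coassoc]
  exact (mul_assoc ..).symm.trans (congrArg (· * _) (Units.inv_mul_cancel_left ..))

theorem onRight_onRight_comul_PhiInv_mul :
    onRight H (onRight H comul) (PhiInv k H) *
        (oneTmul H _ (phi k H) * onRight H (splitFst H comul) (phi k H)) =
      splitFst (H ⊗[k] H) comul (phi k H) * onRight H (onRight H (tmulOne H H)) (PhiInv k H) := by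
  let u := Units.map (onRight H (onRight H (comul (k := k) (H := H)))).toMonoidHom Phi
  let v := Units.map (onRight H (onRight H (tmulOne (k := k) H H))).toMonoidHom Phi
  exact (Units.inv_mul_eq_iff_eq_mul u).2
    ((Units.eq_mul_inv_iff_mul_eq v).2 pentagon |>.trans (mul_assoc ..))

end Counit

section Antipode

variable {k H : Type*} [Field k] [Ring H] [Algebra k H] [QuasiHopfAlgebra k H]

open QuasiBialgebra QuasiHopfAlgebra

theorem S_mul (a b : H) : S k H (a * b) = S k H b * S k H a := antipode_mul a b

@[simp] theorem SInv_S (a : H) : SInv k H (S k H a) = a := antipode.symm_apply_apply a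

@[simp] theorem S_SInv (a : H) : S k H (SInv k H a) = a := antipode.apply_symm_apply a

theorem SInv_mul (a b : H) : SInv k H (a * b) = SInv k H b * SInv k H a := by
  rw [← SInv_S (k := k) (SInv k H b * _), S_mul, S_SInv, S_SInv]

@[simp] theorem S_one : S k H 1 = 1 := by
  simpa only [mul_one, S_SInv, eq_comm] using S_mul (k := k) (SInv k H 1) (1 : H)

@[simp] theorem SInv_one : SInv k H 1 = 1 := by
  simpa only [S_one] using SInv_S (k := k) (1 : H)

end Antipode

section Sandwich

variable {k H E : Type*} [Field k] [Ring H] [Algebra k H] [Ring E] [Algebra k E]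

/-- The linear map `a ⊗ b ↦ σ(a) T δ(b)`, to be used for `σ` reversing products. -/
def sandwich (σ : H →ₗ[k] E) (δ : H →ₐ[k] E) (T : E) : H ⊗[k] H →ₗ[k] E :=
  prodMap (LinearMap.mulRight k T ∘ₗ σ) δ.toLinearMap

@[simp] theorem sandwich_tmul (σ : H →ₗ[k] E) (δ : H →ₐ[k] E) (T : E) (a b : H) :
    sandwich σ δ T (a ⊗ₜ b) = σ a * T * δ b := by
  simp [sandwich]

variable {σ : H →ₗ[k] E} {δ : H →ₐ[k] E} {T : E}

theorem sandwich_mul_tmul (hσ : ∀ a b, σ (a * b) = σ b * σ a) (d : H ⊗[k] H) (a b : H) :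
    sandwich σ δ T (d * a ⊗ₜ b) = σ a * sandwich σ δ T d * δ b := by
  apply eq_of_tmul d
  intro x y
  simp [mul_assoc, hσ]

theorem sandwich_mulLeftEq_comul [QuasiBialgebra k H] (hσ : ∀ a b, σ (a * b) = σ b * σ a)
    (hT : ∀ h, sandwich σ δ T (QuasiBialgebra.comul h) = (QuasiBialgebra.counit h : k) • T) :
    MulLeftEq (sandwich σ δ T) QuasiBialgebra.comul (counitTo k H (H ⊗[k] H)) := fun h t => by
  apply eq_of_tmul t
  intro a b
  rw [sandwich_mul_tmul hσ, hT, counitTo_apply]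
  simp

end Sandwich

section Contractions

variable (k H : Type*) [Field k] [Ring H] [Algebra k H] [QuasiHopfAlgebra k H]

open QuasiBialgebra QuasiHopfAlgebra

/-- The linear map `a ⊗ b ↦ S(a) α b`. -/
def evalAlpha : H ⊗[k] H →ₗ[k] H := sandwich (S k H) (AlgHom.id k H) (alpha k)

/-- The linear map `b ⊗ w ↦ b β e(w)`. -/
def evalBetaWith {W : Type*} [AddCommMonoid W] [Module k W] (e : W →ₗ[k] H) :
    H ⊗[k] W →ₗ[k] H :=
  prodMap (mulBeta k H) e

/-- The linear map `a ⊗ b ↦ a β S(b)`. -/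
def evalBeta : H ⊗[k] H →ₗ[k] H := evalBetaWith k H (S k H)

/-- The linear map `b ⊗ c ⊗ d ↦ b β S(c) α d`. -/
def evalBetaAlpha : H ⊗[k] (H ⊗[k] H) →ₗ[k] H := evalBetaWith k H (evalAlpha k H)

variable {k H}

@[simp] theorem evalAlpha_tmul (a b : H) :
    evalAlpha k H (a ⊗ₜ b) = S k H a * alpha k * b := by
  simp [evalAlpha]

@[simp] theorem evalBetaWith_tmul {W : Type*} [AddCommMonoid W] [Module k W] (e : W →ₗ[k] H)
    (b : H) (w : W) : evalBetaWith k H e (b ⊗ₜ w) = b * beta k * e w := by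
  simp [evalBetaWith]

@[simp] theorem evalBeta_tmul (a b : H) :
    evalBeta k H (a ⊗ₜ b) = a * beta k * S k H b :=
  evalBetaWith_tmul ..

@[simp] theorem evalBetaAlpha_tmul (a : H) (t : H ⊗[k] H) :
    evalBetaAlpha k H (a ⊗ₜ t) = a * beta k * evalAlpha k H t :=
  evalBetaWith_tmul ..

theorem evalAlpha_comul (h : H) :
    evalAlpha k H (Delta k H h) = (counit h : k) • alpha k :=
  antipode_alpha h

theorem evalAlpha_mulLeftEq_comul :
    MulLeftEq (evalAlpha k H) (Delta k H) (counitTo k H (H ⊗[k] H)) :=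
  sandwich_mulLeftEq_comul S_mul evalAlpha_comul

theorem evalBeta_tmul_mul (d : H ⊗[k] H) (a b : H) :
    evalBeta k H (a ⊗ₜ b * d) = a * evalBeta k H d * S k H b := by
  apply eq_of_tmul d
  intro x y
  simp only [Algebra.TensorProduct.tmul_mul_tmul, evalBeta_tmul, S_mul, mul_assoc]

theorem evalBeta_mulRightEq_comul :
    MulRightEq (evalBeta k H) (Delta k H) (counitTo k H (H ⊗[k] H)) := fun h t => by
  apply eq_of_tmul t
  intro a b
  rw [evalBeta_tmul_mul, show evalBeta k H (Delta k H h) = _ from antipode_beta h, counitTo_apply]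
  simp

theorem evalBetaAlpha_mulLeftEq_onRight_comul :
    MulLeftEq (evalBetaAlpha k H) (onRight H (Delta k H))
      (onRight H (counitTo k H (H ⊗[k] H))) := by
  have factor : evalBetaAlpha k H =
      evalBetaWith k H LinearMap.id ∘ₗ (evalAlpha k H).lTensor H :=
    TensorProduct.ext' fun a t => by simp
  rw [factor]
  exact (evalAlpha_mulLeftEq_comul.lTensor H).comp _

theorem evalBetaAlpha_mulRightEq_splitFst_comul :
    MulRightEq (evalBetaAlpha k H) (splitFst H (Delta k H))
      (splitFst H (counitTo k H (H ⊗[k] H))) := by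
  refine MulRightEq.splitFst fun d => ?_
  have factor : fixLast (evalBetaAlpha k H) d =
      LinearMap.mulRight k (alpha k * d) ∘ₗ evalBeta k H :=
    TensorProduct.ext' fun b c => by simp [mul_assoc]
  rw [factor]
  exact evalBeta_mulRightEq_comul.comp _

end Contractions

section AbstractTwist

variable {k H E : Type*} [Field k] [Ring H] [Algebra k H] [QuasiHopfAlgebra k H]
  [Ring E] [Algebra k E] {W : Type*}

open QuasiBialgebra QuasiHopfAlgebra

/-- The linear map `a ⊗ b ⊗ w ↦ σ(a) T δ(b β e(w))`. For `e = S` its value at `Φ⁻¹` is the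
twist determined by `σ`, `δ` and `T`. -/
def twistMap [AddCommMonoid W] [Module k W] (σ : H →ₗ[k] E) (δ : H →ₐ[k] E) (T : E)
    (e : W →ₗ[k] H) : H ⊗[k] (H ⊗[k] W) →ₗ[k] E :=
  sandwich σ δ T ∘ₗ (evalBetaWith k H e).lTensor H

@[simp] theorem twistMap_tmul [AddCommMonoid W] [Module k W] (σ : H →ₗ[k] E) (δ : H →ₐ[k] E)
    (T : E) (e : W →ₗ[k] H) (a : H) (t : H ⊗[k] W) :
    twistMap σ δ T e (a ⊗ₜ t) = σ a * T * δ (evalBetaWith k H e t) := by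
  simp [twistMap]

variable [Ring W] [Algebra k W] {σ : H →ₗ[k] E} {δ : H →ₐ[k] E} {T : E}

theorem twistMap_mulLeftEq_splitFst_comul (hσ : ∀ a b, σ (a * b) = σ b * σ a)
    (hT : ∀ h, sandwich σ δ T (Delta k H h) = (counit h : k) • T) (e : W →ₗ[k] H) :
    MulLeftEq (twistMap σ δ T e) (splitFst W (Delta k H))
      (splitFst W (counitTo k H (H ⊗[k] H))) := by
  refine MulLeftEq.splitFst fun w => ?_
  have factor : fixLast (twistMap σ δ T e) w =
      LinearMap.mulRight k (δ (beta k * e w)) ∘ₗ sandwich σ δ T :=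
    TensorProduct.ext' fun a b => by simp [mul_assoc]
  rw [factor]
  exact (sandwich_mulLeftEq_comul hσ hT).comp _

theorem twistMap_mulRightEq_onRight_comul (σ : H →ₗ[k] E) (δ : H →ₐ[k] E) (T : E) :
    MulRightEq (twistMap σ δ T (S k H)) (onRight H (Delta k H))
      (onRight H (counitTo k H (H ⊗[k] H))) :=
  (evalBeta_mulRightEq_comul.lTensor H).comp _

theorem twistMap_mul_tmul_one (hσ : ∀ a b, σ (a * b) = σ b * σ a) (e : W →ₗ[k] H)
    (y : H ⊗[k] (H ⊗[k] W)) (a : H) :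
    twistMap σ δ T e (y * a ⊗ₜ 1) = σ a * twistMap σ δ T e y := by
  apply eq_of_tmul y
  intro b t
  simp [hσ, mul_assoc]

theorem twistMap_one_tmul_mul (y : H ⊗[k] (H ⊗[k] H)) (a : H) :
    twistMap σ δ T (S k H) ((1 ⊗ₜ (1 ⊗ₜ a)) * y) = twistMap σ δ T (S k H) y * δ (S k H a) := by
  apply eq_of_tmul₃ y
  intro b c d
  simp [S_mul, mul_assoc]

theorem twistMap_PhiInv_mul_S (hσ : ∀ a b, σ (a * b) = σ b * σ a)
    (hT : ∀ h, sandwich σ δ T (Delta k H h) = (counit h : k) • T) (a : H) :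
    twistMap σ δ T (S k H) (PhiInv k H) * δ (S k H a) =
      σ a * twistMap σ δ T (S k H) (PhiInv k H) :=
  calc twistMap σ δ T (S k H) (PhiInv k H) * δ (S k H a)
    _ = twistMap σ δ T (S k H) (splitFst H (Delta k H) (Delta k H a) * PhiInv k H) := by
      rw [twistMap_mulLeftEq_splitFst_comul hσ hT, splitFst_counitTo_comul, twistMap_one_tmul_mul]
    _ = twistMap σ δ T (S k H) (PhiInv k H * onRight H (Delta k H) (Delta k H a)) := by
      rw [PhiInv_mul_onRight_comul]
    _ = σ a * twistMap σ δ T (S k H) (PhiInv k H) := by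
      rw [twistMap_mulRightEq_onRight_comul, onRight_counitTo_comul, twistMap_mul_tmul_one hσ]

theorem lTensor_evalBetaAlpha_pentagon :
    (evalBetaAlpha k H).lTensor H (onRight H (onRight H (Delta k H)) (PhiInv k H) *
      (oneTmul H _ (phi k H) * onRight H (splitFst H (Delta k H)) (phi k H))) = 1 ⊗ₜ 1 := by
  rw [evalBetaAlpha_mulLeftEq_onRight_comul.lTensor H, PhiInv,
    map_inv_eq_one _ _ (onRight_onRight_counitTo_phi _), one_mul,
    evalBetaAlpha_mulRightEq_splitFst_comul.lTensor H, onRight_splitFst_counitTo_phi, mul_one,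
    oneTmul_apply, LinearMap.lTensor_tmul]
  exact congrArg (1 ⊗ₜ ·) antipode_Phi

theorem twistMap_PhiInv_mul_alpha (hσ : ∀ a b, σ (a * b) = σ b * σ a) (hσ1 : σ 1 = 1)
    (hT : ∀ h, sandwich σ δ T (Delta k H h) = (counit h : k) • T) :
    twistMap σ δ T (S k H) (PhiInv k H) * δ (alpha k) = T :=
  calc twistMap σ δ T (S k H) (PhiInv k H) * δ (alpha k)
    _ = twistMap σ δ T (evalAlpha k H) (onRight H (onRight H (tmulOne H H)) (PhiInv k H)) := by
      generalize PhiInv k H = y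
      apply eq_of_tmul₃ y
      intro a b c
      simp [mul_assoc]
    _ = twistMap σ δ T (evalAlpha k H) (splitFst (H ⊗[k] H) (Delta k H) (phi k H) *
          onRight H (onRight H (tmulOne H H)) (PhiInv k H)) := by
      rw [twistMap_mulLeftEq_splitFst_comul hσ hT, splitFst_counitTo_phi, one_mul]
    _ = sandwich σ δ T (1 ⊗ₜ 1) := by
      rw [← onRight_onRight_comul_PhiInv_mul]
      exact congrArg (sandwich σ δ T) lTensor_evalBetaAlpha_pentagon
    _ = T := by simp [hσ1]

end AbstractTwist

section DrinfeldTwist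

variable {k H : Type*} [Field k] [Ring H] [Algebra k H] [QuasiHopfAlgebra k H]

open QuasiBialgebra QuasiHopfAlgebra

theorem antipodeCop_mul (a b : H) :
    antipodeCop k H (a * b) = antipodeCop k H b * antipodeCop k H a := by
  have flip_mul : ∀ x y : H ⊗[k] H,
      TensorProduct.map (S k H) (S k H) (TensorProduct.comm k H H (x * y)) =
        TensorProduct.map (S k H) (S k H) (TensorProduct.comm k H H y) *
          TensorProduct.map (S k H) (S k H) (TensorProduct.comm k H H x) := fun x y => by
    apply eq_of_tmul x
    intro a b
    apply eq_of_tmul y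
    intro c d
    simp only [Algebra.TensorProduct.tmul_mul_tmul, TensorProduct.comm_tmul,
      TensorProduct.map_tmul, S_mul]
  simp only [antipodeCop, LinearMap.comp_apply, AlgHom.toLinearMap_apply, LinearEquiv.coe_coe,
    map_mul, flip_mul]

theorem antipodeCop_one : antipodeCop k H 1 = 1 := by
  simp [antipodeCop, Algebra.TensorProduct.one_def]

theorem sandwich_gammaMap (d : H ⊗[k] H) (y : H ⊗[k] (H ⊗[k] (H ⊗[k] H))) :
    sandwich (antipodeCop k H) (Delta k H) (gammaMap k H y) d =
      gammaMap k H (y * splitFst (H ⊗[k] H) (Delta k H) (onRight H (Delta k H) d)) := by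
  have absorb : ∀ p r : H ⊗[k] H,
      TensorProduct.map (S k H) (S k H) (TensorProduct.comm k H H p) * gammaMap k H y * r =
        gammaMap k H (y * TensorProduct.assoc k H H (H ⊗[k] H) (p ⊗ₜ r)) := fun p r => by
    apply eq_of_tmul p
    intro a b
    apply eq_of_tmul r
    intro c d
    apply eq_of_tmul₃ y
    intro y₁ y₂ y
    apply eq_of_tmul y
    intro y₃ y₄
    simp only [TensorProduct.comm_tmul, TensorProduct.map_tmul, TensorProduct.assoc_tmul,
      Algebra.TensorProduct.tmul_mul_tmul, gammaMap_tmul, S_mul, mul_assoc]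
  apply eq_of_tmul d
  intro a b
  rw [sandwich_tmul, onRight_tmul, splitFst_tmul, ← absorb]
  rfl

theorem phi_mul_splitFst_comul (a : H) :
    phi k H * splitFst H (Delta k H) (Delta k H a) =
      onRight H (Delta k H) (Delta k H a) * phi k H :=
  (Units.mul_inv_eq_iff_eq_mul _).1 (coassoc a).symm

theorem elemA_mul_comul (h : H) :
    elemA k H * splitFst (H ⊗[k] H) (Delta k H) (onRight H (Delta k H) (Delta k H h)) =
      onRight H (splitFst H (Delta k H)) (splitFst H (Delta k H) (Delta k H h)) *
        elemA k H := by
  rw [elemA, mul_assoc, ← map_mul, PhiInv_mul_onRight_comul, map_mul, ← mul_assoc,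
    onRight_tmulOne_mul_splitFst_splitFst phi_mul_splitFst_comul, mul_assoc]

theorem gammaMap_mulLeftEq_onRight_splitFst_comul :
    MulLeftEq (gammaMap k H) (onRight H (splitFst H (Delta k H)))
      (onRight H (splitFst H (counitTo k H (H ⊗[k] H)))) := by
  let inner := (evalAlpha k H).rTensor H ∘ₗ (TensorProduct.assoc k H H H).symm.toLinearMap
  have inner_eq : MulLeftEq inner (splitFst H (Delta k H))
      (splitFst H (counitTo k H (H ⊗[k] H))) :=
    .splitFst fun w => by
      rw [show fixLast inner w = (TensorProduct.mk k H H).flip w ∘ₗ evalAlpha k H by ext; rfl]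
      exact evalAlpha_mulLeftEq_comul.comp _
  have factor : gammaMap k H =
      prodMap ((oneTmul H H).toLinearMap ∘ₗ mulAlpha k H ∘ₗ S k H) LinearMap.id ∘ₗ
        inner.lTensor H := by
    ext a b c d
    simp [inner, gammaMap_tmul]
  rw [factor]
  exact (inner_eq.lTensor H).comp _

theorem gammaMap_mulLeftEq_onRight_oneTmul_comul :
    MulLeftEq (gammaMap k H)
      ((onRight H ((oneTmul H (H ⊗[k] H)).comp (oneTmul H H))).comp (Delta k H))
      (counitTo k H _) := fun h y => by
  have outer : ∀ (d : H ⊗[k] H) (y₁ y₂ y₃ y₄ : H),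
      gammaMap k H (onRight H ((oneTmul H (H ⊗[k] H)).comp (oneTmul H H)) d *
        y₁ ⊗ₜ (y₂ ⊗ₜ (y₃ ⊗ₜ y₄))) =
      (S k H y₂ * alpha k * y₃) ⊗ₜ evalAlpha k H (d * y₁ ⊗ₜ y₄) := fun d y₁ y₂ y₃ y₄ => by
    apply eq_of_tmul d
    simp [gammaMap_tmul]
  apply eq_of_tmul₃ y
  intro y₁ y₂ y
  apply eq_of_tmul y
  intro y₃ y₄
  rw [AlgHom.comp_apply, outer, evalAlpha_mulLeftEq_comul, counitTo_apply, counitTo_apply]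
  simp [gammaMap_tmul]

theorem onRight_splitFst_counitTo_splitFst_comul (d : H ⊗[k] H) :
    onRight H (splitFst H (counitTo k H (H ⊗[k] H))) (splitFst H (Delta k H) d) =
      onRight H ((oneTmul H (H ⊗[k] H)).comp (oneTmul H H)) d := by
  apply eq_of_tmul d
  intro a b
  rw [onRight_splitFst_splitFst_tmul, onRight_counitTo_comul]
  rfl

theorem sandwich_gammaElem_comul (h : H) :
    sandwich (antipodeCop k H) (Delta k H) (gammaElem k H) (Delta k H h) =
      (counit h : k) • gammaElem k H := by
  rw [gammaElem, sandwich_gammaMap, elemA_mul_comul, gammaMap_mulLeftEq_onRight_splitFst_comul,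
    onRight_splitFst_counitTo_splitFst_comul]
  refine (gammaMap_mulLeftEq_onRight_oneTmul_comul h _).trans ?_
  rw [counitTo_apply, smul_one_mul, map_smul]

theorem counit_S (h : H) : (counit (S k H h) : k) = counit h := by
  have counit_evalAlpha : ∀ d : H ⊗[k] H, (counit (evalAlpha k H d) : k) =
      counit (S k H (TensorProduct.rid k H (onRight H counit d))) := fun d => by
    apply eq_of_tmul d
    simp [counit_alpha, mul_comm]
  have h_alpha := congrArg (counit (k := k) (H := H)) (evalAlpha_comul (k := k) h)
  rw [counit_evalAlpha, counit_right] at h_alpha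
  simpa [counit_alpha] using h_alpha

theorem counit_SInv (h : H) : (counit (SInv k H h) : k) = counit h := by
  rw [← counit_S, S_SInv]

theorem drinfeldTwist_eq :
    drinfeldTwist k H =
      twistMap (antipodeCop k H) (Delta k H) (gammaElem k H) (S k H) (PhiInv k H) :=
  DFunLike.congr_fun (TensorProduct.ext' fun a t => by simp [evalBetaWith]) (PhiInv k H)

theorem drinfeldTwist_mul_comul_S (a : H) :
    drinfeldTwist k H * Delta k H (S k H a) = antipodeCop k H a * drinfeldTwist k H := by
  rw [drinfeldTwist_eq]
  exact twistMap_PhiInv_mul_S antipodeCop_mul sandwich_gammaElem_comul a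

theorem drinfeldTwist_mul_comul_alpha :
    drinfeldTwist k H * Delta k H (alpha k) = gammaElem k H := by
  rw [drinfeldTwist_eq]
  exact twistMap_PhiInv_mul_alpha antipodeCop_mul antipodeCop_one sandwich_gammaElem_comul

end DrinfeldTwist

section CounitContraction

open QuasiBialgebra QuasiHopfAlgebra

section QuasiBialgebra

variable (k H Y : Type*) [Field k] [Ring H] [Algebra k H] [QuasiBialgebra k H] [Ring Y]
  [Algebra k Y]

/-- The algebra map `h ⊗ y ↦ ε(h) y`. -/
def counitFst : H ⊗[k] Y →ₐ[k] Y :=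
  (Algebra.TensorProduct.lid k Y).toAlgHom.comp (onLeft Y counit)

/-- The algebra map `y ⊗ h ↦ ε(h) y`. -/
def counitSnd : Y ⊗[k] H →ₐ[k] Y :=
  (Algebra.TensorProduct.rid k k Y).toAlgHom.comp (onRight Y counit)

variable {k H Y} {W : Type*} [Ring W] [Algebra k W]

@[simp] theorem counitFst_tmul (h : H) (y : Y) :
    counitFst k H Y (h ⊗ₜ y) = (counit h : k) • y := by
  simp [counitFst]

@[simp] theorem counitSnd_tmul (h : H) (y : Y) :
    counitSnd k H Y (y ⊗ₜ h) = (counit h : k) • y := by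
  simp [counitSnd]

@[simp] theorem counitFst_comul (h : H) : counitFst k H H (comul h) = h := by
  rw [counitFst, AlgHom.comp_apply, counit_left]
  simp

@[simp] theorem counitSnd_comul (h : H) : counitSnd k H H (comul h) = h := by
  rw [counitSnd, AlgHom.comp_apply, counit_right]
  simp

theorem counitFst_phi : counitFst k H (H ⊗[k] H) (phi k H) = 1 := by
  rw [counitFst, AlgHom.comp_apply, phi, counit_Phi_fst, map_one]

theorem onRight_counitFst_phi : onRight H (counitFst k H H) (phi k H) = 1 := by
  rw [counitFst, onRight_comp, AlgHom.comp_apply, phi, counit_Phi_snd, map_one]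

theorem onRight_counitSnd_phi : onRight H (counitSnd k H H) (phi k H) = 1 := by
  rw [counitSnd, onRight_comp, AlgHom.comp_apply, phi, counit_Phi_trd, map_one]

theorem counitFst_splitFst (f : Y →ₐ[k] H ⊗[k] Y) (hf : ∀ y, counitFst k H Y (f y) = y)
    (t : Y ⊗[k] W) : counitFst k H (Y ⊗[k] W) (splitFst W f t) = t := by
  apply eq_of_tmul t
  intro y w
  have counit_assoc : ∀ d : H ⊗[k] Y, counitFst k H (Y ⊗[k] W)
      (TensorProduct.assoc k H Y W (d ⊗ₜ w)) = counitFst k H Y d ⊗ₜ w := fun d => by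
    apply eq_of_tmul d
    simp [TensorProduct.smul_tmul']
  rw [splitFst_tmul, counit_assoc, hf]

theorem onRight_counitFst_splitFst (f : Y →ₐ[k] Y ⊗[k] H)
    (hf : ∀ y, counitSnd k H Y (f y) = y) (t : Y ⊗[k] W) :
    onRight Y (counitFst k H W) (splitFst W f t) = t := by
  apply eq_of_tmul t
  intro y w
  have counit_assoc : ∀ d : Y ⊗[k] H, onRight Y (counitFst k H W)
      (TensorProduct.assoc k Y H W (d ⊗ₜ w)) = counitSnd k H Y d ⊗ₜ w := fun d => by
    apply eq_of_tmul d
    simp [TensorProduct.smul_tmul']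
  rw [splitFst_tmul, counit_assoc, hf]

end QuasiBialgebra

variable {k H : Type*} [Field k] [Ring H] [Algebra k H] [QuasiHopfAlgebra k H]

theorem counitFst_gammaElem : counitFst k H H (gammaElem k H) = alpha k := by
  have counit_gammaMap : ∀ y, counitFst k H H (gammaMap k H y) =
      evalAlpha k H (onRight H ((counitFst k H H).comp (counitFst k H (H ⊗[k] H))) y) :=
    fun y => by
      apply eq_of_tmul₃ y
      intro y₁ y₂ y
      apply eq_of_tmul y
      intro y₃ y₄
      simp only [gammaMap_tmul, counitFst_tmul, map_mul, counit_S, counit_alpha]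
      simp [smul_smul, mul_comm]
  have counit_tmulOne : ∀ y, onRight H ((counitFst k H H).comp (counitFst k H (H ⊗[k] H)))
      (onRight H (onRight H (tmulOne H H)) y) =
      onRight H (counitTo k H H) (onRight H (counitFst k H H) y) := fun y => by
    apply eq_of_tmul₃ y
    simp [counitTo_apply, smul_smul]
  have counit_PhiInv : onRight H (counitFst k H H) (PhiInv k H) = 1 :=
    map_inv_eq_one _ Phi onRight_counitFst_phi
  rw [gammaElem, counit_gammaMap, elemA, map_mul, counit_tmulOne, onRight_counitFst_phi, map_one,
    one_mul, onRight_comp, AlgHom.comp_apply, onRight_counitFst_splitFst _ counitSnd_comul,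
    counit_PhiInv, Algebra.TensorProduct.one_def]
  simp

theorem counitSnd_gammaElem : counitSnd k H H (gammaElem k H) = alpha k := by
  have counit_gammaMap : ∀ y, counitSnd k H H (gammaMap k H y) =
      evalAlpha k H (onRight H (counitSnd k H H) (counitFst k H _ y)) := fun y => by
    apply eq_of_tmul₃ y
    intro y₁ y₂ y
    apply eq_of_tmul y
    intro y₃ y₄
    simp only [gammaMap_tmul, counitSnd_tmul, map_mul, counit_S, counit_alpha]
    simp [smul_smul, mul_comm]
  have counit_tmulOne : ∀ y, onRight H (counitSnd k H H) (counitFst k H _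
      (onRight H (onRight H (tmulOne H H)) y)) = counitFst k H _ y := fun y => by
    apply eq_of_tmul₃ y
    simp
  have counit_PhiInv : onRight H (counitSnd k H H) (PhiInv k H) = 1 :=
    map_inv_eq_one _ Phi onRight_counitSnd_phi
  rw [gammaElem, counit_gammaMap, elemA, map_mul, map_mul, counit_tmulOne, counitFst_phi, one_mul,
    counitFst_splitFst _ counitFst_comul, counit_PhiInv, Algebra.TensorProduct.one_def]
  simp

theorem map_antipodeCop (e e' : H ⊗[k] H →ₐ[k] H)
    (he : ∀ a b, e (S k H b ⊗ₜ S k H a) = S k H (e' (a ⊗ₜ b)))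
    (he' : ∀ h, e' (Delta k H h) = h) (h : H) : e (antipodeCop k H h) = S k H h := by
  have map_flip : ∀ d : H ⊗[k] H,
      e (TensorProduct.map (S k H) (S k H) (TensorProduct.comm k H H d)) = S k H (e' d) :=
    fun d => by
      apply eq_of_tmul d
      exact he
  exact (map_flip _).trans (congrArg _ (he' h))

theorem map_drinfeldTwist (e : H ⊗[k] H →ₐ[k] H) (hS : ∀ h, e (antipodeCop k H h) = S k H h)
    (hγ : e (gammaElem k H) = alpha k) (hΔ : ∀ h, e (Delta k H h) = h) :
    e (drinfeldTwist k H) = 1 := by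
  have map_twistMap : ∀ y,
      e (twistMap (antipodeCop k H) (Delta k H) (gammaElem k H) (S k H) y) =
        prodMap (mulAlpha k H ∘ₗ S k H) (evalBeta k H) y := fun y => by
    apply eq_of_tmul₃ y
    intro a b c
    simp [-LinearEquiv.coe_coe, hS, hγ, hΔ]
  rw [drinfeldTwist_eq, map_twistMap]
  exact antipode_PhiInv

theorem counitFst_drinfeldTwist : counitFst k H H (drinfeldTwist k H) = 1 :=
  map_drinfeldTwist _ (map_antipodeCop _ (counitSnd k H H)
    (fun a b => by rw [counitFst_tmul, counitSnd_tmul, counit_S, map_smul]) counitSnd_comul)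
    counitFst_gammaElem counitFst_comul

theorem counitSnd_drinfeldTwist : counitSnd k H H (drinfeldTwist k H) = 1 :=
  map_drinfeldTwist _ (map_antipodeCop _ (counitFst k H H)
    (fun a b => by rw [counitFst_tmul, counitSnd_tmul, counit_S, map_smul]) counitFst_comul)
    counitSnd_gammaElem counitSnd_comul

end CounitContraction

/-! ### The elements `p̃` and `q̃` -/

section RightComodule

open QuasiBialgebra QuasiHopfAlgebra RightComoduleAlgebra

variable {k H 𝔸 : Type*} [Field k] [Ring H] [Algebra k H] [QuasiHopfAlgebra k H] [Ring 𝔸]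
  [Algebra k 𝔸]

variable (k H 𝔸) in
/-- The linear map `a ⊗ b ⊗ c ↦ a ⊗ S⁻¹(α c) b`, which sends `Φ_ρ` to `q̃`. -/
def qMap : 𝔸 ⊗[k] (H ⊗[k] H) →ₗ[k] 𝔸 ⊗[k] H :=
  (SInv k H ∘ₗ evalAlpha k H).lTensor 𝔸

@[simp] theorem qMap_tmul (a : 𝔸) (t : H ⊗[k] H) :
    qMap k H 𝔸 (a ⊗ₜ t) = a ⊗ₜ SInv k H (evalAlpha k H t) := rfl

theorem SInv_evalAlpha_mul_tmul (d : H ⊗[k] H) (a b : H) :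
    SInv k H (evalAlpha k H (d * a ⊗ₜ b)) = SInv k H b * SInv k H (evalAlpha k H d) * a := by
  rw [evalAlpha, sandwich_mul_tmul S_mul, SInv_mul, SInv_mul, SInv_S, AlgHom.id_apply, mul_assoc]

theorem qMap_mulLeftEq_onRight_comul :
    MulLeftEq (qMap k H 𝔸) (onRight 𝔸 (Delta k H)) (onRight 𝔸 (counitTo k H (H ⊗[k] H))) :=
  (evalAlpha_mulLeftEq_comul.comp _).lTensor 𝔸

theorem qMap_tmul_one_mul (a : 𝔸) (y : 𝔸 ⊗[k] (H ⊗[k] H)) :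
    qMap k H 𝔸 (a ⊗ₜ 1 * y) = a ⊗ₜ 1 * qMap k H 𝔸 y := by
  apply eq_of_tmul y
  simp

theorem qMap_mul_splitFst_tmul (f : 𝔸 →ₐ[k] 𝔸 ⊗[k] H) (y : 𝔸 ⊗[k] (H ⊗[k] H)) (a : 𝔸) (h : H) :
    qMap k H 𝔸 (y * splitFst H f (a ⊗ₜ h)) = 1 ⊗ₜ SInv k H h * qMap k H 𝔸 y * f a := by
  rw [splitFst_tmul]
  generalize f a = r
  apply eq_of_tmul r
  intro b c
  apply eq_of_tmul y
  intro d s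
  rw [TensorProduct.assoc_tmul, Algebra.TensorProduct.tmul_mul_tmul, qMap_tmul,
    SInv_evalAlpha_mul_tmul]
  simp

variable [RightComoduleAlgebra k H 𝔸]

theorem qRho_eq : qRho k H 𝔸 = qMap k H 𝔸 (phiRho k H 𝔸) := by
  rw [qRho, qMap, LinearMap.lTensor]
  congr 2
  refine TensorProduct.ext' fun a b => ?_
  rw [LinearMap.comp_apply, LinearMap.comp_apply, evalAlpha_tmul, mul_assoc, SInv_mul, SInv_S]
  simp

theorem pRho_eq : pRho k H 𝔸 = (evalBeta k H).lTensor 𝔸 (phiRhoInv k H 𝔸) := rfl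

theorem onRight_counitFst_phiRho : onRight 𝔸 (counitFst k H H) (phiRho k H 𝔸) = 1 := by
  rw [counitFst, onRight_comp, AlgHom.comp_apply, phiRho, counit_PhiRho_snd, map_one]

theorem onRight_counitSnd_phiRho : onRight 𝔸 (counitSnd k H H) (phiRho k H 𝔸) = 1 := by
  rw [counitSnd, onRight_comp, AlgHom.comp_apply, phiRho, counit_PhiRho_trd, map_one]

theorem onRight_splitFst_counitTo_phiRho (Y Z : Type*) [Ring Y] [Algebra k Y] [Ring Z]
    [Algebra k Z] :
    onRight 𝔸 (splitFst H (counitTo k H (Y ⊗[k] Z))) (phiRho k H 𝔸) = 1 := by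
  rw [splitFst_counitTo, onRight_comp, AlgHom.comp_apply, phiRho, counit_PhiRho_snd, map_one]

theorem onRight_onRight_counitTo_phiRho (E : Type*) [Ring E] [Algebra k E] :
    onRight 𝔸 (onRight H (counitTo k H E)) (phiRho k H 𝔸) = 1 := by
  rw [onRight_counitTo, onRight_comp, AlgHom.comp_apply, phiRho, counit_PhiRho_trd, map_one]

@[simp] theorem counitSnd_rho (a : 𝔸) : counitSnd k H 𝔸 (rho a) = a := by
  rw [counitSnd, AlgHom.comp_apply, rho_counit]
  simp

theorem onRight_counitTo_rho (E : Type*) [Ring E] [Algebra k E] (a : 𝔸) :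
    onRight 𝔸 (counitTo k H E) (rho a) = a ⊗ₜ 1 := by
  rw [onRight_counitTo, AlgHom.comp_apply, rho_counit]
  simp

theorem phiRho_mul_splitFst_rho (a : 𝔸) :
    phiRho k H 𝔸 * splitFst H (rho (k := k) (H := H)) (rho a) =
      onRight 𝔸 (Delta k H) (rho a) * phiRho k H 𝔸 := rho_coassoc a

theorem qMap_phiRho_mul_splitFst_rho (a : 𝔸) :
    qMap k H 𝔸 (phiRho k H 𝔸 * splitFst H (rho (k := k) (H := H)) (rho a)) =
      a ⊗ₜ 1 * qRho k H 𝔸 := by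
  rw [phiRho_mul_splitFst_rho, qMap_mulLeftEq_onRight_comul, onRight_counitTo_rho,
    qMap_tmul_one_mul, qRho_eq]

theorem onRight_tmulOne_phiRho_mul_splitFst_phiRhoInv :
    onRight 𝔸 (onRight H (tmulOne H H)) (phiRho k H 𝔸) *
        splitFst (H ⊗[k] H) (rho (k := k) (H := H)) (phiRhoInv k H 𝔸) =
      onRight 𝔸 (splitFst H (Delta k H)) (phiRhoInv k H 𝔸) *
        (oneTmul 𝔸 _ (PhiInv k H) * onRight 𝔸 (onRight H (Delta k H)) (phiRho k H 𝔸)) := by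
  let u := Units.map (splitFst (H ⊗[k] H) (rho (k := k) (H := H) (A := 𝔸))).toMonoidHom PhiRho
  let v := Units.map (onRight 𝔸 (splitFst H (Delta k H))).toMonoidHom PhiRho
  let w := Units.map (oneTmul (k := k) 𝔸 (H ⊗[k] (H ⊗[k] H))).toMonoidHom Phi
  have pentagon : ↑w * (↑v * onRight 𝔸 (onRight H (tmulOne H H)) (phiRho k H 𝔸)) =
      onRight 𝔸 (onRight H (Delta k H)) (phiRho k H 𝔸) * ↑u :=
    (mul_assoc ..).symm.trans rho_pentagon
  refine (Units.mul_inv_eq_iff_eq_mul u).2 ?_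
  rw [mul_assoc, mul_assoc]
  exact (Units.eq_inv_mul_iff_mul_eq v).2 ((Units.eq_inv_mul_iff_mul_eq w).2 pentagon)

theorem splitFst_phiRho_mul_onRight_tmulOne_phiRhoInv :
    splitFst (H ⊗[k] H) (rho (k := k) (H := H)) (phiRho k H 𝔸) *
        onRight 𝔸 (onRight H (tmulOne H H)) (phiRhoInv k H 𝔸) =
      onRight 𝔸 (onRight H (Delta k H)) (phiRhoInv k H 𝔸) *
        (oneTmul 𝔸 _ (phi k H) * onRight 𝔸 (splitFst H (Delta k H)) (phiRho k H 𝔸)) := by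
  let u := Units.map (onRight 𝔸 (onRight H (Delta k H))).toMonoidHom PhiRho
  let v := Units.map (onRight 𝔸 (onRight H (tmulOne (k := k) H H))).toMonoidHom PhiRho
  exact (Units.eq_inv_mul_iff_mul_eq u).2 ((mul_assoc ..).symm.trans
    ((Units.mul_inv_eq_iff_eq_mul v).2 rho_pentagon.symm))

theorem lTensor_SInv_twistMap_mul_splitFst_rho (u y : 𝔸 ⊗[k] (H ⊗[k] H)) :
    (SInv k H).lTensor 𝔸 ((twistMap (S k H) (AlgHom.id k H) (alpha k) (S k H)).lTensor 𝔸
      (onRight 𝔸 (onRight H (tmulOne H H)) u *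
        splitFst (H ⊗[k] H) (rho (k := k) (H := H)) y)) =
      qMap k H 𝔸 (u * splitFst H (rho (k := k) (H := H)) ((evalBeta k H).lTensor 𝔸 y)) := by
  apply eq_of_tmul y
  intro a s
  rw [LinearMap.lTensor_tmul, splitFst_tmul, splitFst_tmul]
  generalize rho (k := k) (H := H) a = r
  apply eq_of_tmul r
  intro b c
  apply eq_of_tmul s
  intro s₁ s₂
  apply eq_of_tmul₃ u
  simp [-LinearEquiv.coe_coe, mul_assoc]

theorem qMap_phiRho_mul_splitFst_pRho :
    qMap k H 𝔸 (phiRho k H 𝔸 * splitFst H (rho (k := k) (H := H)) (pRho k H 𝔸)) = 1 := by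
  have hα : ∀ h, sandwich (S k H) (AlgHom.id k H) (alpha k) (Delta k H h) =
    (counit h : k) • alpha k := antipode_alpha
  rw [pRho_eq, ← lTensor_SInv_twistMap_mul_splitFst_rho,
    onRight_tmulOne_phiRho_mul_splitFst_phiRhoInv,
    (twistMap_mulLeftEq_splitFst_comul S_mul hα _).lTensor, phiRhoInv,
    map_inv_eq_one _ _ (onRight_splitFst_counitTo_phiRho _ _), one_mul,
    (twistMap_mulRightEq_onRight_comul _ _ _).lTensor, onRight_onRight_counitTo_phiRho, mul_one,
    oneTmul_apply, LinearMap.lTensor_tmul, LinearMap.lTensor_tmul]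
  have twist_eq_one : twistMap (S k H) (AlgHom.id k H) (alpha k) (S k H) (PhiInv k H) = 1 := by
    rw [← antipode_PhiInv (k := k) (H := H)]
    generalize PhiInv k H = y
    apply eq_of_tmul₃ y
    simp [-LinearEquiv.coe_coe]
  rw [twist_eq_one, SInv_one, Algebra.TensorProduct.one_def]

theorem prodMap_rho_mul_qMap (u y : 𝔸 ⊗[k] (H ⊗[k] H)) :
    prodMap (LinearMap.mulRight k ((evalBeta k H).lTensor 𝔸 y) ∘ₗ
      (rho (k := k) (H := H)).toLinearMap) ((oneTmul 𝔸 H).toLinearMap ∘ₗ S k H) (qMap k H 𝔸 u) =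
      (evalBetaAlpha k H).lTensor 𝔸 (splitFst (H ⊗[k] H) (rho (k := k) (H := H)) u *
        onRight 𝔸 (onRight H (tmulOne H H)) y) := by
  apply eq_of_tmul u
  intro u₁ u
  rw [qMap_tmul, prodMap_tmul, splitFst_tmul]
  simp only [LinearMap.comp_apply, LinearMap.mulRight_apply, AlgHom.toLinearMap_apply]
  rw [S_SInv]
  generalize rho (k := k) (H := H) u₁ = r
  apply eq_of_tmul r
  intro b c
  apply eq_of_tmul u
  intro u₂ u₃
  apply eq_of_tmul₃ y
  simp [-LinearEquiv.coe_coe, S_mul, mul_assoc]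

theorem rho_qRho_mul_pRho :
    prodMap (LinearMap.mulRight k (pRho k H 𝔸) ∘ₗ (rho (k := k) (H := H)).toLinearMap)
      ((oneTmul 𝔸 H).toLinearMap ∘ₗ S k H) (qRho k H 𝔸) = 1 := by
  rw [pRho_eq, qRho_eq, prodMap_rho_mul_qMap, splitFst_phiRho_mul_onRight_tmulOne_phiRhoInv,
    evalBetaAlpha_mulLeftEq_onRight_comul.lTensor, phiRhoInv,
    map_inv_eq_one _ _ (onRight_onRight_counitTo_phiRho _), one_mul,
    evalBetaAlpha_mulRightEq_splitFst_comul.lTensor, onRight_splitFst_counitTo_phiRho, mul_one,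
    oneTmul_apply, LinearMap.lTensor_tmul]
  exact congrArg (1 ⊗ₜ ·) antipode_Phi

end RightComodule

/-! ### The formula for `(id ⊗ Δ)(q̃)` -/

section SwapInv

variable (k H : Type*) [Field k] [Ring H] [Algebra k H] [QuasiHopfAlgebra k H]

open QuasiBialgebra QuasiHopfAlgebra

/-- The linear map `a ⊗ b ↦ S⁻¹(b) ⊗ S⁻¹(a)`. -/
def swapInv : H ⊗[k] H →ₗ[k] H ⊗[k] H :=
  TensorProduct.map (SInv k H) (SInv k H) ∘ₗ (TensorProduct.comm k H H).toLinearMap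

variable {k H}

@[simp] theorem swapInv_tmul (a b : H) :
    swapInv k H (a ⊗ₜ b) = SInv k H b ⊗ₜ SInv k H a := rfl

theorem swapInv_mul (x y : H ⊗[k] H) :
    swapInv k H (x * y) = swapInv k H y * swapInv k H x := by
  apply eq_of_tmul x
  intro a b
  apply eq_of_tmul y
  simp only [Algebra.TensorProduct.tmul_mul_tmul, swapInv_tmul, SInv_mul, implies_true]

theorem swapInv_antipodeCop (h : H) : swapInv k H (antipodeCop k H h) = Delta k H h := by
  rw [antipodeCop, LinearMap.comp_apply, LinearMap.comp_apply, AlgHom.toLinearMap_apply]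
  generalize Delta k H h = d
  apply eq_of_tmul d
  intro a b
  rw [LinearEquiv.coe_coe, TensorProduct.comm_tmul, TensorProduct.map_tmul, swapInv_tmul, SInv_S,
    SInv_S]

theorem swapInv_drinfeldTwist_mul_comul_SInv (h : H) :
    swapInv k H (drinfeldTwist k H) * Delta k H (SInv k H h) =
      swapInv k H (drinfeldTwist k H * Delta k H h) := by
  rw [← S_SInv (k := k) h, drinfeldTwist_mul_comul_S, swapInv_mul, swapInv_antipodeCop, S_SInv]

theorem drinfeldTwist_mul_comul_evalAlpha (t : H ⊗[k] H) :
    drinfeldTwist k H * Delta k H (evalAlpha k H t) =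
      sandwich (antipodeCop k H) (Delta k H) (gammaElem k H) t := by
  apply eq_of_tmul t
  intro a b
  rw [evalAlpha_tmul, map_mul, map_mul, ← mul_assoc, ← mul_assoc, drinfeldTwist_mul_comul_S,
    mul_assoc (antipodeCop k H a), drinfeldTwist_mul_comul_alpha, sandwich_tmul]

theorem swapInv_drinfeldTwist_mul_mul_comul_SInv_evalAlpha (t z : H ⊗[k] H) :
    swapInv k H (drinfeldTwist k H * z) * Delta k H (SInv k H (evalAlpha k H t)) =
      swapInv k H (gammaMap k H (elemA k H *
        splitFst (H ⊗[k] H) (Delta k H) (onRight H (Delta k H) t)) * z) := by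
  rw [swapInv_mul, mul_assoc, swapInv_drinfeldTwist_mul_comul_SInv,
    drinfeldTwist_mul_comul_evalAlpha, gammaElem, sandwich_gammaMap, ← swapInv_mul]

theorem gammaMap_mul (y : H ⊗[k] (H ⊗[k] (H ⊗[k] H))) (z : H ⊗[k] H) :
    gammaMap k H y * z = gammaMap k H (y * 1 ⊗ₜ (1 ⊗ₜ z)) := by
  apply eq_of_tmul z
  intro a b
  apply eq_of_tmul₃ y
  intro y₁ y₂ y
  apply eq_of_tmul y
  simp [-LinearEquiv.coe_coe, gammaMap_tmul, mul_assoc]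

theorem swapInv_gammaMap_mul (y : H ⊗[k] (H ⊗[k] (H ⊗[k] H))) (x : H ⊗[k] H) :
    swapInv k H (gammaMap k H y) * x =
      swapInv k H (gammaMap k H (y * onRight H (tmulOne H (H ⊗[k] H)) x)) := by
  apply eq_of_tmul x
  intro a b
  apply eq_of_tmul₃ y
  intro y₁ y₂ y
  apply eq_of_tmul y
  intro y₃ y₄
  simp only [onRight_tmul, tmulOne_apply, Algebra.TensorProduct.tmul_mul_tmul,
    Algebra.TensorProduct.one_def, mul_one, gammaMap_tmul, swapInv_tmul, SInv_mul, SInv_S,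
    S_mul, mul_assoc]

theorem swapInv_gammaMap_tmul_mul (b e : H) (s : H ⊗[k] (H ⊗[k] H)) :
    swapInv k H (gammaMap k H (b ⊗ₜ (1 ⊗ₜ (1 ⊗ₜ e)) * onRight H (onRight H (tmulOne H H)) s)) =
      SInv k H (evalAlpha k H (b ⊗ₜ e)) ⊗ₜ 1 * qMap k H H s := by
  apply eq_of_tmul₃ s
  intro s₁ s₂ s₃
  simp only [onRight_tmul, tmulOne_apply, Algebra.TensorProduct.tmul_mul_tmul, gammaMap_tmul,
    swapInv_tmul, qMap_tmul, evalAlpha_tmul, one_mul, mul_one, SInv_mul, S_mul, SInv_S, mul_assoc]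

end SwapInv

section Coproduct

variable {k H 𝔸 : Type*} [Field k] [Ring H] [Algebra k H] [QuasiHopfAlgebra k H]
  [Ring 𝔸] [Algebra k 𝔸]

open QuasiBialgebra QuasiHopfAlgebra

variable (k H 𝔸) in
/-- The linear map `a ⊗ b ⊗ c ⊗ d ⊗ e ↦ a ⊗ S⁻¹(α e) b ⊗ S⁻¹(α d) c`. -/
def qMap₂ : 𝔸 ⊗[k] (H ⊗[k] (H ⊗[k] (H ⊗[k] H))) →ₗ[k] 𝔸 ⊗[k] (H ⊗[k] H) :=
  (swapInv k H ∘ₗ gammaMap k H).lTensor 𝔸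

@[simp] theorem qMap₂_tmul (a : 𝔸) (t : H ⊗[k] (H ⊗[k] (H ⊗[k] H))) :
    qMap₂ k H 𝔸 (a ⊗ₜ t) = a ⊗ₜ swapInv k H (gammaMap k H t) := rfl

theorem qMap₂_mul (y : 𝔸 ⊗[k] (H ⊗[k] (H ⊗[k] (H ⊗[k] H)))) (x : 𝔸 ⊗[k] (H ⊗[k] H)) :
    qMap₂ k H 𝔸 y * x =
      qMap₂ k H 𝔸 (y * onRight 𝔸 (onRight H (tmulOne H (H ⊗[k] H))) x) := by
  apply eq_of_tmul x
  intro a b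
  apply eq_of_tmul y
  intro c d
  simp only [qMap₂_tmul, onRight_tmul, Algebra.TensorProduct.tmul_mul_tmul, swapInv_gammaMap_mul]

theorem qMap₂_mulLeftEq_onRight_onRight_splitFst_comul :
    MulLeftEq (qMap₂ k H 𝔸) (onRight 𝔸 (onRight H (splitFst H (Delta k H))))
      (onRight 𝔸 (onRight H (splitFst H (counitTo k H (H ⊗[k] H))))) :=
  (gammaMap_mulLeftEq_onRight_splitFst_comul.comp _).lTensor 𝔸

theorem oneTmul_swapInv_mul_onRight_comul_qMap (y : 𝔸 ⊗[k] (H ⊗[k] H)) (z : H ⊗[k] H) :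
    oneTmul 𝔸 _ (swapInv k H (drinfeldTwist k H * z)) *
      onRight 𝔸 (Delta k H) (qMap k H 𝔸 y) =
    qMap₂ k H 𝔸 (oneTmul 𝔸 _ (elemA k H) *
      onRight 𝔸 ((splitFst (H ⊗[k] H) (Delta k H)).comp (onRight H (Delta k H))) y *
      1 ⊗ₜ (1 ⊗ₜ (1 ⊗ₜ z))) := by
  apply eq_of_tmul y
  intro a t
  rw [qMap_tmul, onRight_tmul, onRight_tmul, oneTmul_apply, oneTmul_apply,
    Algebra.TensorProduct.tmul_mul_tmul, Algebra.TensorProduct.tmul_mul_tmul,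
    Algebra.TensorProduct.tmul_mul_tmul, qMap₂_tmul,
    swapInv_drinfeldTwist_mul_mul_comul_SInv_evalAlpha, gammaMap_mul, mul_one, one_mul,
    AlgHom.comp_apply]

theorem oneTmul_mul_onRight {W X Y : Type*} [Ring X] [Algebra k X] [Ring Y] [Algebra k Y]
    [Ring W] [Algebra k W] {f g : X →ₐ[k] Y} {p : Y} (h : ∀ x, p * f x = g x * p)
    (t : W ⊗[k] X) : oneTmul W Y p * onRight W f t = onRight W g t * oneTmul W Y p := by
  apply eq_of_tmul t
  simp [h]

theorem splitFst_onRight_tmulOne {W X Y V : Type*} [Ring X] [Algebra k X] [Ring Y] [Algebra k Y]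
    [Ring W] [Algebra k W] [Ring V] [Algebra k V] (f : W →ₐ[k] V ⊗[k] W) (t : W ⊗[k] X) :
    splitFst (X ⊗[k] Y) f (onRight W (tmulOne X Y) t) =
      onRight V (onRight W (tmulOne X Y)) (splitFst X f t) := by
  apply eq_of_tmul t
  intro a b
  simp only [onRight_tmul, splitFst_tmul, tmulOne_apply]
  generalize f a = r
  apply eq_of_tmul r
  simp

end Coproduct

section QCoproduct

variable {k H 𝔸 : Type*} [Field k] [Ring H] [Algebra k H] [QuasiHopfAlgebra k H]
  [Ring 𝔸] [Algebra k 𝔸]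

open QuasiBialgebra QuasiHopfAlgebra RightComoduleAlgebra

theorem qMap₂_onRight_oneTmul_mul (t : 𝔸 ⊗[k] (H ⊗[k] H)) (y : 𝔸 ⊗[k] (H ⊗[k] (H ⊗[k] H))) :
    qMap₂ k H 𝔸 (onRight 𝔸 (onRight H ((oneTmul H (H ⊗[k] H)).comp (oneTmul H H))) t *
        onRight 𝔸 (onRight H (onRight H (tmulOne H H))) y) =
      onRight 𝔸 (tmulOne H H) (qMap k H 𝔸 t) * (qMap k H H).lTensor 𝔸 y := by
  apply eq_of_tmul₃ t
  intro a b e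
  apply eq_of_tmul y
  intro c s
  simp only [onRight_tmul, AlgHom.comp_apply, oneTmul_apply, Algebra.TensorProduct.tmul_mul_tmul,
    qMap₂_tmul, swapInv_gammaMap_tmul_mul, qMap_tmul, LinearMap.lTensor_tmul, tmulOne_apply]

theorem splitFst_lTensor {X Y Z V W : Type*} [Ring X] [Algebra k X] [Ring Y] [Algebra k Y]
    [Ring Z] [Algebra k Z] [Ring V] [Algebra k V] [Ring W] [Algebra k W]
    (f : X →ₐ[k] Y ⊗[k] Z) (g : V →ₗ[k] W) (t : X ⊗[k] V) :
    splitFst W f (g.lTensor X t) = (g.lTensor Z).lTensor Y (splitFst V f t) := by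
  apply eq_of_tmul t
  intro a b
  simp only [LinearMap.lTensor_tmul, splitFst_tmul]
  generalize f a = r
  apply eq_of_tmul r
  simp

theorem splitFst_qMap {X Y Z : Type*} [Ring X] [Algebra k X] [Ring Y] [Algebra k Y]
    [Ring Z] [Algebra k Z] (f : X →ₐ[k] Y ⊗[k] Z) (t : X ⊗[k] (H ⊗[k] H)) :
    splitFst H f (qMap k H X t) = (qMap k H Z).lTensor Y (splitFst (H ⊗[k] H) f t) :=
  splitFst_lTensor ..

theorem elemA_mul_splitFst_phi :
    elemA k H * splitFst (H ⊗[k] H) (Delta k H) (phi k H) =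
      onRight H (onRight H (tmulOne H H)) (phi k H) := by
  rw [elemA, mul_assoc, ← map_mul, PhiInv_mul_phi, map_one, mul_one]

theorem tmul_mul_onRight_onRight_comul (r : 𝔸 ⊗[k] H) (z : H ⊗[k] H) :
    (1 : 𝔸) ⊗ₜ[k] ((1 : H) ⊗ₜ[k] ((1 : H) ⊗ₜ[k] z)) *
        onRight 𝔸 (onRight H (tmulOne H (H ⊗[k] H))) (onRight 𝔸 (Delta k H) r) =
      onRight 𝔸 (splitFst (H ⊗[k] H) (Delta k H))
        (TensorProduct.assoc k 𝔸 H (H ⊗[k] H) (r ⊗ₜ z)) := by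
  apply eq_of_tmul r
  intro b h
  simp only [onRight_tmul, TensorProduct.assoc_tmul, splitFst_tmul]
  generalize Delta k H h = d
  apply eq_of_tmul d
  simp

variable [RightComoduleAlgebra k H 𝔸]

theorem phiRho_pentagon :
    oneTmul 𝔸 (H ⊗[k] (H ⊗[k] H)) (phi k H) *
      onRight 𝔸 (splitFst H (Delta k H)) (phiRho k H 𝔸) *
      onRight 𝔸 (onRight H (tmulOne H H)) (phiRho k H 𝔸) =
    onRight 𝔸 (onRight H (Delta k H)) (phiRho k H 𝔸) *
      splitFst (H ⊗[k] H) (rho (k := k) (H := H)) (phiRho k H 𝔸) := rho_pentagon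

theorem oneTmul_elemA_mul_phiRho :
    oneTmul 𝔸 _ (elemA k H) *
      onRight 𝔸 ((splitFst (H ⊗[k] H) (Delta k H)).comp (onRight H (Delta k H)))
        (phiRho k H 𝔸) *
      onRight 𝔸 (splitFst (H ⊗[k] H) (Delta k H))
        (splitFst (H ⊗[k] H) (rho (k := k) (H := H)) (phiRho k H 𝔸)) *
      onRight 𝔸 (onRight H (tmulOne H (H ⊗[k] H))) (phiRho k H 𝔸) =
    onRight 𝔸 ((onRight H (splitFst H (Delta k H))).comp (splitFst H (Delta k H)))
        (phiRho k H 𝔸) *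
      onRight 𝔸 (onRight H (onRight H (tmulOne H H)))
        (onRight 𝔸 (onRight H (Delta k H)) (phiRho k H 𝔸) *
          splitFst (H ⊗[k] H) (rho (k := k) (H := H)) (phiRho k H 𝔸)) := by
  have coassoc := oneTmul_mul_onRight (W := 𝔸)
    (f := (splitFst (H ⊗[k] H) (Delta k H)).comp (splitFst H (Delta k H)))
    (g := (onRight H (splitFst H (Delta k H))).comp (splitFst H (Delta k H)))
    (p := onRight H (onRight H (tmulOne H H)) (phi k H))
    (onRight_tmulOne_mul_splitFst_splitFst phi_mul_splitFst_comul) (phiRho k H 𝔸)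
  have split_tmulOne : (splitFst (H ⊗[k] H) (Delta k H)).comp (onRight H (tmulOne H H)) =
      (onRight H (onRight H (tmulOne H H))).comp (splitFst H (Delta k H)) :=
    AlgHom.ext (splitFst_onRight_tmulOne (Delta k H))
  have tmulOne_one : onRight 𝔸 (onRight H (tmulOne H (H ⊗[k] H))) =
      (onRight 𝔸 (onRight H (onRight H (tmulOne H H)))).comp
        (onRight 𝔸 (onRight H (tmulOne (k := k) H H))) := by
    rw [← onRight_comp, ← onRight_comp]
    rfl
  rw [onRight_comp, AlgHom.comp_apply, mul_assoc (oneTmul 𝔸 _ (elemA k H)), ← map_mul,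
    ← phiRho_pentagon, map_mul, map_mul, ← mul_assoc, ← mul_assoc, oneTmul_apply, oneTmul_apply,
    onRight_tmul, Algebra.TensorProduct.tmul_mul_tmul, elemA_mul_splitFst_phi, one_mul,
    onRight_onRight, ← oneTmul_apply, coassoc, onRight_onRight, split_tmulOne, map_mul, map_mul,
    tmulOne_one]
  simp only [mul_assoc, oneTmul_apply, onRight_tmul, onRight_comp, AlgHom.comp_apply]

variable (k H 𝔸) in
/-- The linear map `a ⊗ b ⊗ c ↦ [1 ⊗ S⁻¹(f² c) ⊗ S⁻¹(f¹ b)] y (ρ ⊗ id)(ρ(a))`. -/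
def twistedRhoRho (y : 𝔸 ⊗[k] (H ⊗[k] H)) : 𝔸 ⊗[k] (H ⊗[k] H) →ₗ[k] 𝔸 ⊗[k] (H ⊗[k] H) :=
  prodMap ((oneTmul 𝔸 (H ⊗[k] H)).toLinearMap ∘ₗ swapInv k H ∘ₗ
      LinearMap.mulLeft k (drinfeldTwist k H))
    (LinearMap.mulLeft k y ∘ₗ (splitFst H (rho (k := k) (H := H))).toLinearMap ∘ₗ
      (rho (k := k) (H := H) (A := 𝔸)).toLinearMap) ∘ₗ
    (TensorProduct.comm k 𝔸 (H ⊗[k] H)).toLinearMap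

theorem twistedRhoRho_tmul (y : 𝔸 ⊗[k] (H ⊗[k] H)) (a : 𝔸) (z : H ⊗[k] H) :
    twistedRhoRho k H 𝔸 y (a ⊗ₜ z) = oneTmul 𝔸 _ (swapInv k H (drinfeldTwist k H * z)) *
      (y * splitFst H (rho (k := k) (H := H)) (rho a)) :=
  prodMap_tmul ..

theorem twistedRhoRho_eq_qMap₂ (z : 𝔸 ⊗[k] (H ⊗[k] H)) :
    twistedRhoRho k H 𝔸 (onRight 𝔸 (Delta k H) (qRho k H 𝔸) * phiRho k H 𝔸) z =
      qMap₂ k H 𝔸 (oneTmul 𝔸 _ (elemA k H) *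
        onRight 𝔸 ((splitFst (H ⊗[k] H) (Delta k H)).comp (onRight H (Delta k H)))
          (phiRho k H 𝔸) *
        onRight 𝔸 (splitFst (H ⊗[k] H) (Delta k H))
          (splitFst (H ⊗[k] H) (rho (k := k) (H := H)) z) *
        onRight 𝔸 (onRight H (tmulOne H (H ⊗[k] H))) (phiRho k H 𝔸)) := by
  apply eq_of_tmul z
  intro a z
  rw [twistedRhoRho_tmul, splitFst_tmul, ← tmul_mul_onRight_onRight_comul,
    mul_assoc (onRight 𝔸 (Delta k H) (qRho k H 𝔸)), phiRho_mul_splitFst_rho, ← mul_assoc, qRho_eq,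
    oneTmul_swapInv_mul_onRight_comul_qMap, qMap₂_mul,
    map_mul (onRight 𝔸 (onRight H (tmulOne H (H ⊗[k] H))))]
  simp only [mul_assoc]

theorem twistedRhoRho_phiRho :
    twistedRhoRho k H 𝔸 (onRight 𝔸 (Delta k H) (qRho k H 𝔸) * phiRho k H 𝔸) (phiRho k H 𝔸) =
      onRight 𝔸 (tmulOne H H) (qRho k H 𝔸) *
        splitFst H (rho (k := k) (H := H)) (qRho k H 𝔸) := by
  have counit_inner : (onRight H (splitFst H (counitTo k H (H ⊗[k] H)))).comp
      (splitFst H (Delta k H)) = onRight H ((oneTmul H (H ⊗[k] H)).comp (oneTmul H H)) :=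
    AlgHom.ext onRight_splitFst_counitTo_splitFst_comul
  rw [twistedRhoRho_eq_qMap₂, oneTmul_elemA_mul_phiRho, onRight_comp, AlgHom.comp_apply,
    qMap₂_mulLeftEq_onRight_onRight_splitFst_comul, onRight_onRight,
    counit_inner, qMap₂_onRight_oneTmul_mul, (qMap_mulLeftEq_onRight_comul.lTensor 𝔸),
    onRight_onRight_counitTo_phiRho, one_mul, qRho_eq, splitFst_qMap]

end QCoproduct

section Bicomodule

variable {k H 𝔸 : Type*} [Field k] [Ring H] [Algebra k H] [QuasiHopfAlgebra k H]
  [Ring 𝔸] [Algebra k 𝔸]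

open QuasiBialgebra QuasiHopfAlgebra RightComoduleAlgebra LeftComoduleAlgebra BicomoduleAlgebra

section Left

variable [LeftComoduleAlgebra k H 𝔸]

@[simp] theorem counitFst_lam (a : 𝔸) : counitFst k H 𝔸 (lam a) = a := by
  rw [counitFst, AlgHom.comp_apply, lam_counit]
  simp

theorem phiLam_mul_splitFst_lam (a : 𝔸) :
    phiLam k H 𝔸 * splitFst 𝔸 (Delta k H) (lam a) =
      onRight H (lam (k := k) (H := H)) (lam a) * phiLam k H 𝔸 := (lam_coassoc a).symm

theorem counitFst_phiLam : counitFst k H _ (phiLam k H 𝔸) = 1 := by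
  rw [counitFst, AlgHom.comp_apply, phiLam, counit_PhiLam_fst, map_one]

theorem onRight_counitFst_phiLam : onRight H (counitFst k H 𝔸) (phiLam k H 𝔸) = 1 := by
  rw [counitFst, onRight_comp, AlgHom.comp_apply, phiLam, counit_PhiLam_snd, map_one]

end Left

section Counit

variable {V W X Y Z : Type*} [Ring V] [Algebra k V] [Ring W] [Algebra k W] [Ring X]
  [Algebra k X] [Ring Y] [Algebra k Y] [Ring Z] [Algebra k Z]

theorem counitFst_onRight (f : X →ₐ[k] Y) (t : H ⊗[k] X) :
    counitFst k H Y (onRight H f t) = f (counitFst k H X t) := by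
  apply eq_of_tmul t
  simp

theorem onRight_counitFst_onRight_onRight (f : X →ₐ[k] Y) (t : W ⊗[k] (H ⊗[k] X)) :
    onRight W (counitFst k H Y) (onRight W (onRight H f) t) =
      onRight W f (onRight W (counitFst k H X) t) := by
  rw [onRight_onRight, onRight_onRight]
  congr 2
  exact AlgHom.ext (counitFst_onRight f)

theorem onRight_onRight_splitFst (f : X →ₐ[k] Y ⊗[k] Z) (g : V →ₐ[k] W) (t : X ⊗[k] V) :
    onRight Y (onRight Z g) (splitFst V f t) = splitFst W f (onRight X g t) := by
  apply eq_of_tmul t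
  intro x v
  rw [splitFst_tmul, onRight_tmul, splitFst_tmul]
  generalize f x = r
  apply eq_of_tmul r
  simp

theorem onRight_id (t : W ⊗[k] X) : onRight W (AlgHom.id k X) t = t := by
  apply eq_of_tmul t
  simp

end Counit

theorem onRight_onRight_counitFst_onRight_comul (t : H ⊗[k] (𝔸 ⊗[k] H)) :
    onRight H (onRight 𝔸 (counitFst k H H)) (onRight H (onRight 𝔸 (Delta k H)) t) = t := by
  rw [onRight_onRight, ← onRight_comp,
    show (counitFst k H H).comp (Delta k H) = AlgHom.id k H from AlgHom.ext counitFst_comul]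
  apply eq_of_tmul₃ t
  simp

theorem qMap_mul_tmulOne (y : 𝔸 ⊗[k] (H ⊗[k] H)) (x : 𝔸 ⊗[k] H) :
    qMap k H 𝔸 (y * onRight 𝔸 (tmulOne H H) x) = qMap k H 𝔸 y * x := by
  apply eq_of_tmul x
  intro a b
  apply eq_of_tmul y
  intro c d
  simp [SInv_evalAlpha_mul_tmul, SInv_one]

variable [BicomoduleAlgebra k H 𝔸]

variable (k H 𝔸) in
/-- `Φ_{λ,ρ}`, as an element of `H ⊗ 𝔸 ⊗ H`. -/
def phiLamRho : H ⊗[k] (𝔸 ⊗[k] H) := (PhiLamRho : (H ⊗[k] (𝔸 ⊗[k] H))ˣ)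

theorem theta_mul_onRight_rho (a : 𝔸) :
    theta k H 𝔸 * onRight H (rho (k := k) (H := H)) (lam a) =
      splitFst H (lam (k := k) (H := H)) (rho a) * theta k H 𝔸 :=
  (Units.inv_mul_eq_iff_eq_mul _).2 (((Units.eq_mul_inv_iff_mul_eq _).2
    (lam_rho (k := k) (H := H) a).symm).trans (mul_assoc ..))

theorem counitFst_phiLamRho : counitFst k H (𝔸 ⊗[k] H) (phiLamRho k H 𝔸) = 1 := by
  have contract_lam : (counitFst k H (𝔸 ⊗[k] H)).comp (splitFst H (lam (k := k) (H := H))) =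
      AlgHom.id k _ := AlgHom.ext (counitFst_splitFst _ counitFst_lam)
  have contracted : oneTmul H _ (counitFst k H _ (phiLamRho k H 𝔸)) * phiLamRho k H 𝔸 =
      phiLamRho k H 𝔸 := by
    have h := congrArg (onRight H (counitFst k H (𝔸 ⊗[k] H)))
      (lam_lam_rho (k := k) (H := H) (A := 𝔸))
    rwa [map_mul, map_mul, map_mul, oneTmul_apply, onRight_tmul, onRight_counitFst_onRight_onRight,
      onRight_counitFst_onRight_onRight, ← phiLam, onRight_counitFst_phiLam, map_one, map_one,
      mul_one, one_mul, onRight_counitFst_splitFst _ counitSnd_comul, onRight_onRight,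
      contract_lam, onRight_id] at h
  simpa using congrArg (counitFst k H _) ((Units.mul_left_inj PhiLamRho).1
    (contracted.trans (one_mul _).symm))

theorem onRight_counitSnd_phiLamRho : onRight H (counitSnd k H 𝔸) (phiLamRho k H 𝔸) = 1 := by
  have contract_rho : (onRight 𝔸 (counitFst k H H)).comp (splitFst H (rho (k := k) (H := H))) =
      AlgHom.id k (𝔸 ⊗[k] H) := AlgHom.ext (onRight_counitFst_splitFst _ counitSnd_rho)
  have contract_tmulOne : (onRight 𝔸 (counitFst k H H)).comp (onRight 𝔸 (tmulOne H H)) =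
      (tmulOne 𝔸 H).comp (counitSnd k H 𝔸) := by
    ext <;> simp [TensorProduct.smul_tmul']
  have contract_one : (counitSnd k H 𝔸).comp (tmulOne 𝔸 H) = AlgHom.id k 𝔸 :=
    AlgHom.ext fun a => by simp
  have contracted : phiLamRho k H 𝔸 *
      onRight H (tmulOne 𝔸 H) (onRight H (counitSnd k H 𝔸) (phiLamRho k H 𝔸)) =
        phiLamRho k H 𝔸 := by
    have h := congrArg (onRight H (onRight 𝔸 (counitFst k H H)))
      (lam_rho_rho (k := k) (H := H) (A := 𝔸))
    rwa [map_mul, map_mul, map_mul, oneTmul_apply, onRight_tmul, ← phiRho,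
      onRight_counitFst_phiRho, onRight_onRight_splitFst, onRight_counitFst_phiRho, map_one,
      mul_one, ← Algebra.TensorProduct.one_def, one_mul, onRight_onRight_counitFst_onRight_comul,
      onRight_onRight, contract_rho, onRight_id, onRight_onRight, contract_tmulOne,
      ← onRight_onRight] at h
  have h := congrArg (onRight H (counitSnd k H 𝔸)) ((Units.mul_right_inj PhiLamRho).1
    (contracted.trans (mul_one _).symm))
  rwa [map_one, onRight_onRight, contract_one, onRight_id] at h

theorem splitFst_lam_phiRho_mul_theta :
    splitFst (H ⊗[k] H) (lam (k := k) (H := H)) (phiRho k H 𝔸) *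
      onRight H (onRight 𝔸 (tmulOne H H)) (theta k H 𝔸) *
      onRight H (splitFst H (rho (k := k) (H := H))) (theta k H 𝔸) =
    onRight H (onRight 𝔸 (Delta k H)) (theta k H 𝔸) *
      oneTmul H (𝔸 ⊗[k] (H ⊗[k] H)) (phiRho k H 𝔸) := by
  let u := Units.map (onRight H (onRight 𝔸 (Delta k H))).toMonoidHom PhiLamRho
  let v := Units.map (onRight H (splitFst H (rho (k := k) (H := H) (A := 𝔸)))).toMonoidHom
    PhiLamRho
  let w := Units.map (onRight H (onRight 𝔸 (tmulOne (k := k) H H))).toMonoidHom PhiLamRho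
  have h := (Units.eq_mul_inv_iff_mul_eq v).2
    ((Units.eq_mul_inv_iff_mul_eq w).2 (lam_rho_rho (k := k) (H := H) (A := 𝔸)))
  refine ((Units.eq_inv_mul_iff_mul_eq u).2 (h.trans ?_).symm)
  simp only [mul_assoc]
  rfl

theorem onRight_onRight_counitTo_theta (E : Type*) [Ring E] [Algebra k E] :
    onRight H (onRight 𝔸 (counitTo k H E)) (theta k H 𝔸) = 1 := by
  have counit_eq : onRight 𝔸 (counitTo k H E) = (tmulOne 𝔸 E).comp (counitSnd k H 𝔸) := by
    ext <;> simp [counitTo_apply, TensorProduct.smul_tmul']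
  rw [counit_eq, ← onRight_onRight, theta, map_inv_eq_one _ PhiLamRho onRight_counitSnd_phiLamRho,
    map_one]

theorem lTensor_qMap_theta :
    (qMap k H 𝔸).lTensor H (splitFst (H ⊗[k] H) (lam (k := k) (H := H)) (phiRho k H 𝔸) *
      onRight H (onRight 𝔸 (tmulOne H H)) (theta k H 𝔸) *
      onRight H (splitFst H (rho (k := k) (H := H))) (theta k H 𝔸)) =
    1 ⊗ₜ qRho k H 𝔸 := by
  rw [splitFst_lam_phiRho_mul_theta, qMap_mulLeftEq_onRight_comul.lTensor,
    onRight_onRight_counitTo_theta, one_mul, oneTmul_apply, LinearMap.lTensor_tmul, qRho_eq]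

theorem lTensor_qMap_mul_splitFst_tmul (y : H ⊗[k] (𝔸 ⊗[k] (H ⊗[k] H)))
    (x : H ⊗[k] (𝔸 ⊗[k] H)) (t₁ t₃ : H) (t₂ : 𝔸) :
    (qMap k H 𝔸).lTensor H (y * onRight H (onRight 𝔸 (tmulOne H H)) x *
      onRight H (splitFst H (rho (k := k) (H := H))) (t₁ ⊗ₜ (t₂ ⊗ₜ t₃))) =
    1 ⊗ₜ (1 ⊗ₜ SInv k H t₃) * (qMap k H 𝔸).lTensor H y * x *
      onRight H (rho (k := k) (H := H)) (t₁ ⊗ₜ t₂) := by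
  apply eq_of_tmul x
  intro a b
  apply eq_of_tmul y
  intro c d
  simp only [onRight_tmul, Algebra.TensorProduct.tmul_mul_tmul, LinearMap.lTensor_tmul,
    qMap_mul_splitFst_tmul, qMap_mul_tmulOne, one_mul, ← mul_assoc]

end Bicomodule

/-! ### Tensors acting on `𝒜 ⊗ 𝔸` and mapping into `B` -/

section CrossedAction

variable {k H 𝒜 𝔸 B : Type*} [Field k] [Ring H] [Algebra k H] [NonAssocRing 𝒜] [Module k 𝒜]
  [Module Hᵐᵒᵖ 𝒜] [IsScalarTower k Hᵐᵒᵖ 𝒜] [Ring 𝔸] [Algebra k 𝔸] [Ring B] [Algebra k B]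

open QuasiBialgebra QuasiHopfAlgebra RightComoduleAlgebra LeftComoduleAlgebra BicomoduleAlgebra
open MulOpposite

section Twisted

variable [QuasiHopfAlgebra k H] [Module H 𝒜] [IsScalarTower k H 𝒜]

variable (k H 𝒜 𝔸) in
/-- `h ⊗ a ⊗ h'` acts on `𝒜 ⊗ 𝔸` by `φ ⊗ u ↦ (h · φ · S⁻¹(h')) ⊗ a u`. -/
def twistedAct3 : H ⊗[k] (𝔸 ⊗[k] H) →ₗ[k] Module.End k (𝒜 ⊗[k] 𝔸) :=
  act3 k H 𝒜 𝔸 ∘ₗ TensorProduct.map LinearMap.id (TensorProduct.map LinearMap.id (SInv k H))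

@[simp] theorem twistedAct3_tmul (h h' : H) (a u : 𝔸) (φ : 𝒜) :
    twistedAct3 k H 𝒜 𝔸 (h ⊗ₜ (a ⊗ₜ h')) (φ ⊗ₜ u) =
      (h • op (SInv k H h') • φ) ⊗ₜ (a * u) := by
  simp [twistedAct3, act3]

theorem twistedAct3_one : twistedAct3 k H 𝒜 𝔸 1 = 1 := by
  refine TensorProduct.ext' fun φ u => ?_
  rw [Algebra.TensorProduct.one_def, Algebra.TensorProduct.one_def, twistedAct3_tmul, SInv_one]
  simp

theorem twistedAct3_mul [SMulCommClass H Hᵐᵒᵖ 𝒜] (s t : H ⊗[k] (𝔸 ⊗[k] H)) :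
    twistedAct3 k H 𝒜 𝔸 (s * t) = twistedAct3 k H 𝒜 𝔸 s * twistedAct3 k H 𝒜 𝔸 t := by
  apply eq_of_tmul₃ s
  intro s₁ s₂ s₃
  apply eq_of_tmul₃ t
  intro t₁ t₂ t₃
  refine TensorProduct.ext' fun φ u => ?_
  rw [Module.End.mul_apply, Algebra.TensorProduct.tmul_mul_tmul,
    Algebra.TensorProduct.tmul_mul_tmul, twistedAct3_tmul, twistedAct3_tmul, twistedAct3_tmul,
    SInv_mul, op_mul, mul_smul, mul_smul, mul_assoc, smul_comm t₁ (op (SInv k H s₃))]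

theorem twistedAct3_tmul_mul (s : H ⊗[k] (𝔸 ⊗[k] H)) (φ : 𝒜) (u u' : 𝔸) :
    twistedAct3 k H 𝒜 𝔸 s (φ ⊗ₜ (u * u')) =
      (LinearMap.mulRight k u').lTensor 𝒜 (twistedAct3 k H 𝒜 𝔸 s (φ ⊗ₜ u)) := by
  apply eq_of_tmul₃ s
  simp [-LinearEquiv.coe_coe, mul_assoc]

variable (k H 𝒜 𝔸) in
/-- `h₁ ⊗ h₂ ⊗ a ⊗ h₄ ⊗ h₅` acts on `𝒜 ⊗ 𝒜 ⊗ 𝔸` by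
`φ ⊗ φ' ⊗ u ↦ (h₁ · φ · S⁻¹(h₅)) ⊗ (h₂ · φ' · S⁻¹(h₄)) ⊗ a u`. -/
def twistedAct5 : H ⊗[k] (H ⊗[k] (𝔸 ⊗[k] (H ⊗[k] H))) →ₗ[k] Module.End k (𝒜 ⊗[k] (𝒜 ⊗[k] 𝔸)) :=
  act5 k H 𝒜 𝔸 ∘ₗ TensorProduct.map LinearMap.id (TensorProduct.map LinearMap.id
    (TensorProduct.map LinearMap.id (TensorProduct.map (SInv k H) (SInv k H))))

@[simp] theorem twistedAct5_tmul (h₁ h₂ h₄ h₅ : H) (a u : 𝔸) (φ φ' : 𝒜) :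
    twistedAct5 k H 𝒜 𝔸 (h₁ ⊗ₜ (h₂ ⊗ₜ (a ⊗ₜ (h₄ ⊗ₜ h₅)))) (φ ⊗ₜ (φ' ⊗ₜ u)) =
      (h₁ • op (SInv k H h₅) • φ) ⊗ₜ ((h₂ • op (SInv k H h₄) • φ') ⊗ₜ (a * u)) := by
  simp [twistedAct5, act5]

end Twisted

variable (k H) in
/-- The linear map `a ⊗ h ↦ γ(a) v(φ · h)`, as a linear function of `φ`. -/
def evalRight (γ : 𝔸 →ₐ[k] B) (v : 𝒜 →ₗ[k] B) : 𝒜 →ₗ[k] 𝔸 ⊗[k] H →ₗ[k] B where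
  toFun φ := prodMap γ.toLinearMap (vR v φ)
  map_add' φ φ' := TensorProduct.ext' fun a h => by simp [vR, mul_add]
  map_smul' c φ := TensorProduct.ext' fun a h => by simp only [vR, map_smul]; simp

theorem evalRight_apply (γ : 𝔸 →ₐ[k] B) (v : 𝒜 →ₗ[k] B) (φ : 𝒜) :
    evalRight k H γ v φ = prodMap γ.toLinearMap (vR v φ) := rfl

@[simp] theorem evalRight_tmul (γ : 𝔸 →ₐ[k] B) (v : 𝒜 →ₗ[k] B) (φ : 𝒜) (a : 𝔸) (h : H) :
    evalRight k H γ v φ (a ⊗ₜ[k] h) = γ a * v (op h • φ) := by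
  simp [evalRight_apply, vR]

theorem evalRight_tmul_mul (γ : 𝔸 →ₐ[k] B) (v : 𝒜 →ₗ[k] B) (φ : 𝒜) (a : 𝔸) (h : H)
    (t : 𝔸 ⊗[k] H) :
    evalRight k H γ v φ (a ⊗ₜ[k] h * t) = γ a * evalRight k H γ v (op h • φ) t := by
  apply eq_of_tmul t
  simp [mul_smul, mul_assoc]

section Right

variable [QuasiHopfAlgebra k H] [RightComoduleAlgebra k H 𝔸]

variable (H) in
/-- The linear map `φ ↦ γ(q̃¹) v(φ · q̃²)`. -/
def vTilde (γ : 𝔸 →ₐ[k] B) (v : 𝒜 →ₗ[k] B) : 𝒜 →ₗ[k] B :=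
  (evalRight k H γ v).flip (qRho k H 𝔸)

theorem vTilde_apply (γ : 𝔸 →ₐ[k] B) (v : 𝒜 →ₗ[k] B) (φ : 𝒜) :
    vTilde H γ v φ = evalRight k H γ v φ (qRho k H 𝔸) := rfl

variable (H) in
/-- The linear map `φ ⊗ u ↦ γ(q̃¹) v(φ · q̃²) γ(u)`. -/
def wTilde (γ : 𝔸 →ₐ[k] B) (v : 𝒜 →ₗ[k] B) : 𝒜 ⊗[k] 𝔸 →ₗ[k] B :=
  prodMap (vTilde H γ v) γ.toLinearMap

@[simp] theorem wTilde_tmul (γ : 𝔸 →ₐ[k] B) (v : 𝒜 →ₗ[k] B) (φ : 𝒜) (u : 𝔸) :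
    wTilde H γ v (φ ⊗ₜ u) = vTilde H γ v φ * γ u := by
  simp [wTilde]

theorem wTilde_lTensor_mulRight (γ : 𝔸 →ₐ[k] B) (v : 𝒜 →ₗ[k] B) (x : 𝒜 ⊗[k] 𝔸) (u : 𝔸) :
    wTilde H γ v ((LinearMap.mulRight k u).lTensor 𝒜 x) = wTilde H γ v x * γ u := by
  apply eq_of_tmul x
  simp [mul_assoc]

end Right

variable [QuasiHopfAlgebra k H] [Module H 𝒜] [IsScalarTower k H 𝒜] [BicomoduleAlgebra k H 𝔸]

variable (H) in
/-- The condition `γ(u_{<0>}) v(φ · u_{<1>}) = v(u_{[-1]} · φ) γ(u_{[0]})`. -/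
def IntertwinesCoactions (γ : 𝔸 →ₐ[k] B) (v : 𝒜 →ₗ[k] B) : Prop :=
  ∀ (φ : 𝒜) (u : 𝔸), prodMap γ.toLinearMap (vR v φ) (rho (k := k) (H := H) u) =
    prodMap (vL v φ) γ.toLinearMap (lam (k := k) (H := H) u)

variable [SMulCommClass H Hᵐᵒᵖ 𝒜] {γ : 𝔸 →ₐ[k] B} {v : 𝒜 →ₗ[k] B}

theorem evalRight_mul_rho (hcomm : IntertwinesCoactions H γ v) (t : 𝔸 ⊗[k] H) (φ : 𝒜) (u : 𝔸) :
    evalRight k H γ v φ (t * rho u) =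
      prodMap ((evalRight k H γ v).flip t ∘ₗ (actL k H 𝒜).flip φ) γ.toLinearMap
        (lam (k := k) (H := H) u) := by
  induction t using TensorProduct.induction_on with
  | zero => simp [prodMap]
  | add x y hx hy =>
    rw [add_mul, map_add, hx, hy, ← LinearMap.add_apply]
    congr 1
    exact TensorProduct.ext' fun a b => by simp [add_mul]
  | tmul a b =>
    rw [evalRight_tmul_mul, evalRight_apply, hcomm, ← LinearMap.mulLeft_apply k,
      ← LinearMap.comp_apply]
    congr 1
    refine TensorProduct.ext' fun h c => ?_
    simp [vL, mul_assoc, smul_comm h (op b)]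

theorem wTilde_twistedAct3 (hcomm : IntertwinesCoactions H γ v) (r : 𝔸 ⊗[k] H) (φ : 𝒜) :
    wTilde H γ v (twistedAct3 k H 𝒜 𝔸 (splitFst H (lam (k := k) (H := H)) r) (φ ⊗ₜ 1)) =
      evalRight k H γ v φ
        (qMap k H 𝔸 (phiRho k H 𝔸 * splitFst H (rho (k := k) (H := H)) r)) := by
  apply eq_of_tmul r
  intro a h
  rw [qMap_mul_splitFst_tmul, mul_assoc, evalRight_tmul_mul, evalRight_mul_rho hcomm, map_one,
    one_mul, splitFst_tmul, ← qRho_eq]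
  generalize lam (k := k) (H := H) a = l
  apply eq_of_tmul l
  simp [-LinearEquiv.coe_coe, vTilde_apply]

theorem wTilde_twistedAct3_rho (hcomm : IntertwinesCoactions H γ v) (u u' : 𝔸) (φ : 𝒜) :
    wTilde H γ v (twistedAct3 k H 𝒜 𝔸 (splitFst H (lam (k := k) (H := H)) (rho u)) (φ ⊗ₜ u')) =
      γ u * vTilde H γ v φ * γ u' := by
  rw [← one_mul u', twistedAct3_tmul_mul, wTilde_lTensor_mulRight, wTilde_twistedAct3 hcomm,
    qMap_phiRho_mul_splitFst_rho, evalRight_tmul_mul, op_one, one_smul, vTilde_apply, one_mul]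

end CrossedAction

section Words

variable {k H 𝒜 𝔸 B : Type*} [Field k] [Ring H] [Algebra k H] [NonAssocRing 𝒜] [Module k 𝒜]
  [Module H 𝒜] [IsScalarTower k H 𝒜] [Module Hᵐᵒᵖ 𝒜] [IsScalarTower k Hᵐᵒᵖ 𝒜]
  [Ring 𝔸] [Algebra k 𝔸] [Ring B] [Algebra k B]

open RightComoduleAlgebra LeftComoduleAlgebra MulOpposite

/-- The linear map `R ⊗ T ⊗ L ↦ vMulExpr γ v R T L φ φ'`, in curried form. -/
def wordMap (γ : 𝔸 →ₐ[k] B) (v : 𝒜 →ₗ[k] B) (φ φ' : 𝒜) :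
    𝔸 ⊗[k] (H ⊗[k] H) →ₗ[k] H ⊗[k] (𝔸 ⊗[k] H) →ₗ[k] H ⊗[k] (H ⊗[k] 𝔸) →ₗ[k] B :=
  LinearMap.mk₂ k
    (fun R T => wordEval γ v ∘ₗ wordTheta k H 𝒜 𝔸 T ∘ₗ wordRho k H 𝒜 𝔸 R ∘ₗ
      (wordLam k H 𝒜 𝔸).flip (1 ⊗ₜ[k] (φ ⊗ₜ[k] (1 ⊗ₜ[k] (φ' ⊗ₜ[k] 1)))))
    (fun R R' T => by simp only [map_add, LinearMap.add_comp, LinearMap.comp_add])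
    (fun c R T => by simp only [map_smul, LinearMap.smul_comp, LinearMap.comp_smul])
    (fun R T T' => by simp only [map_add, LinearMap.add_comp, LinearMap.comp_add])
    (fun c R T => by simp only [map_smul, LinearMap.smul_comp, LinearMap.comp_smul])

theorem wordMap_apply (γ : 𝔸 →ₐ[k] B) (v : 𝒜 →ₗ[k] B) (φ φ' : 𝒜) (R : 𝔸 ⊗[k] (H ⊗[k] H))
    (T : H ⊗[k] (𝔸 ⊗[k] H)) (L : H ⊗[k] (H ⊗[k] 𝔸)) :
    wordMap γ v φ φ' R T L = vMulExpr γ v R T L φ φ' := rfl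

variable [SMulCommClass H Hᵐᵒᵖ 𝒜]

theorem wordMap_tmul (γ : 𝔸 →ₐ[k] B) (v : 𝒜 →ₗ[k] B) (φ φ' : 𝒜) (x₁ t₂ y₃ : 𝔸)
    (x₂ x₃ t₁ t₃ y₁ y₂ : H) :
    wordMap γ v φ φ' (x₁ ⊗ₜ (x₂ ⊗ₜ x₃)) (t₁ ⊗ₜ (t₂ ⊗ₜ t₃)) (y₁ ⊗ₜ (y₂ ⊗ₜ y₃)) =
      γ x₁ * v ((t₁ * y₁) • op x₂ • φ) * γ t₂ * v (y₂ • op (x₃ * t₃) • φ') * γ y₃ := by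
  simp [wordMap, wordEval, wordTheta, wordRho, wordLam, onWord1, onWord2, onWord3, onWord4,
    onWord5, mul_smul, mul_assoc, smul_comm y₁ (op x₂), smul_comm y₂ (op t₃), smul_comm y₂ (op x₃)]

theorem wordMap_tmul_one (γ : 𝔸 →ₐ[k] B) (v : 𝒜 →ₗ[k] B) (φ φ' : 𝒜) (x₁ t₂ : 𝔸)
    (x₂ x₃ t₁ t₃ : H) :
    wordMap γ v φ φ' (x₁ ⊗ₜ (x₂ ⊗ₜ x₃)) (t₁ ⊗ₜ (t₂ ⊗ₜ t₃)) 1 =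
      γ x₁ * v (t₁ • op x₂ • φ) * γ t₂ * v (op (x₃ * t₃) • φ') := by
  rw [Algebra.TensorProduct.one_def, Algebra.TensorProduct.one_def, wordMap_tmul, mul_one,
    one_smul, map_one, mul_one]

theorem wordMap_mul_one_tmul (γ : 𝔸 →ₐ[k] B) (v : 𝒜 →ₗ[k] B) (φ φ' : 𝒜)
    (R : 𝔸 ⊗[k] (H ⊗[k] H)) (T : H ⊗[k] (𝔸 ⊗[k] H)) (s : H) :
    wordMap γ v φ φ' (R * 1 ⊗ₜ (1 ⊗ₜ s)) T 1 = wordMap γ v φ φ' R (1 ⊗ₜ (1 ⊗ₜ s) * T) 1 := by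
  apply eq_of_tmul₃ R
  intro x₁ x₂ x₃
  apply eq_of_tmul₃ T
  intro t₁ t₂ t₃
  simp only [Algebra.TensorProduct.tmul_mul_tmul, wordMap_tmul_one, mul_one, one_mul, mul_assoc]

theorem mul_wordMap_mul (γ : 𝔸 →ₐ[k] B) (v : 𝒜 →ₗ[k] B) (φ φ' : 𝒜) (R : 𝔸 ⊗[k] (H ⊗[k] H))
    (T : H ⊗[k] (𝔸 ⊗[k] H)) (L : H ⊗[k] (H ⊗[k] 𝔸)) (b a : 𝔸) (c₁ c₂ h₁ h₂ h₄ h₅ : H) :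
    γ b * wordMap γ v (op c₁ • h₁ • op h₅ • φ) (op c₂ • h₂ • op h₄ • φ') R T L * γ a =
      wordMap γ v φ φ' (b ⊗ₜ ((h₅ * c₁) ⊗ₜ (h₄ * c₂)) * R) T (L * h₁ ⊗ₜ (h₂ ⊗ₜ a)) := by
  apply eq_of_tmul₃ L
  intro y₁ y₂ y₃
  apply eq_of_tmul₃ R
  intro x₁ x₂ x₃
  apply eq_of_tmul₃ T
  intro t₁ t₂ t₃
  simp only [Algebra.TensorProduct.tmul_mul_tmul, wordMap_tmul, op_mul, mul_smul, map_mul,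
    mul_assoc, smul_comm h₁ (op _), smul_comm h₂ (op _)]

theorem wordMap_onRight_tmulOne_one_tmul (γ : 𝔸 →ₐ[k] B) (v : 𝒜 →ₗ[k] B) (φ φ' : 𝒜)
    (q q' : 𝔸 ⊗[k] H) : wordMap γ v φ φ' (onRight 𝔸 (tmulOne H H) q) (1 ⊗ₜ q') 1 =
      evalRight k H γ v φ q * evalRight k H γ v φ' q' := by
  apply eq_of_tmul q
  intro a b
  apply eq_of_tmul q'
  intro c d
  simp [wordMap_tmul_one, mul_assoc]

variable [QuasiHopfAlgebra k H] [BicomoduleAlgebra k H 𝔸] {γ : 𝔸 →ₐ[k] B} {v : 𝒜 →ₗ[k] B}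

theorem wordMap_onRight_lam (hcomm : IntertwinesCoactions H γ v) (φ φ' : 𝒜)
    (R : 𝔸 ⊗[k] (H ⊗[k] H)) (T : H ⊗[k] (𝔸 ⊗[k] H)) (s : H ⊗[k] 𝔸) :
    wordMap γ v φ φ' R T (onRight H (lam (k := k) (H := H)) s) =
      wordMap γ v φ φ' R (T * onRight H (rho (k := k) (H := H)) s) 1 := by
  apply eq_of_tmul s
  intro h b
  apply eq_of_tmul₃ R
  intro x₁ x₂ x₃
  apply eq_of_tmul₃ T
  intro t₁ t₂ t₃
  have word_lam (l : H ⊗[k] 𝔸) :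
      wordMap γ v φ φ' (x₁ ⊗ₜ (x₂ ⊗ₜ x₃)) (t₁ ⊗ₜ (t₂ ⊗ₜ t₃)) (h ⊗ₜ l) =
        γ x₁ * v ((t₁ * h) • op x₂ • φ) * γ t₂ *
          prodMap (vL v (op (x₃ * t₃) • φ')) γ.toLinearMap l := by
    apply eq_of_tmul l
    simp [wordMap_tmul, vL, mul_assoc]
  have word_rho (r : 𝔸 ⊗[k] H) :
      wordMap γ v φ φ' (x₁ ⊗ₜ (x₂ ⊗ₜ x₃)) ((t₁ * h) ⊗ₜ ((t₂ ⊗ₜ t₃) * r)) 1 =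
        γ x₁ * v ((t₁ * h) • op x₂ • φ) * γ t₂ *
          prodMap γ.toLinearMap (vR v (op (x₃ * t₃) • φ')) r := by
    apply eq_of_tmul r
    simp [wordMap_tmul_one, vR, mul_assoc, mul_smul]
  rw [onRight_tmul, onRight_tmul, Algebra.TensorProduct.tmul_mul_tmul, word_lam, word_rho, hcomm]

theorem wordMap_splitFst_lam_mul (hcomm : IntertwinesCoactions H γ v) (φ φ' : 𝒜)
    (R : 𝔸 ⊗[k] (H ⊗[k] H)) (T : H ⊗[k] (𝔸 ⊗[k] H)) (r : 𝔸 ⊗[k] H) :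
    wordMap γ v φ φ' R (splitFst H (lam (k := k) (H := H)) r * T) 1 =
      wordMap γ v φ φ' (R * splitFst H (rho (k := k) (H := H)) r) T 1 := by
  apply eq_of_tmul r
  intro u d
  apply eq_of_tmul₃ R
  intro x₁ x₂ x₃
  apply eq_of_tmul₃ T
  intro t₁ t₂ t₃
  have word_lam (l : H ⊗[k] 𝔸) : wordMap γ v φ φ' (x₁ ⊗ₜ (x₂ ⊗ₜ x₃))
      (TensorProduct.assoc k H 𝔸 H (l ⊗ₜ d) * (t₁ ⊗ₜ (t₂ ⊗ₜ t₃))) 1 =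
        γ x₁ * prodMap (vL v (t₁ • op x₂ • φ)) γ.toLinearMap l *
          (γ t₂ * v (op (x₃ * d * t₃) • φ')) := by
    apply eq_of_tmul l
    simp [wordMap_tmul_one, vL, mul_assoc, mul_smul]
  have word_rho (l : 𝔸 ⊗[k] H) : wordMap γ v φ φ'
      (x₁ ⊗ₜ (x₂ ⊗ₜ x₃) * TensorProduct.assoc k 𝔸 H H (l ⊗ₜ d)) (t₁ ⊗ₜ (t₂ ⊗ₜ t₃)) 1 =
        γ x₁ * prodMap γ.toLinearMap (vR v (t₁ • op x₂ • φ)) l *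
          (γ t₂ * v (op (x₃ * d * t₃) • φ')) := by
    apply eq_of_tmul l
    simp [wordMap_tmul_one, vR, mul_assoc, mul_smul, smul_comm t₁ (op _)]
  rw [splitFst_tmul, splitFst_tmul, word_lam, word_rho, hcomm]

end Words

section Multiplicativity

variable {k H 𝒜 𝔸 B : Type*} [Field k] [Ring H] [Algebra k H] [NonAssocRing 𝒜] [Module k 𝒜]
  [SMulCommClass k 𝒜 𝒜] [IsScalarTower k 𝒜 𝒜] [Module H 𝒜] [IsScalarTower k H 𝒜]
  [Module Hᵐᵒᵖ 𝒜] [IsScalarTower k Hᵐᵒᵖ 𝒜]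
  [Ring 𝔸] [Algebra k 𝔸] [Ring B] [Algebra k B]

open QuasiBialgebra QuasiHopfAlgebra RightComoduleAlgebra LeftComoduleAlgebra BicomoduleAlgebra
open MulOpposite

variable (k H 𝒜) in
/-- The condition `(φ ψ) · h = (φ · h₁)(ψ · h₂)` that the multiplication of `𝒜` is a map of right
`H`-modules. -/
def IsRightModuleMul [QuasiBialgebra k H] : Prop :=
  ∀ (h : H) (φ ψ : 𝒜), op h • (φ * ψ) = prodMap LinearMap.id LinearMap.id
    (tensorAct (actR k H 𝒜) (actR k H 𝒜) (comul h) (φ ⊗ₜ[k] ψ))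

theorem wTilde_mulFst_twistedAct5_tmul [QuasiHopfAlgebra k H] [RightComoduleAlgebra k H 𝔸]
    (γ : 𝔸 →ₐ[k] B) (v : 𝒜 →ₗ[k] B) (s : H ⊗[k] (H ⊗[k] (𝔸 ⊗[k] (H ⊗[k] H)))) (φ φ' : 𝒜)
    (u : 𝔸) :
    wTilde H γ v (mulFst k 𝒜 𝔸 (twistedAct5 k H 𝒜 𝔸 s (φ ⊗ₜ (φ' ⊗ₜ u)))) =
      wTilde H γ v (mulFst k 𝒜 𝔸 (twistedAct5 k H 𝒜 𝔸 s (φ ⊗ₜ (φ' ⊗ₜ 1)))) * γ u := by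
  apply eq_of_tmul₃ s
  intro s₁ s₂ s
  apply eq_of_tmul₃ s
  intro a s₄ s₅
  simp only [twistedAct5_tmul, mulFst_tmul, wTilde_tmul, mul_one, map_mul, mul_assoc]

variable [SMulCommClass H Hᵐᵒᵖ 𝒜] [QuasiHopfAlgebra k H] [BicomoduleAlgebra k H 𝔸]
  {γ : 𝔸 →ₐ[k] B} {v : 𝒜 →ₗ[k] B}

variable (H) in
/-- The condition that `v(φ φ')` equals
`γ(X̃¹_ρ) v(θ¹ X̃¹_λ · φ · X̃²_ρ) γ(θ²) v(X̃²_λ · φ' · X̃³_ρ θ³) γ(X̃³_λ)`. -/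
def ReassociatesMul (γ : 𝔸 →ₐ[k] B) (v : 𝒜 →ₗ[k] B) : Prop :=
  ∀ φ φ' : 𝒜, v (φ * φ') =
    vMulExpr γ v (phiRho k H 𝔸) (theta k H 𝔸) (phiLam k H 𝔸) φ φ'

theorem evalRight_mul (hact : IsRightModuleMul k H 𝒜) (hmul : ReassociatesMul H γ v)
    (t : 𝔸 ⊗[k] H) (h₁ h₂ h₄ h₅ : H) (a : 𝔸) (φ φ' : 𝒜) :
    evalRight k H γ v ((h₁ • op h₅ • φ) * (h₂ • op h₄ • φ')) t * γ a =
      wordMap γ v φ φ' (1 ⊗ₜ (h₅ ⊗ₜ h₄) * onRight 𝔸 (Delta k H) t * phiRho k H 𝔸)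
        (theta k H 𝔸) (phiLam k H 𝔸 * h₁ ⊗ₜ (h₂ ⊗ₜ a)) := by
  apply eq_of_tmul t
  intro b c
  rw [evalRight_tmul, hact, onRight_tmul, Algebra.TensorProduct.tmul_mul_tmul, one_mul, ← Delta]
  generalize Delta k H c = d
  apply eq_of_tmul d
  intro c₁ c₂
  rw [Algebra.TensorProduct.tmul_mul_tmul, ← mul_wordMap_mul, wordMap_apply, ← hmul]
  simp

variable (k H 𝔸) in
/-- The algebra map `h ⊗ h' ⊗ a ↦ h ⊗ h' ⊗ a ⊗ 1 ⊗ 1`. -/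
abbrev extendRight : H ⊗[k] (H ⊗[k] 𝔸) →ₐ[k] H ⊗[k] (H ⊗[k] (𝔸 ⊗[k] (H ⊗[k] H))) :=
  onRight H (onRight H (tmulOne 𝔸 (H ⊗[k] H)))

theorem wTilde_mulFst_twistedAct5_extendRight (hact : IsRightModuleMul k H 𝒜)
    (hmul : ReassociatesMul H γ v) (L : H ⊗[k] (H ⊗[k] 𝔸)) (P : H ⊗[k] H) (φ φ' : 𝒜) :
    wTilde H γ v (mulFst k 𝒜 𝔸 (twistedAct5 k H 𝒜 𝔸
        (extendRight k H 𝔸 L * 1 ⊗ₜ (1 ⊗ₜ (1 ⊗ₜ P))) (φ ⊗ₜ (φ' ⊗ₜ 1)))) =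
      wordMap γ v φ φ' (1 ⊗ₜ swapInv k H P * onRight 𝔸 (Delta k H) (qRho k H 𝔸) * phiRho k H 𝔸)
        (theta k H 𝔸) (phiLam k H 𝔸 * L) := by
  apply eq_of_tmul₃ L
  intro h₁ h₂ a
  apply eq_of_tmul P
  intro p₄ p₅
  rw [swapInv_tmul, ← evalRight_mul hact hmul, ← vTilde_apply]
  simp only [onRight_tmul, tmulOne_apply, Algebra.TensorProduct.tmul_mul_tmul, one_mul, mul_one,
    twistedAct5_tmul, mulFst_tmul, wTilde_tmul]

end Multiplicativity

/-! ### The element `Ω` -/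

section Omega

variable {k H 𝔸 : Type*} [Field k] [Ring H] [Algebra k H] [Ring 𝔸] [Algebra k 𝔸]

open QuasiBialgebra QuasiHopfAlgebra RightComoduleAlgebra LeftComoduleAlgebra BicomoduleAlgebra

theorem extendRight_mul_comm (L : H ⊗[k] (H ⊗[k] 𝔸)) (P : H ⊗[k] H) :
    1 ⊗ₜ (1 ⊗ₜ (1 ⊗ₜ P)) * extendRight k H 𝔸 L = extendRight k H 𝔸 L * 1 ⊗ₜ (1 ⊗ₜ (1 ⊗ₜ P)) := by
  apply eq_of_tmul₃ L
  simp

theorem splitFst_comul_splitFst_lam_tmul [QuasiHopfAlgebra k H] [LeftComoduleAlgebra k H 𝔸]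
    (a : 𝔸) (P : H ⊗[k] H) :
    splitFst (𝔸 ⊗[k] (H ⊗[k] H)) (Delta k H)
      (splitFst (H ⊗[k] H) (lam (k := k) (H := H) (A := 𝔸)) (a ⊗ₜ P)) =
    extendRight k H 𝔸 (splitFst 𝔸 (Delta k H) (lam a)) * 1 ⊗ₜ (1 ⊗ₜ (1 ⊗ₜ P)) := by
  rw [splitFst_tmul]
  generalize lam (k := k) (H := H) a = l
  apply eq_of_tmul l
  intro h b
  rw [TensorProduct.assoc_tmul, splitFst_tmul, splitFst_tmul]
  generalize Delta k H h = d
  apply eq_of_tmul d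
  simp

variable [QuasiHopfAlgebra k H] [BicomoduleAlgebra k H 𝔸]

theorem onRight_splitFst_lam_tmul (t₁ t₃ : H) (t₂ : 𝔸) :
    onRight H (onRight H (onRight 𝔸 (tmulOne H H)))
      (onRight H (splitFst H (lam (k := k) (H := H) (A := 𝔸))) (t₁ ⊗ₜ (t₂ ⊗ₜ t₃))) =
    extendRight k H 𝔸 (onRight H (lam (k := k) (H := H)) (t₁ ⊗ₜ t₂)) *
      1 ⊗ₜ (1 ⊗ₜ (1 ⊗ₜ (t₃ ⊗ₜ 1))) := by
  rw [onRight_tmul, splitFst_tmul, onRight_tmul, onRight_tmul (lam (k := k) (H := H))]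
  generalize lam (k := k) (H := H) t₂ = l
  apply eq_of_tmul l
  simp

variable (k H 𝔸) in
/-- The element `omegaAux`, with `Φ_ρ` and `Φ_{λ,ρ}⁻¹` replaced by variable elements; `omegaAux`
is bilinear in the two, which reduces its computation to pure tensors. -/
def omegaBilin : 𝔸 ⊗[k] (H ⊗[k] H) →ₗ[k] H ⊗[k] (𝔸 ⊗[k] H) →ₗ[k]
    H ⊗[k] (H ⊗[k] (𝔸 ⊗[k] (H ⊗[k] H))) :=
  (LinearMap.mul k (H ⊗[k] (H ⊗[k] (𝔸 ⊗[k] (H ⊗[k] H))))).compl₁₂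
    (LinearMap.mulRight k (extendRight k H 𝔸 (phiLamInv k H 𝔸)) ∘ₗ
      LinearMap.mulLeft k (oneTmul H _ (oneTmul H _ (oneTmul 𝔸 _ (drinfeldTwist k H)))) ∘ₗ
      ((splitFst (𝔸 ⊗[k] (H ⊗[k] H)) (Delta k H)).comp
        (splitFst (H ⊗[k] H) (lam (k := k) (H := H) (A := 𝔸)))).toLinearMap)
    ((onRight H (onRight H (onRight 𝔸 (tmulOne H H)))).comp
      (onRight H (splitFst H (lam (k := k) (H := H) (A := 𝔸))))).toLinearMap

theorem omegaBilin_phiRho_theta :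
    omegaBilin k H 𝔸 (phiRho k H 𝔸) (theta k H 𝔸) = omegaAux k H 𝔸 := rfl

theorem omegaBilin_apply (z : 𝔸 ⊗[k] (H ⊗[k] H)) (t : H ⊗[k] (𝔸 ⊗[k] H)) :
    omegaBilin k H 𝔸 z t =
      oneTmul H _ (oneTmul H _ (oneTmul 𝔸 _ (drinfeldTwist k H))) *
        splitFst (𝔸 ⊗[k] (H ⊗[k] H)) (Delta k H)
          (splitFst (H ⊗[k] H) (lam (k := k) (H := H) (A := 𝔸)) z) *
        extendRight k H 𝔸 (phiLamInv k H 𝔸) *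
        onRight H (onRight H (onRight 𝔸 (tmulOne H H)))
          (onRight H (splitFst H (lam (k := k) (H := H) (A := 𝔸))) t) := rfl

theorem omegaBilin_tmul (a t₂ : 𝔸) (P : H ⊗[k] H) (t₁ t₃ : H) :
    omegaBilin k H 𝔸 (a ⊗ₜ P) (t₁ ⊗ₜ (t₂ ⊗ₜ t₃)) =
      extendRight k H 𝔸 (splitFst 𝔸 (Delta k H) (lam a) * phiLamInv k H 𝔸 *
        onRight H (lam (k := k) (H := H)) (t₁ ⊗ₜ t₂)) *
      1 ⊗ₜ (1 ⊗ₜ (1 ⊗ₜ (drinfeldTwist k H * P * t₃ ⊗ₜ 1))) := by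
  have one_tmul_mul (P Q : H ⊗[k] H) : (1 : H) ⊗ₜ[k] ((1 : H) ⊗ₜ[k] ((1 : 𝔸) ⊗ₜ[k] (P * Q))) =
      1 ⊗ₜ (1 ⊗ₜ (1 ⊗ₜ P)) * 1 ⊗ₜ (1 ⊗ₜ (1 ⊗ₜ Q)) := by simp
  have left_comm (L : H ⊗[k] (H ⊗[k] 𝔸)) (P : H ⊗[k] H)
      (x : H ⊗[k] (H ⊗[k] (𝔸 ⊗[k] (H ⊗[k] H)))) :
      1 ⊗ₜ (1 ⊗ₜ (1 ⊗ₜ P)) * (extendRight k H 𝔸 L * x) =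
        extendRight k H 𝔸 L * (1 ⊗ₜ (1 ⊗ₜ (1 ⊗ₜ P)) * x) := by
    rw [← mul_assoc, extendRight_mul_comm, mul_assoc]
  rw [omegaBilin_apply, splitFst_comul_splitFst_lam_tmul, onRight_splitFst_lam_tmul]
  simp only [oneTmul_apply, mul_assoc, map_mul, left_comm, one_tmul_mul]

theorem phiLam_mul_splitFst_lam_mul_phiLamInv (a : 𝔸) (t : H ⊗[k] 𝔸) :
    phiLam k H 𝔸 * (splitFst 𝔸 (Delta k H) (lam a) * phiLamInv k H 𝔸 *
      onRight H (lam (k := k) (H := H)) t) = onRight H (lam (k := k) (H := H)) (lam a * t) := by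
  rw [← mul_assoc, ← mul_assoc, phiLam_mul_splitFst_lam, mul_assoc (onRight H _ _), phiLam,
    phiLamInv, Units.mul_inv, mul_one, map_mul]

variable {𝒜 B : Type*} [NonAssocRing 𝒜] [Module k 𝒜] [SMulCommClass k 𝒜 𝒜] [IsScalarTower k 𝒜 𝒜]
  [Module H 𝒜] [IsScalarTower k H 𝒜] [Module Hᵐᵒᵖ 𝒜] [IsScalarTower k Hᵐᵒᵖ 𝒜]
  [SMulCommClass H Hᵐᵒᵖ 𝒜] [Ring B] [Algebra k B] {γ : 𝔸 →ₐ[k] B} {v : 𝒜 →ₗ[k] B}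

theorem wTilde_mulFst_omegaBilin_tmul (hcomm : IntertwinesCoactions H γ v)
    (hact : IsRightModuleMul k H 𝒜) (hmul : ReassociatesMul H γ v) (z : 𝔸 ⊗[k] (H ⊗[k] H))
    (t₁ t₃ : H) (t₂ : 𝔸) (φ φ' : 𝒜) :
    wTilde H γ v (mulFst k 𝒜 𝔸 (twistedAct5 k H 𝒜 𝔸
        (omegaBilin k H 𝔸 z (t₁ ⊗ₜ (t₂ ⊗ₜ t₃))) (φ ⊗ₜ (φ' ⊗ₜ 1)))) =
      wordMap γ v φ φ' (1 ⊗ₜ (1 ⊗ₜ SInv k H t₃) *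
          twistedRhoRho k H 𝔸 (onRight 𝔸 (Delta k H) (qRho k H 𝔸) * phiRho k H 𝔸) z)
        (theta k H 𝔸 * onRight H (rho (k := k) (H := H)) (t₁ ⊗ₜ t₂)) 1 := by
  apply eq_of_tmul z
  intro a P
  rw [omegaBilin_tmul, wTilde_mulFst_twistedAct5_extendRight hact hmul,
    phiLam_mul_splitFst_lam_mul_phiLamInv, wordMap_onRight_lam hcomm,
    map_mul (onRight H (rho (k := k) (H := H))), ← mul_assoc, theta_mul_onRight_rho,
    mul_assoc (splitFst H _ _), wordMap_splitFst_lam_mul hcomm, swapInv_mul, swapInv_tmul,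
    SInv_one, twistedRhoRho_tmul]
  simp only [oneTmul_apply, ← mul_assoc, Algebra.TensorProduct.tmul_mul_tmul, one_mul]

theorem wTilde_mulFst_omegaBilin_phiRho (hcomm : IntertwinesCoactions H γ v)
    (hact : IsRightModuleMul k H 𝒜) (hmul : ReassociatesMul H γ v) (t : H ⊗[k] (𝔸 ⊗[k] H))
    (φ φ' : 𝒜) :
    wTilde H γ v (mulFst k 𝒜 𝔸 (twistedAct5 k H 𝒜 𝔸
        (omegaBilin k H 𝔸 (phiRho k H 𝔸) t) (φ ⊗ₜ (φ' ⊗ₜ 1)))) =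
      wordMap γ v φ φ' (onRight 𝔸 (tmulOne H H) (qRho k H 𝔸)) ((qMap k H 𝔸).lTensor H
        (splitFst (H ⊗[k] H) (lam (k := k) (H := H)) (phiRho k H 𝔸) *
          onRight H (onRight 𝔸 (tmulOne H H)) (theta k H 𝔸) *
          onRight H (splitFst H (rho (k := k) (H := H))) t)) 1 := by
  have tmul_comm (q : 𝔸 ⊗[k] H) (s : H) :
      1 ⊗ₜ (1 ⊗ₜ s) * onRight 𝔸 (tmulOne H H) q = onRight 𝔸 (tmulOne H H) q * 1 ⊗ₜ (1 ⊗ₜ s) := by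
    apply eq_of_tmul q
    simp
  apply eq_of_tmul₃ t
  intro t₁ t₂ t₃
  rw [wTilde_mulFst_omegaBilin_tmul hcomm hact hmul, twistedRhoRho_phiRho, ← mul_assoc, tmul_comm,
    ← wordMap_splitFst_lam_mul hcomm, wordMap_mul_one_tmul, lTensor_qMap_mul_splitFst_tmul,
    ← splitFst_qMap, ← qRho_eq]
  simp only [mul_assoc]

theorem wTilde_mulFst_omegaAux (hcomm : IntertwinesCoactions H γ v)
    (hact : IsRightModuleMul k H 𝒜) (hmul : ReassociatesMul H γ v) (φ : 𝒜) (x : 𝒜 ⊗[k] 𝔸) :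
    wTilde H γ v (mulFst k 𝒜 𝔸 (twistedAct5 k H 𝒜 𝔸 (omegaAux k H 𝔸) (φ ⊗ₜ x))) =
      vTilde H γ v φ * wTilde H γ v x := by
  apply eq_of_tmul x
  intro φ' u
  rw [wTilde_mulFst_twistedAct5_tmul, ← omegaBilin_phiRho_theta,
    wTilde_mulFst_omegaBilin_phiRho hcomm hact hmul, lTensor_qMap_theta,
    wordMap_onRight_tmulOne_one_tmul, ← vTilde_apply, ← vTilde_apply, wTilde_tmul, mul_assoc]

end Omega

/-! ### Units -/

section Counit

variable (k H 𝔸 : Type*) [Field k] [Ring H] [Algebra k H] [QuasiHopfAlgebra k H] [Ring 𝔸]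
  [Algebra k 𝔸]

open QuasiBialgebra QuasiHopfAlgebra RightComoduleAlgebra LeftComoduleAlgebra BicomoduleAlgebra

/-- The algebra map `h₁ ⊗ h₂ ⊗ a ⊗ h₄ ⊗ h₅ ↦ ε(h₁) ε(h₅) h₂ ⊗ a ⊗ h₄`, through which `twistedAct5`
acts on `1 ⊗ φ ⊗ u`. -/
def counitOuter : H ⊗[k] (H ⊗[k] (𝔸 ⊗[k] (H ⊗[k] H))) →ₐ[k] H ⊗[k] (𝔸 ⊗[k] H) :=
  (onRight H (onRight 𝔸 (counitSnd k H H))).comp (counitFst k H _)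

/-- The algebra map `h₁ ⊗ h₂ ⊗ a ⊗ h₄ ⊗ h₅ ↦ ε(h₂) ε(h₄) h₁ ⊗ a ⊗ h₅`, through which `twistedAct5`
acts on `φ ⊗ 1 ⊗ u`. -/
def counitInner : H ⊗[k] (H ⊗[k] (𝔸 ⊗[k] (H ⊗[k] H))) →ₐ[k] H ⊗[k] (𝔸 ⊗[k] H) :=
  (onRight H (onRight 𝔸 (counitFst k H H))).comp (onRight H (counitFst k H _))

variable {k H 𝔸} [BicomoduleAlgebra k H 𝔸]

theorem counitOuter_omegaAux : counitOuter k H 𝔸 (omegaAux k H 𝔸) = 1 := by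
  have outer_twist : counitOuter k H 𝔸
      (oneTmul H _ (oneTmul H _ (oneTmul 𝔸 _ (drinfeldTwist k H)))) = 1 := by
    simp [counitOuter, counitSnd_drinfeldTwist, Algebra.TensorProduct.one_def]
  have outer_phiRho : counitOuter k H 𝔸 (splitFst (𝔸 ⊗[k] (H ⊗[k] H)) (Delta k H)
      (splitFst (H ⊗[k] H) (lam (k := k) (H := H)) (phiRho k H 𝔸))) = 1 := by
    rw [counitOuter, AlgHom.comp_apply, counitFst_splitFst _ counitFst_comul,
      onRight_onRight_splitFst, onRight_counitSnd_phiRho, map_one]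
  have outer_phiLamInv : counitOuter k H 𝔸 (extendRight k H 𝔸 (phiLamInv k H 𝔸)) = 1 := by
    rw [counitOuter, AlgHom.comp_apply, counitFst_onRight, phiLamInv,
      map_inv_eq_one _ PhiLam counitFst_phiLam, map_one, map_one]
  have outer_theta : counitOuter k H 𝔸 (onRight H (onRight H (onRight 𝔸 (tmulOne H H)))
      (onRight H (splitFst H (lam (k := k) (H := H))) (theta k H 𝔸))) = 1 := by
    rw [counitOuter, AlgHom.comp_apply, counitFst_onRight, counitFst_onRight, theta,
      map_inv_eq_one _ PhiLamRho counitFst_phiLamRho, map_one, map_one, map_one]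
  rw [omegaAux, map_mul, map_mul, map_mul, outer_twist, outer_phiRho, outer_phiLamInv, outer_theta,
    one_mul, one_mul, one_mul]

theorem counitInner_omegaAux : counitInner k H 𝔸 (omegaAux k H 𝔸) = 1 := by
  have inner_twist : counitInner k H 𝔸
      (oneTmul H _ (oneTmul H _ (oneTmul 𝔸 _ (drinfeldTwist k H)))) = 1 := by
    simp [counitInner, counitFst_drinfeldTwist, Algebra.TensorProduct.one_def]
  have inner_phiRho : counitInner k H 𝔸 (splitFst (𝔸 ⊗[k] (H ⊗[k] H)) (Delta k H)
      (splitFst (H ⊗[k] H) (lam (k := k) (H := H)) (phiRho k H 𝔸))) = 1 := by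
    rw [counitInner, AlgHom.comp_apply, onRight_counitFst_splitFst _ counitSnd_comul,
      onRight_onRight_splitFst, onRight_counitFst_phiRho, map_one]
  have inner_phiLamInv : counitInner k H 𝔸 (extendRight k H 𝔸 (phiLamInv k H 𝔸)) = 1 := by
    rw [counitInner, AlgHom.comp_apply, onRight_counitFst_onRight_onRight, phiLamInv,
      map_inv_eq_one _ PhiLam onRight_counitFst_phiLam, map_one, map_one]
  have contract_tmulOne : (counitFst k H H).comp (tmulOne H H) = counitTo k H H :=
    AlgHom.ext fun h => by simp [counitTo_apply]
  have contract_lam : (counitFst k H (𝔸 ⊗[k] H)).comp (splitFst H (lam (k := k) (H := H))) =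
      AlgHom.id k _ := AlgHom.ext (counitFst_splitFst _ counitFst_lam)
  have inner_theta : counitInner k H 𝔸 (onRight H (onRight H (onRight 𝔸 (tmulOne H H)))
      (onRight H (splitFst H (lam (k := k) (H := H))) (theta k H 𝔸))) = 1 := by
    rw [counitInner, AlgHom.comp_apply, onRight_counitFst_onRight_onRight,
      onRight_onRight (counitFst k H (𝔸 ⊗[k] H)), contract_lam, onRight_id, onRight_onRight,
      ← onRight_comp, contract_tmulOne, onRight_onRight_counitTo_theta]
  rw [omegaAux, map_mul, map_mul, map_mul, inner_twist, inner_phiRho, inner_phiLamInv, inner_theta,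
    one_mul, one_mul, one_mul]

end Counit

section Unit

variable {k H 𝒜 𝔸 B : Type*} [Field k] [Ring H] [Algebra k H] [QuasiHopfAlgebra k H]
  [NonAssocRing 𝒜] [Module k 𝒜] [Module Hᵐᵒᵖ 𝒜] [Ring 𝔸] [Algebra k 𝔸] [Ring B] [Algebra k B]

open QuasiBialgebra QuasiHopfAlgebra RightComoduleAlgebra LeftComoduleAlgebra BicomoduleAlgebra
open MulOpposite DiagonalCrossedProduct

theorem counitSnd_qRho [RightComoduleAlgebra k H 𝔸] : counitSnd k H 𝔸 (qRho k H 𝔸) = 1 := by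
  have counitSnd_qMap : ∀ t, counitSnd k H 𝔸 (qMap k H 𝔸 t) =
      counitSnd k H 𝔸 (onRight 𝔸 (counitSnd k H H) t) := fun t => by
    apply eq_of_tmul₃ t
    intro a b c
    rw [qMap_tmul, counitSnd_tmul, counit_SInv, evalAlpha_tmul, map_mul, map_mul, counit_S,
      counit_alpha, onRight_tmul, counitSnd_tmul, counitSnd_tmul, map_smul]
    simp [mul_comm]
  rw [qRho_eq, counitSnd_qMap, onRight_counitSnd_phiRho, map_one]

theorem vTilde_one [IsScalarTower k Hᵐᵒᵖ 𝒜] [RightComoduleAlgebra k H 𝔸]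
    (hinv : ∀ h : H, op h • (1 : 𝒜) = (counit h : k) • (1 : 𝒜)) (γ : 𝔸 →ₐ[k] B)
    {v : 𝒜 →ₗ[k] B} (hone : v 1 = 1) : vTilde H γ v 1 = 1 := by
  have evalRight_one : ∀ t : 𝔸 ⊗[k] H, evalRight k H γ v 1 t = γ (counitSnd k H 𝔸 t) :=
    fun t => by
      apply eq_of_tmul t
      intro a h
      rw [evalRight_tmul, hinv, counitSnd_tmul, map_smul, map_smul, hone, mul_smul_comm, mul_one]
  rw [vTilde_apply, evalRight_one, counitSnd_qRho, map_one]

variable [Module H 𝒜]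

variable (k H 𝒜) in
/-- The condition `h · 1 = ε(h) 1 = 1 · h` that `H` acts on the unit of `𝒜` through its counit. -/
def UnitIsInvariant : Prop :=
  ∀ h : H, h • (1 : 𝒜) = (counit h : k) • (1 : 𝒜) ∧ op h • (1 : 𝒜) = (counit h : k) • (1 : 𝒜)

variable [IsScalarTower k H 𝒜]

theorem smul_op_SInv_smul_one (hinv : UnitIsInvariant k H 𝒜) (h h' : H) :
    h • op (SInv k H h') • (1 : 𝒜) = (counit h * counit h' : k) • (1 : 𝒜) := by
  rw [(hinv _).2, counit_SInv, ← actL_apply k H 𝒜, map_smul, actL_apply, (hinv h).1, smul_smul,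
    mul_comm]

variable [IsScalarTower k Hᵐᵒᵖ 𝒜]

section Multiplication

variable [SMulCommClass k 𝒜 𝒜] [IsScalarTower k 𝒜 𝒜]

theorem mulFst_twistedAct5_one_tmul (hinv : UnitIsInvariant k H 𝒜)
    (s : H ⊗[k] (H ⊗[k] (𝔸 ⊗[k] (H ⊗[k] H)))) (x : 𝒜 ⊗[k] 𝔸) :
    mulFst k 𝒜 𝔸 (twistedAct5 k H 𝒜 𝔸 s (1 ⊗ₜ x)) =
      twistedAct3 k H 𝒜 𝔸 (counitOuter k H 𝔸 s) x := by
  apply eq_of_tmul x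
  intro φ u
  apply eq_of_tmul₃ s
  intro s₁ s₂ s
  apply eq_of_tmul₃ s
  intro a s₄ s₅
  rw [twistedAct5_tmul, mulFst_tmul, smul_op_SInv_smul_one hinv, smul_mul_assoc, one_mul]
  simp [-LinearEquiv.coe_coe, counitOuter, TensorProduct.smul_tmul', smul_smul, mul_comm]

theorem mulFst_twistedAct5_tmul_one (hinv : UnitIsInvariant k H 𝒜)
    (s : H ⊗[k] (H ⊗[k] (𝔸 ⊗[k] (H ⊗[k] H)))) (φ : 𝒜) (u : 𝔸) :
    mulFst k 𝒜 𝔸 (twistedAct5 k H 𝒜 𝔸 s (φ ⊗ₜ (1 ⊗ₜ u))) =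
      twistedAct3 k H 𝒜 𝔸 (counitInner k H 𝔸 s) (φ ⊗ₜ u) := by
  apply eq_of_tmul₃ s
  intro s₁ s₂ s
  apply eq_of_tmul₃ s
  intro a s₄ s₅
  rw [twistedAct5_tmul, mulFst_tmul, smul_op_SInv_smul_one hinv, mul_smul_comm, mul_one]
  simp [-LinearEquiv.coe_coe, counitInner, TensorProduct.smul_tmul', smul_smul, mul_comm]

end Multiplication

theorem twistedAct3_splitFst_lam_one_tmul [LeftComoduleAlgebra k H 𝔸]
    (hinv : UnitIsInvariant k H 𝒜) (r : 𝔸 ⊗[k] H) (u : 𝔸) :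
    twistedAct3 k H 𝒜 𝔸 (splitFst H (lam (k := k) (H := H)) r) (1 ⊗ₜ u) =
      1 ⊗ₜ (counitSnd k H 𝔸 r * u) := by
  have twistedAct3_one_tmul : ∀ s : H ⊗[k] (𝔸 ⊗[k] H), twistedAct3 k H 𝒜 𝔸 s (1 ⊗ₜ u) =
      1 ⊗ₜ (counitSnd k H 𝔸 (counitFst k H _ s) * u) := fun s => by
    apply eq_of_tmul₃ s
    intro h a h'
    rw [twistedAct3_tmul, smul_op_SInv_smul_one hinv]
    simp [TensorProduct.smul_tmul', smul_smul, mul_comm]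
  rw [twistedAct3_one_tmul, counitFst_splitFst _ counitFst_lam]

variable [SMulCommClass k 𝒜 𝒜] [IsScalarTower k 𝒜 𝒜] [BicomoduleAlgebra k H 𝔸]

theorem mk_mul (φ : 𝒜) (u : 𝔸) (x : 𝒜 ⊗[k] 𝔸) :
    (mk H φ u * of k H 𝒜 𝔸 x : DiagonalCrossedProduct k H 𝒜 𝔸) =
      of k H 𝒜 𝔸 (mulFst k 𝒜 𝔸 (twistedAct5 k H 𝒜 𝔸 (omegaAux k H 𝔸)
        (φ ⊗ₜ twistedAct3 k H 𝒜 𝔸 (splitFst H (lam (k := k) (H := H)) (rho u)) x))) := rfl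

theorem mk_mul_mk_one (hinv : UnitIsInvariant k H 𝒜) (φ : 𝒜) (u u' : 𝔸) :
    (mk H φ u * mk H 1 u' : DiagonalCrossedProduct k H 𝒜 𝔸) = mk H φ (u * u') := by
  refine (mk_mul φ u (1 ⊗ₜ u')).trans (congrArg (of k H 𝒜 𝔸) ?_)
  rw [twistedAct3_splitFst_lam_one_tmul hinv, counitSnd_rho, mulFst_twistedAct5_tmul_one hinv,
    counitInner_omegaAux, twistedAct3_one, Module.End.one_apply]

theorem mk_one_mul (hinv : UnitIsInvariant k H 𝒜) (u : 𝔸) (x : 𝒜 ⊗[k] 𝔸) :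
    (mk H 1 u * of k H 𝒜 𝔸 x : DiagonalCrossedProduct k H 𝒜 𝔸) =
      of k H 𝒜 𝔸 (twistedAct3 k H 𝒜 𝔸 (splitFst H (lam (k := k) (H := H)) (rho u)) x) := by
  rw [mk_mul, mulFst_twistedAct5_one_tmul hinv, counitOuter_omegaAux, twistedAct3_one,
    Module.End.one_apply]

end Unit

/-! ### The algebra map -/

section Homomorphism

variable {k H 𝒜 𝔸 B : Type*} [Field k] [Ring H] [Algebra k H] [QuasiHopfAlgebra k H]
  [NonAssocRing 𝒜] [Module k 𝒜] [Module Hᵐᵒᵖ 𝒜] [IsScalarTower k Hᵐᵒᵖ 𝒜]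
  [Ring 𝔸] [Algebra k 𝔸] [BicomoduleAlgebra k H 𝔸] [Ring B] [Algebra k B]
  {γ : 𝔸 →ₐ[k] B} {v : 𝒜 →ₗ[k] B}

open QuasiBialgebra QuasiHopfAlgebra RightComoduleAlgebra LeftComoduleAlgebra
open MulOpposite DiagonalCrossedProduct

theorem wTilde_comp_j (hinv : ∀ h : H, op h • (1 : 𝒜) = (counit h : k) • (1 : 𝒜))
    (hone : v 1 = 1) :
    (wTilde H γ v ∘ₗ (of k H 𝒜 𝔸).symm.toLinearMap) ∘ₗ j k H 𝒜 𝔸 = γ.toLinearMap := by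
  refine LinearMap.ext fun u => ?_
  change wTilde H γ v (1 ⊗ₜ u) = γ u
  rw [wTilde_tmul, vTilde_one hinv γ hone, one_mul]

variable [Module H 𝒜] [IsScalarTower k H 𝒜]

theorem twistedAct3_splitFst_lam_S_tmul_one (φ : 𝒜) (h : H) :
    twistedAct3 k H 𝒜 𝔸 (splitFst H (lam (k := k) (H := H)) (1 ⊗ₜ S k H h)) (φ ⊗ₜ 1) =
      (op h • φ) ⊗ₜ 1 := by
  rw [splitFst_tmul, map_one, Algebra.TensorProduct.one_def, TensorProduct.assoc_tmul,
    twistedAct3_tmul, SInv_S, one_smul, one_mul]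

variable [SMulCommClass H Hᵐᵒᵖ 𝒜]

theorem wTilde_comp_Gam (hcomm : IntertwinesCoactions H γ v) :
    (wTilde H γ v ∘ₗ (of k H 𝒜 𝔸).symm.toLinearMap) ∘ₗ Gam k H 𝒜 𝔸 = v := by
  refine LinearMap.ext fun φ => ?_
  change wTilde H γ v (twistedAct3 k H 𝒜 𝔸
    (splitFst H (lam (k := k) (H := H)) (pRho k H 𝔸)) (φ ⊗ₜ 1)) = v φ
  rw [wTilde_twistedAct3 hcomm, qMap_phiRho_mul_splitFst_pRho, Algebra.TensorProduct.one_def,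
    evalRight_tmul, map_one, one_mul, op_one, one_smul]

variable [SMulCommClass k 𝒜 𝒜] [IsScalarTower k 𝒜 𝒜]

theorem isAlgMap_wTilde (hact : IsRightModuleMul k H 𝒜) (hinv : UnitIsInvariant k H 𝒜)
    (hcomm : IntertwinesCoactions H γ v) (hmul : ReassociatesMul H γ v) (hone : v 1 = 1) :
    IsAlgMap (wTilde H γ v ∘ₗ (of k H 𝒜 𝔸).symm.toLinearMap) where
  map_one := by
    change wTilde H γ v (1 ⊗ₜ 1) = 1
    rw [wTilde_tmul, vTilde_one (fun h => (hinv h).2) γ hone, map_one, one_mul]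
  map_mul x y := by
    obtain ⟨x, rfl⟩ := (of k H 𝒜 𝔸).surjective x
    obtain ⟨y, rfl⟩ := (of k H 𝒜 𝔸).surjective y
    change wTilde H γ v (mulAux k H 𝒜 𝔸 x y) = wTilde H γ v x * wTilde H γ v y
    apply eq_of_tmul x
    intro φ u
    change wTilde H γ v (mulFst k 𝒜 𝔸 (twistedAct5 k H 𝒜 𝔸 (omegaAux k H 𝔸)
      (φ ⊗ₜ twistedAct3 k H 𝒜 𝔸 (splitFst H (lam (k := k) (H := H)) (rho u)) y))) = _
    rw [wTilde_mulFst_omegaAux hcomm hact hmul]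
    apply eq_of_tmul y
    intro φ' u'
    rw [wTilde_twistedAct3_rho hcomm, wTilde_tmul, wTilde_tmul]
    simp only [mul_assoc]

variable {w : DiagonalCrossedProduct k H 𝒜 𝔸 →ₗ[k] B}

theorem isAlgMap_apply_twistedAct3_pRho (hinv : UnitIsInvariant k H 𝒜) (hw : IsAlgMap w)
    (hΓ : w ∘ₗ Gam k H 𝒜 𝔸 = v) (hj : w ∘ₗ j k H 𝒜 𝔸 = γ.toLinearMap) (φ : 𝒜) (t : 𝔸 ⊗[k] H) :
    w (of k H 𝒜 𝔸 (twistedAct3 k H 𝒜 𝔸 (splitFst H (lam (k := k) (H := H))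
      (prodMap (LinearMap.mulRight k (pRho k H 𝔸) ∘ₗ (rho (k := k) (H := H)).toLinearMap)
        ((oneTmul 𝔸 H).toLinearMap ∘ₗ S k H) t)) (φ ⊗ₜ 1))) = evalRight k H γ v φ t := by
  apply eq_of_tmul t
  intro a h
  have apply_mk_one : w (mk H 1 a) = γ a := LinearMap.congr_fun hj a
  have apply_Gam : w (of k H 𝒜 𝔸 (twistedAct3 k H 𝒜 𝔸
      (splitFst H (lam (k := k) (H := H)) (pRho k H 𝔸)) ((op h • φ) ⊗ₜ 1))) = v (op h • φ) :=
    LinearMap.congr_fun hΓ (op h • φ)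
  simp only [prodMap_tmul, LinearMap.comp_apply, LinearMap.mulRight_apply,
    AlgHom.toLinearMap_apply, oneTmul_apply]
  rw [map_mul (splitFst H (lam (k := k) (H := H))), map_mul (splitFst H (lam (k := k) (H := H))),
    twistedAct3_mul, twistedAct3_mul, Module.End.mul_apply, Module.End.mul_apply,
    twistedAct3_splitFst_lam_S_tmul_one, ← mk_one_mul hinv, hw.map_mul, apply_mk_one, apply_Gam,
    evalRight_tmul]

theorem isAlgMap_apply_mk (hinv : UnitIsInvariant k H 𝒜) (hw : IsAlgMap w)
    (hΓ : w ∘ₗ Gam k H 𝒜 𝔸 = v) (hj : w ∘ₗ j k H 𝒜 𝔸 = γ.toLinearMap) (φ : 𝒜) (u : 𝔸) :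
    w (mk H φ u) = vTilde H γ v φ * γ u := by
  have apply_mk_one : w (mk H φ 1) = vTilde H γ v φ := by
    have h := isAlgMap_apply_twistedAct3_pRho hinv hw hΓ hj φ (qRho k H 𝔸)
    rwa [rho_qRho_mul_pRho, map_one, twistedAct3_one] at h
  have apply_one_mk : w (mk H 1 u) = γ u := LinearMap.congr_fun hj u
  rw [← apply_mk_one, ← apply_one_mk, ← hw.map_mul, mk_mul_mk_one hinv, one_mul]

theorem isAlgMap_eq_wTilde (hinv : UnitIsInvariant k H 𝒜) (hw : IsAlgMap w)
    (hΓ : w ∘ₗ Gam k H 𝒜 𝔸 = v) (hj : w ∘ₗ j k H 𝒜 𝔸 = γ.toLinearMap) :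
    w = wTilde H γ v ∘ₗ (of k H 𝒜 𝔸).symm.toLinearMap := by
  have comp_of : w ∘ₗ (of k H 𝒜 𝔸).toLinearMap = wTilde H γ v :=
    TensorProduct.ext' fun φ u =>
      (isAlgMap_apply_mk hinv hw hΓ hj φ u).trans (wTilde_tmul γ v φ u).symm
  exact LinearMap.ext fun x => LinearMap.congr_fun comp_of ((of k H 𝒜 𝔸).symm x)

end Homomorphism

end QuasiHopf

end

theorem proposition7p1_general {k H 𝒜 𝔸 B : Type*} [Field k]
    [Ring H] [Algebra k H] [QuasiHopfAlgebra k H]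
    [NonAssocRing 𝒜] [Module k 𝒜] [SMulCommClass k 𝒜 𝒜] [IsScalarTower k 𝒜 𝒜]
    [Module H 𝒜] [IsScalarTower k H 𝒜] [Module Hᵐᵒᵖ 𝒜] [IsScalarTower k Hᵐᵒᵖ 𝒜]
    [SMulCommClass H Hᵐᵒᵖ 𝒜]
    [Ring 𝔸] [Algebra k 𝔸] [BicomoduleAlgebra k H 𝔸]
    [Ring B] [Algebra k B]
    (γ : 𝔸 →ₐ[k] B) (v : 𝒜 →ₗ[k] B)
    (hact : ∀ (h : H) (φ φ' : 𝒜), MulOpposite.op h • (φ * φ') =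
      prodMap LinearMap.id LinearMap.id
        (tensorAct (actR k H 𝒜) (actR k H 𝒜) (QuasiBialgebra.comul h) (φ ⊗ₜ[k] φ')))
    (hinv : ∀ h : H, h • (1 : 𝒜) = (QuasiBialgebra.counit h : k) • (1 : 𝒜) ∧
      MulOpposite.op h • (1 : 𝒜) = (QuasiBialgebra.counit h : k) • (1 : 𝒜))
    (hcomm : ∀ (φ : 𝒜) (u : 𝔸),
      prodMap γ.toLinearMap (vR v φ) (RightComoduleAlgebra.rho (k := k) (H := H) u) =
        prodMap (vL v φ) γ.toLinearMap (LeftComoduleAlgebra.lam (k := k) (H := H) u))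
    (hmul : ∀ φ φ' : 𝒜, v (φ * φ') =
      vMulExpr γ v (phiRho k H 𝔸) (theta k H 𝔸) (phiLam k H 𝔸) φ φ')
    (hone : v 1 = 1) :
    (∃! w : DiagonalCrossedProduct k H 𝒜 𝔸 →ₗ[k] B,
      DiagonalCrossedProduct.IsAlgMap w ∧
        w ∘ₗ DiagonalCrossedProduct.Gam k H 𝒜 𝔸 = v ∧
        w ∘ₗ DiagonalCrossedProduct.j k H 𝒜 𝔸 = γ.toLinearMap) ∧
    ∀ w : DiagonalCrossedProduct k H 𝒜 𝔸 →ₗ[k] B,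
      DiagonalCrossedProduct.IsAlgMap w →
      w ∘ₗ DiagonalCrossedProduct.Gam k H 𝒜 𝔸 = v →
      w ∘ₗ DiagonalCrossedProduct.j k H 𝒜 𝔸 = γ.toLinearMap →
      ∀ (φ : 𝒜) (u : 𝔸), w (DiagonalCrossedProduct.mk H φ u) =
        prodMap γ.toLinearMap (vR v φ) (qRho k H 𝔸) * γ u :=
  ⟨⟨_, ⟨isAlgMap_wTilde hact hinv hcomm hmul hone, wTilde_comp_Gam hcomm,
      wTilde_comp_j (fun h => (hinv h).2) hone⟩,
    fun _ ⟨hw, hΓ, hj⟩ => isAlgMap_eq_wTilde hinv hw hΓ hj⟩,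
    fun _ hw hΓ hj => isAlgMap_apply_mk hinv hw hΓ hj⟩

theorem proposition7p1 {k H 𝒜 𝔸 B : Type*} [Field k]
    [Ring H] [Algebra k H] [QuasiHopfAlgebra k H]
    [NonAssocRing 𝒜] [Module k 𝒜] [SMulCommClass k 𝒜 𝒜] [IsScalarTower k 𝒜 𝒜]
    [Module H 𝒜] [IsScalarTower k H 𝒜] [Module Hᵐᵒᵖ 𝒜] [IsScalarTower k Hᵐᵒᵖ 𝒜]
    [SMulCommClass H Hᵐᵒᵖ 𝒜] [BimoduleAlgebra k H 𝒜]
    [Ring 𝔸] [Algebra k 𝔸] [BicomoduleAlgebra k H 𝔸]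
    [Ring B] [Algebra k B]
    (γ : 𝔸 →ₐ[k] B) (v : 𝒜 →ₗ[k] B)
    (hcomm : ∀ (φ : 𝒜) (u : 𝔸),
      prodMap γ.toLinearMap (vR v φ) (RightComoduleAlgebra.rho (k := k) (H := H) u) =
        prodMap (vL v φ) γ.toLinearMap (LeftComoduleAlgebra.lam (k := k) (H := H) u))
    (hmul : ∀ φ φ' : 𝒜, v (φ * φ') =
      vMulExpr γ v (phiRho k H 𝔸) (theta k H 𝔸) (phiLam k H 𝔸) φ φ')
    (hone : v 1 = 1) :
    (∃! w : DiagonalCrossedProduct k H 𝒜 𝔸 →ₗ[k] B,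
      DiagonalCrossedProduct.IsAlgMap w ∧
        w ∘ₗ DiagonalCrossedProduct.Gam k H 𝒜 𝔸 = v ∧
        w ∘ₗ DiagonalCrossedProduct.j k H 𝒜 𝔸 = γ.toLinearMap) ∧
    ∀ w : DiagonalCrossedProduct k H 𝒜 𝔸 →ₗ[k] B,
      DiagonalCrossedProduct.IsAlgMap w →
      w ∘ₗ DiagonalCrossedProduct.Gam k H 𝒜 𝔸 = v →
      w ∘ₗ DiagonalCrossedProduct.j k H 𝒜 𝔸 = γ.toLinearMap →
      ∀ (φ : 𝒜) (u : 𝔸), w (DiagonalCrossedProduct.mk H φ u) =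
        prodMap γ.toLinearMap (vR v φ) (qRho k H 𝔸) * γ u :=
  proposition7p1_general γ v (BimoduleAlgebra.mul_smul' (k := k))
    (fun h => ⟨BimoduleAlgebra.smul_one' h, BimoduleAlgebra.one_smul' h⟩) hcomm hmul hone
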